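/- \textbf{Model.} Let $G_{eqt}=(V,E)$ be the infinite regular triangular grid. An amoebot structure is a nonempty finite set $S\subseteq V$ that induces a connected subgraph; every node of $S$ is occupied by one amoebot, and $n=|S|$. Each amoebot has its own compass and chirality: it labels its six incident edges $0,\dots,5$ in cyclic order, starting in an arbitrary direction and proceeding clockwise or counterclockwise; these choices are arbitrary and need not agree. Every edge incident to an amoebot carries $k$ pins in a fixed linear order; neighboring amoebots share the pins of their common edge, and each amoebot numbers the pins of an edge according to its own chirality. The amoebots are anonymous, identical, randomized finite state machines (all start in the same state) that act in synchronized rounds. In each round, an amoebot (look) learns which of its labelled edges lead to neighbors and on which of its pins a beep was received, (compute) updates its state using fresh independent randomness, and (act) connects its pins by an arbitrary set of wires (edges between its own pins) and beeps on any set of its pins. The circuits are the connected components of the graph on all pins formed by all wires; a beep is received, in the next look phase, on every pin of a circuit on which at least one amoebot beeps. No beep is sent before the first round. An amoebot terminates by entering a state with verdict "yes" or "no", which it never leaves. An execution takes $t$ rounds if $t$ is the first round after which all amoebots have terminated. \textbf{Parallelograms.} $S$ forms a parallelogram with height $h$ and length $l$ ($h,l\in\mathbb N_0$, $h\le l$)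 if $S$ is the set of all grid nodes in a parallelogram whose corners are grid nodes and whose sides are parallel to two different axes of the grid and consist of $h$ and $l$ edges, respectively. It is degenerate if $h=0$. \textbf{Theorem.} Let $p\in\mathbb R[X]$ be a fixed polynomial, let $k\ge 2$ be the number of pins per edge, and let $c\in\mathbb N$. Fix either of the two conventions that degenerate parallelograms are admitted, or are not admitted. Then there are an algorithm (a randomized finite state machine as above, which depends only on $p$, $k$, $c$ and the convention) and constants $C_1,C_2>0$ such that for every amoebot structure $S$ with $n$ amoebots and for all choices of the compasses and chiralities, the following holds with probability at least $1-1/n^{c}$: the execution takes at least $C_1\log n$ and at most $C_2\log n$ rounds, and all amoebots terminate with the verdict "yes" if $S$ forms an (admitted) parallelogram with height $h$ and length $l=p(h)$ for some $h\le l$, and all terminate with the verdict "no" otherwise. In short: the amoebot structure can detect a parallelogram with polynomial side ratio $l=p(h)$ in $\Theta(\log n)$ rounds, w.h.p. -/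

import Mathlib

/-! ### The triangular grid -/

/-- Nodes of the infinite regular triangular grid, in coordinates with respect to two unit vectors
that enclose an angle of 60 degrees. -/
abbrev Node : Type := ℤ × ℤ

/-- The six directions, numbered counterclockwise. Direction `g + 3` is opposite to `g`. -/
abbrev Dir : Type := ZMod 6

/-- The unit vector of a direction. -/
def dirVec : Dir → Node :=
  (![(1, 0), (0, 1), (-1, 1), (-1, 0), (0, -1), (1, -1)] : Fin 6 → Node)

theorem dirVec_add_three (g : Dir) : dirVec (g + 3) = -dirVec g := by
  revert g; decide

theorem dirVec_ne_zero (g : Dir) : dirVec g ≠ 0 := by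
  revert g; decide

/-- The infinite regular triangular grid graph. -/
def triGrid : SimpleGraph Node where
  Adj u v := ∃ g : Dir, v = u + dirVec g
  symm := ⟨by
    rintro u v ⟨g, rfl⟩
    exact ⟨g + 3, by rw [dirVec_add_three]; abel⟩⟩
  loopless := ⟨by
    rintro u ⟨g, hg⟩
    exact dirVec_ne_zero g (by simpa using hg.symm)⟩

/-- An amoebot structure: the finite set of occupied nodes induces a connected
(in particular nonempty) subgraph of the grid. -/
def IsAmoebotStructure (S : Finset Node) : Prop :=
  (triGrid.induce (S : Set Node)).Connected

/-! ### Local labels and pins -/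

/-- The private orientation of an amoebot: the global direction that it labels `0` (its compass),
and its chirality, i.e. whether its labels increase clockwise or counterclockwise. -/
structure Frame where
  compass : Dir
  clockwise : Bool

/-- The global direction of the incident edge with local label `i`. -/
def Frame.dir (f : Frame) (i : Dir) : Dir :=
  if f.clockwise then f.compass - i else f.compass + i

/-- A pin as an amoebot names it, when each edge carries `k` pins: the local label of the edge, and
the position of the pin on that edge, counted in the sense of rotation of the amoebot. -/
abbrev LocalPin (k : ℕ) : Type := Dir × Fin k

/-- A pin of the system: an edge of the grid, given by an end node and one of the directions
`0, 1, 2` out of it, and a position on this edge. -/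
abbrev Pin (k : ℕ) : Type := Node × Dir × Fin k

/-- The `j`-th pin, counted counterclockwise around `u`, on the edge that leaves `u` in the global
direction `g`. The pins of an edge appear in opposite orders around its two end nodes. -/
def pinAt {k : ℕ} (u : Node) (g : Dir) (j : Fin k) : Pin k :=
  if g.val < 3 then (u, g, j) else (u + dirVec g, g + 3, j.rev)

/-- Neighboring nodes share the pins of their common edge. -/
theorem pinAt_opposite {k : ℕ} (u : Node) (g : Dir) (j : Fin k) :
    pinAt (u + dirVec g) (g + 3) j.rev = pinAt u g j := by
  have h : ((g + 3).val < 3) ↔ ¬ (g.val < 3) := by revert g; decide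
  have h6 : g + 3 + 3 = g := by revert g; decide
  unfold pinAt
  by_cases hg : g.val < 3
  · rw [if_neg (by rw [h]; exact not_not.2 hg), if_pos hg, dirVec_add_three, h6, Fin.rev_rev]
    simp
  · rw [if_pos (h.2 hg), if_neg hg]

/-- The pin of the system that the amoebot at `u` with orientation `f` calls `a`. -/
def Frame.pin {k : ℕ} (f : Frame) (u : Node) (a : LocalPin k) : Pin k :=
  pinAt u (f.dir a.1) (if f.clockwise then a.2.rev else a.2)

/-! ### Algorithms -/

/-- The program of uniform, anonymous, randomized finite state amoebots with `k` pins per edge.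
All amoebots start in the state `init`. In each round an amoebot draws a fresh random symbol with
law `coin`; any randomized transition function of a finite state machine arises in this way. -/
structure AmoebotAlgorithm (k : ℕ) where
  /-- the local memory -/
  State : Type
  finite_state : Finite State
  init : State
  symbols : ℕ
  coin : PMF (Fin symbols)
  /-- `step q N H r` is the new state, where `q` is the old state, `N` is the set of labels of the
  edges to occupied nodes, `H` is the set of pins on which a beep has been received, and `r` is the
  random symbol. -/
  step : State → Set Dir → Set (LocalPin k) → Fin symbols → State
  /-- the pin configuration: the wires by which an amoebot connects its pins -/
  wires : State → SimpleGraph (LocalPin k)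
  /-- the pins on whose circuits an amoebot beeps -/
  beeps : State → Set (LocalPin k)
  /-- nothing is sent before the first round -/
  init_silent : beeps init = ∅
  /-- the answer, if the amoebot has already terminated -/
  verdict : State → Option Bool
  /-- an amoebot that has terminated does not change its state any more -/
  step_of_verdict : ∀ q N H r, verdict q ≠ none → step q N H r = q

namespace AmoebotAlgorithm

variable {k : ℕ} (A : AmoebotAlgorithm k) (S : Finset Node) (frame : Node → Frame)

/-- The graph on all pins given by the wires of all amoebots, when `σ u` is the state of the
amoebot at `u`. Its connected components are the circuits. -/
def circuitGraph (σ : Node → A.State) : SimpleGraph (Pin k) :=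
  SimpleGraph.fromRel fun x y => ∃ u ∈ S, ∃ a b : LocalPin k,
    (A.wires (σ u)).Adj a b ∧ (frame u).pin u a = x ∧ (frame u).pin u b = y

/-- The pins of `u` on which a beep is received: some amoebot beeps on the same circuit. -/
def heard (σ : Node → A.State) (u : Node) : Set (LocalPin k) :=
  {a | ∃ v ∈ S, ∃ b ∈ A.beeps (σ v),
    (A.circuitGraph S frame σ).Reachable ((frame v).pin v b) ((frame u).pin u a)}

/-- The labels of the edges that lead from `u` to occupied nodes. -/
def neighbors (u : Node) : Set Dir :=
  {i | u + dirVec ((frame u).dir i) ∈ S}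

/-- The states after `t` synchronized rounds, if `ω (t, u)` is the random symbol that the amoebot
at `u` draws in round `t + 1`. (Values at nodes outside `S` are irrelevant.) -/
def run (ω : ℕ × Node → Fin A.symbols) : ℕ → Node → A.State
  | 0 => fun _ => A.init
  | t + 1 => fun u => A.step (run ω t u) (neighbors S frame u) (A.heard S frame (run ω t) u) (ω (t, u))

/-- All amoebots have terminated after `t` rounds. -/
def TerminatedBy (ω : ℕ × Node → Fin A.symbols) (t : ℕ) : Prop :=
  ∀ u ∈ S, A.verdict (A.run S frame ω t u) ≠ none

/-- The execution takes exactly `t` rounds, and all amoebots answer correctly whether `P` holds. -/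
def DecidesIn (P : Prop) (ω : ℕ × Node → Fin A.symbols) (t : ℕ) : Prop :=
  (∀ s < t, ¬ A.TerminatedBy S frame ω s) ∧
    ∃ b : Bool, (b = true ↔ P) ∧ ∀ u ∈ S, A.verdict (A.run S frame ω t u) = some b

/-- The law of the random symbols: independent over rounds and nodes, each with law `A.coin`. -/
noncomputable def coins : MeasureTheory.Measure (ℕ × Node → Fin A.symbols) :=
  MeasureTheory.Measure.infinitePi fun _ => A.coin.toMeasure

end AmoebotAlgorithm

/-! ### Parallelograms -/

/-- `S` is the set of grid nodes in a parallelogram whose corners are grid nodes and whose sides are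
parallel to two different axes of the grid and consist of `h` and `l` edges, respectively. -/
def FormsParallelogram (S : Finset Node) (h l : ℕ) : Prop :=
  ∃ (v : Node) (i j : Dir), j ≠ i ∧ j ≠ i + 3 ∧
    ∀ w : Node, w ∈ S ↔ ∃ a ≤ h, ∃ b ≤ l, w = v + a • dirVec i + b • dirVec j

/-- `S` forms a parallelogram with height `h`, length `l ≥ h` and `l = p(h)`. The proposition
`degenerate` says whether line segments, i.e. parallelograms of height `0`, are admitted. -/
def FormsPolynomialParallelogram (degenerate : Prop) (p : Polynomial ℝ) (S : Finset Node) : Prop :=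
  ∃ h l : ℕ, FormsParallelogram S h l ∧ (1 ≤ h ∨ degenerate) ∧ h ≤ l ∧ (l : ℝ) = p.eval (h : ℝ)

/-!
The theorem holds because circuits let the two sides of a parallelogram do bit-serial arithmetic on
their own lengths, at one bit per pass of constantly many rounds.

*Shape.* An amoebot sees which of its six neighbours are present, its mask. A side edge is an edge
with exactly one occupied adjacent triangle. If all masks are those of corners of 60 or 120
degrees, of nodes inside a straight side, or of interior nodes, and if every maximal straight run
of side edges has one acute and one obtuse end, then the structure is a parallelogram
(`exists_isPara`). If only these masks and those of a segment occur, and one of the latter does,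
the structure is a segment (`exists_isSegment`). A segment has only one admissible length, a
constant, which is tested by removing nodes from both ends (`Detector.IsSegment.fail_iff`).

*Orientation.* Compasses and chiralities give no common direction to the two ends of an edge. On
every side edge the ends toss coins until the results differ; afterwards each end owns one of the
two pins used on the edge. A node inside a side connects the pins of its two side edges in such a
way that a beep from the acute corner arrives everywhere on the pin of the nearer end
(`Detector.Tossing.sig_orient`). Thus all nodes learn the direction towards the acute corner, and a
second beep from the obtuse corners verifies that the two kinds of corners alternate. Which of the
two pins of a side edge is the outer one is visible to both ends, from the occupied triangle, and
so chirality does not matter.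

*Arithmetic.* In pass `s`, the nodes of a side whose distance to the acute corner is divisible by
`2 ^ s` exchange the two tracks. A beep from the acute corner then tells every node the digit of
weight `2 ^ s` of its distance to this corner (`crossParity_dvd`), and the obtuse corner broadcasts
the digit of the length `L`. The real polynomial is first replaced by an integral one: `l = p(h)`
is equivalent on the natural numbers to `D * l = q(h)` for some `D > 0` and `q` with integer
coefficients (`exists_int_equation`). The value `q(L)` is computed by Horner's scheme,
least significant digit first, with one carry-save multiplier per coefficient. The cells of the
multipliers are the nodes of the side, which suffice because `L < 2 ^ L`; `output_add` is the
invariant. As digits are produced in two's complement, signs need no attention. At the obtuse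
corners the test `D * l = q(h)` and the comparison `h ≤ l` are made serially against the digits of
the other side (`Detector.Start.succ`). After `T` passes they are exact if `2 ^ T` exceeds both
lengths and `|D * l - q(h)|` (`Detector.IsCorner.exists_port_iff`), hence `O(log n)` passes suffice.

*Clock.* The amoebots cannot count to `log n`. An amoebot stays alive until it draws the symbol
`0`, and the passes are repeated until, on a circuit through the whole structure, nobody alive is
heard (`Detector.At.exists_passes`). The last of `n` amoebots drops out after `Θ(log n)` rounds
with high probability; choosing the number of symbols large makes the lower bound as large a
multiple of `log n` as the arithmetic needs (`exists_survival`). Together with the union bound over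
the coin tosses on the edges (`le_tosses_favourable`), this yields the probability `1 - 1 / n ^ c`,
since for favourable coin tosses the algorithm is correct without exception
(`Detector.exists_decidesIn`).
-/

/-! ### Masks, side edges and tracks -/

/-- The mask of a node: which of the six neighbouring grid nodes are occupied. -/
abbrev Mask : Type := Dir → Bool

/-- The edge in direction `i` is a *side edge*: it leads to an occupied node, and exactly one of the
two nodes that complete the edge to a triangle is occupied. -/
def side (N : Mask) (i : Dir) : Bool := N i && (N (i + 1) != N (i - 1))

/-- The two pins of a side edge that are used: track `false` is the pin next to the empty triangle,
track `true` the one next to the occupied triangle. Both end nodes agree on this. -/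
def trackPin (K : ℕ) (N : Mask) (i : Dir) (b : Bool) : Fin (K + 2) :=
  if N (i + 1) = b then Fin.last (K + 1) else 0

theorem trackPin_injective {K : ℕ} {N : Mask} {i : Dir} {b b' : Bool}
    (h : trackPin K N i b = trackPin K N i b') : b = b' := by
  have h0 : (Fin.last (K + 1)) ≠ 0 := by simp [Fin.ext_iff]
  unfold trackPin at h
  cases hN : N (i + 1) <;> cases b <;> cases b' <;> simp_all

namespace Frame

variable (f : Frame)

/-- The local label of a global direction. -/
def lab (g : Dir) : Dir := if f.clockwise then f.compass - g else g - f.compass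

@[simp] theorem dir_lab (g : Dir) : f.dir (f.lab g) = g := by
  unfold dir lab; split <;> ring

@[simp] theorem lab_dir (i : Dir) : f.lab (f.dir i) = i := by
  unfold dir lab; split <;> ring

theorem dir_injective : Function.Injective f.dir := fun i j h => by
  rw [← f.lab_dir i, h, lab_dir]

theorem dir_add_three (i : Dir) : f.dir (i + 3) = f.dir i + 3 := by
  unfold dir
  split
  · have : (3 : Dir) = -3 := by decide
    rw [sub_add_eq_sub_sub, sub_eq_add_neg, ← this]
  · ring

theorem lab_add_three (g : Dir) : f.lab (g + 3) = f.lab g + 3 := by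
  apply f.dir_injective
  rw [dir_add_three, dir_lab, dir_lab]

theorem dir_succ (i : Dir) :
    (f.clockwise = false ∧ f.dir (i + 1) = f.dir i + 1 ∧ f.dir (i - 1) = f.dir i - 1) ∨
    (f.clockwise = true ∧ f.dir (i + 1) = f.dir i - 1 ∧ f.dir (i - 1) = f.dir i + 1) := by
  unfold dir
  cases f.clockwise
  · left; refine ⟨rfl, ?_, ?_⟩ <;> simp <;> ring
  · right; refine ⟨rfl, ?_, ?_⟩ <;> simp <;> ring

theorem side_comp_dir (N : Mask) (i : Dir) : side (N ∘ f.dir) i = side N (f.dir i) := by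
  rcases f.dir_succ i with ⟨-, h1, h2⟩ | ⟨-, h1, h2⟩
  · simp [side, h1, h2]
  · simp only [side, Function.comp, h1, h2]
    cases N (f.dir i) <;> cases N (f.dir i + 1) <;> cases N (f.dir i - 1) <;> rfl

end Frame

/-- The global mask of the node `u` in the structure `S`. -/
def gmask (S : Finset Node) (u : Node) : Mask := fun g => decide (u + dirVec g ∈ S)

/-- The edge of `u` in direction `g` is a side edge of the structure `S`. -/
def GSide (S : Finset Node) (u : Node) (g : Dir) : Prop := u ∈ S ∧ side (gmask S u) g = true

/-- The pin of a side edge that belongs to the given track. -/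
def gpin (K : ℕ) (S : Finset Node) (u : Node) (g : Dir) (b : Bool) : Pin (K + 2) :=
  pinAt u g (trackPin K (gmask S u) g b)

theorem dirVec_step (g : Dir) : dirVec g + dirVec (g + 2) = dirVec (g + 1) := by
  revert g; decide

theorem dirVec_step' (g : Dir) : dirVec g + dirVec (g - 2) = dirVec (g - 1) := by
  revert g; decide

theorem gmask_opposite {S : Finset Node} {u : Node} {g : Dir} :
    gmask S (u + dirVec g) (g + 3 + 1) = gmask S u (g - 1) ∧
    gmask S (u + dirVec g) (g + 3 - 1) = gmask S u (g + 1) ∧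
    (u ∈ S → gmask S (u + dirVec g) (g + 3) = true) := by
  have e1 : g + 3 + 1 = g - 2 := by revert g; decide
  have e2 : g + 3 - 1 = g + 2 := by ring
  refine ⟨?_, ?_, ?_⟩
  · rw [e1]; simp only [gmask, add_assoc, dirVec_step']
  · rw [e2]; simp only [gmask, add_assoc, dirVec_step]
  · intro hu; simp [gmask, add_assoc, dirVec_add_three, hu]

theorem GSide.mem {S : Finset Node} {u : Node} {g : Dir} (h : GSide S u g) : u ∈ S := h.1

theorem GSide.next_mem {S : Finset Node} {u : Node} {g : Dir} (h : GSide S u g) :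
    u + dirVec g ∈ S := by
  have := h.2
  simp only [side, gmask, Bool.and_eq_true, decide_eq_true_eq] at this
  exact this.1

theorem add_three_add_three (g : Dir) : g + 3 + 3 = g := by revert g; decide

theorem add_dirVec_add_three (u : Node) (g : Dir) : u + dirVec g + dirVec (g + 3) = u := by
  rw [dirVec_add_three]; abel

theorem GSide.opposite {S : Finset Node} {u : Node} {g : Dir} (h : GSide S u g) :
    GSide S (u + dirVec g) (g + 3) := by
  refine ⟨h.next_mem, ?_⟩
  obtain ⟨h1, h2, h3⟩ := gmask_opposite (S := S) (u := u) (g := g)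
  have := h.2
  simp only [side, h1, h2, h3 h.1] at this ⊢
  cases hp : gmask S u (g + 1) <;> cases hm : gmask S u (g - 1) <;> simp_all

theorem gpin_opposite {K : ℕ} {S : Finset Node} {u : Node} {g : Dir} (h : GSide S u g) (b : Bool) :
    gpin K S (u + dirVec g) (g + 3) b = gpin K S u g b := by
  unfold gpin
  rw [← pinAt_opposite u g]
  congr 1
  obtain ⟨h1, h2, h3⟩ := gmask_opposite (S := S) (u := u) (g := g)
  have h4 := h.2
  simp only [side, Bool.and_eq_true] at h4
  unfold trackPin
  rw [h1]
  cases hp : gmask S u (g + 1) <;> cases hm : gmask S u (g - 1) <;> cases b <;> simp_all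

theorem pinAt_injective {k : ℕ} {u u' : Node} {g g' : Dir} {j j' : Fin k}
    (h : pinAt u g j = pinAt u' g' j') :
    (u = u' ∧ g = g' ∧ j = j') ∨ (u' = u + dirVec g ∧ g' = g + 3 ∧ j' = j.rev) := by
  have key : ∀ g : Dir, ((g + 3).val < 3) ↔ ¬ (g.val < 3) := by decide
  have aux : ∀ {u u' : Node} {g g' : Dir} {j j' : Fin k}, g.val < 3 →
      pinAt u g j = pinAt u' g' j' →
      (u = u' ∧ g = g' ∧ j = j') ∨ (u' = u + dirVec g ∧ g' = g + 3 ∧ j' = j.rev) := by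
    intro u u' g g' j j' hg h
    unfold pinAt at h
    rw [if_pos hg] at h
    split_ifs at h with hg'
    · left; simpa using h
    · right
      simp only [Prod.mk.injEq] at h
      obtain ⟨h1, h2, h3⟩ := h
      refine ⟨?_, ?_, ?_⟩
      · rw [h1, h2, dirVec_add_three]; abel
      · rw [h2, add_three_add_three]
      · rw [h3, Fin.rev_rev]
  by_cases hg : g.val < 3
  · exact aux hg h
  · have h' := h
    rw [← pinAt_opposite u g] at h'
    rcases aux ((key g).2 hg) h' with ⟨h1, h2, h3⟩ | ⟨h1, h2, h3⟩
    · right; exact ⟨h1.symm, h2.symm, h3.symm⟩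
    · left
      refine ⟨?_, ?_, ?_⟩
      · rw [h1, add_dirVec_add_three]
      · rw [h2, add_three_add_three]
      · rw [h3, Fin.rev_rev]

theorem gpin_injective {K : ℕ} {S : Finset Node} {u u' : Node} {g g' : Dir} {b b' : Bool}
    (hs : GSide S u g) (h : gpin K S u g b = gpin K S u' g' b') :
    b = b' ∧ ((u' = u ∧ g' = g) ∨ (u' = u + dirVec g ∧ g' = g + 3)) := by
  rcases pinAt_injective h with ⟨h1, h2, h3⟩ | ⟨h1, h2, h3⟩
  · subst h1 h2
    exact ⟨trackPin_injective h3, Or.inl ⟨rfl, rfl⟩⟩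
  · subst h1 h2
    rw [gpin_opposite hs] at h
    rcases pinAt_injective h with ⟨-, -, h3⟩ | ⟨h1, -, -⟩
    · exact ⟨trackPin_injective h3, Or.inr ⟨rfl, rfl⟩⟩
    · exact absurd h1 (by simpa using (dirVec_ne_zero g))

theorem Frame.pin_eq_pinAt {k : ℕ} (f : Frame) (u : Node) (i : Dir) (j : Fin k) :
    f.pin u (i, j) = pinAt u (f.dir i) (if f.clockwise then j.rev else j) := rfl

/-- The local pin by which a node addresses a track of a side edge is the pin of that track. -/
theorem Frame.pin_trackPin {K : ℕ} (f : Frame) {S : Finset Node} {u : Node} {i : Dir}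
    (hs : side (gmask S u) (f.dir i) = true) (b : Bool) :
    f.pin u (i, trackPin K (gmask S u ∘ f.dir) i b) = gpin K S u (f.dir i) b := by
  rw [f.pin_eq_pinAt]
  unfold gpin
  congr 1
  simp only [side, Bool.and_eq_true] at hs
  unfold trackPin
  rcases f.dir_succ i with ⟨hc, h1, h2⟩ | ⟨hc, h1, h2⟩
  · simp [hc, h1]
  · simp only [hc, if_true, Function.comp, h1]
    cases hp : gmask S u (f.dir i + 1) <;> cases hm : gmask S u (f.dir i - 1) <;> cases b <;>
      simp_all

/-- The wires of the straight sides: a node with side edges in two opposite directions `i` and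
`i + 3` connects their tracks, exchanging the two tracks if `c i`. -/
def lineWires (K : ℕ) (N : Mask) (c : Dir → Bool) : SimpleGraph (LocalPin (K + 2)) :=
  SimpleGraph.fromRel fun a b => ∃ i β, side N i = true ∧ side N (i + 3) = true ∧
    a = (i, trackPin K N i β) ∧ b = (i + 3, trackPin K N (i + 3) (β ^^ c i))

/-! ### Circuits along the sides -/

/-- A signal arrives on track `b` of the side edge of `u` in direction `g`, when `snd v g' b'` says
that `v` beeps on track `b'` of its side edge in direction `g'` and `G` is the graph of wires. -/
def Hears {K : ℕ} (G : SimpleGraph (Pin (K + 2))) (S : Finset Node)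
    (snd : Node → Dir → Bool → Prop) (u : Node) (g : Dir) (b : Bool) : Prop :=
  ∃ v g' b', GSide S v g' ∧ snd v g' b' ∧ G.Reachable (gpin K S v g' b') (gpin K S u g b)

theorem hears_opposite {K : ℕ} {G : SimpleGraph (Pin (K + 2))} {S : Finset Node}
    {snd : Node → Dir → Bool → Prop} {u : Node} {g : Dir} (h : GSide S u g) (b : Bool) :
    Hears G S snd (u + dirVec g) (g + 3) b ↔ Hears G S snd u g b := by
  unfold Hears; rw [gpin_opposite h]

theorem hears_bot {K : ℕ} {S : Finset Node}
    {snd : Node → Dir → Bool → Prop} {u : Node} {g : Dir} (h : GSide S u g) (b : Bool) :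
    Hears (K := K) ⊥ S snd u g b ↔ snd u g b ∨ snd (u + dirVec g) (g + 3) b := by
  constructor
  · rintro ⟨v, g', b', -, hsnd, hr⟩
    rw [SimpleGraph.reachable_bot] at hr
    obtain ⟨rfl, ⟨rfl, rfl⟩ | ⟨rfl, rfl⟩⟩ := gpin_injective h hr.symm
    · exact Or.inl hsnd
    · exact Or.inr hsnd
  · rintro (hs | hs)
    · exact ⟨u, g, b, h, hs, SimpleGraph.Reachable.refl _⟩
    · exact ⟨_, _, b, h.opposite, hs, by rw [gpin_opposite h]⟩

/-- The wires of all sides in global terms: `cr u g` says that `u` exchanges the two tracks of the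
straight line through `u` in direction `g`. -/
def SideCircuits {K : ℕ} (G : SimpleGraph (Pin (K + 2))) (S : Finset Node)
    (cr : Node → Dir → Bool) : Prop :=
  (∀ p q, G.Adj p q → ∃ u g β, GSide S u g ∧ GSide S u (g + 3) ∧
    p = gpin K S u g β ∧ q = gpin K S u (g + 3) (β ^^ cr u g)) ∧
  (∀ u g β, GSide S u g → GSide S u (g + 3) →
    G.Reachable (gpin K S u g β) (gpin K S u (g + 3) (β ^^ cr u g)))

/-- The node `x` steps away from `v` in direction `g`. -/
def lineNode (v : Node) (g : Dir) (x : ℕ) : Node := v + x • dirVec g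

@[simp] theorem lineNode_zero (v : Node) (g : Dir) : lineNode v g 0 = v := by simp [lineNode]

theorem lineNode_succ (v : Node) (g : Dir) (x : ℕ) :
    lineNode v g (x + 1) = lineNode v g x + dirVec g := by
  simp [lineNode, add_smul, add_assoc]

/-- A maximal straight run of `L` side edges that starts at `v` in direction `g`. -/
structure IsRun (S : Finset Node) (v : Node) (g : Dir) (L : ℕ) : Prop where
  pos : 1 ≤ L
  side : ∀ x < L, GSide S (lineNode v g x) g
  not_before : ¬ GSide S v (g + 3)
  not_after : ¬ GSide S (lineNode v g L) g

theorem IsRun.side_back {S : Finset Node} {v : Node} {g : Dir} {L : ℕ} (h : IsRun S v g L) {x : ℕ}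
    (hx : x < L) : GSide S (lineNode v g (x + 1)) (g + 3) := by
  rw [lineNode_succ]; exact (h.side x hx).opposite

/-- The parity of the number of exchanges among the nodes `1, …, x`. -/
def crossParity (c : ℕ → Bool) : ℕ → Bool
  | 0 => false
  | x + 1 => crossParity c x ^^ c (x + 1)

/-- On a run, the circuits are determined by the parity of the number of exchanges. -/
theorem IsRun.hears_iff {K : ℕ} {G : SimpleGraph (Pin (K + 2))} {S : Finset Node}
    {cr : Node → Dir → Bool} (hG : SideCircuits G S cr) (hcr : ∀ u g, cr u (g + 3) = cr u g)
    {snd : Node → Dir → Bool → Prop} {v : Node} {g : Dir} {L : ℕ} (h : IsRun S v g L)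
    {x : ℕ} (hx : x < L) (b : Bool) :
    Hears G S snd (lineNode v g x) g b ↔ ∃ y < L, ∃ b',
      (snd (lineNode v g y) g b' ∨ snd (lineNode v g (y + 1)) (g + 3) b') ∧
      (b ^^ crossParity (fun z => cr (lineNode v g z) g) x) =
        (b' ^^ crossParity (fun z => cr (lineNode v g z) g) y) := by
  set par := crossParity (fun z => cr (lineNode v g z) g) with hpar
  have hsucc : ∀ z, par (z + 1) = (par z ^^ cr (lineNode v g (z + 1)) g) := fun z => rfl
  constructor
  · rintro ⟨w, g', b', hw, hsnd, hr⟩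
    set κ : Bool := b ^^ par x with hκ
    -- the pins that are reached from a pin of the run stay on the track given by the parity
    have hclosed : ∀ p q, G.Reachable p q → (∃ y < L, q = gpin K S (lineNode v g y) g (κ ^^ par y)) →
        ∃ y < L, p = gpin K S (lineNode v g y) g (κ ^^ par y) := by
      intro p q hpq hq
      induction hpq.symm with
      | intro walk =>
        clear hpq
        induction walk with
        | nil => exact hq
        | @cons q' p' r hadj _ ih =>
          apply ih
          obtain ⟨y, hy, rfl⟩ := hq
          obtain ⟨u, d, β, hu, hu3, hpe, hqe⟩ := hG.1 _ _ hadj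
          obtain ⟨hβ, ⟨rfl, rfl⟩ | ⟨rfl, rfl⟩⟩ := gpin_injective (h.side y hy) hpe
          · cases y with
            | zero => rw [lineNode_zero] at hu3; exact absurd hu3 h.not_before
            | succ y =>
              refine ⟨y, by omega, ?_⟩
              have hs := h.side y (by omega)
              rw [hqe, lineNode_succ, gpin_opposite hs, ← lineNode_succ]
              congr 1
              rw [← hβ, hsucc]
              cases κ <;> cases par y <;> cases cr (lineNode v d (y + 1)) d <;> rfl
          · rw [add_three_add_three] at hu3 hqe
            rw [← lineNode_succ] at hu3 hqe
            have hy' : y + 1 < L := by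
              rcases Nat.lt_or_ge (y + 1) L with h' | h'
              · exact h'
              · have : y + 1 = L := by omega
                rw [this] at hu3
                exact absurd hu3 h.not_after
            refine ⟨y + 1, hy', ?_⟩
            rw [hqe]
            congr 1
            rw [← hβ, hsucc, hcr]
            cases κ <;> cases par y <;> cases cr (lineNode v g (y + 1)) g <;> rfl
    obtain ⟨y, hy, hp⟩ := hclosed _ _ hr ⟨x, hx, by
      rw [hκ]; congr 1; cases b <;> cases par x <;> rfl⟩
    obtain ⟨hb, ⟨rfl, rfl⟩ | ⟨rfl, rfl⟩⟩ := gpin_injective (h.side y hy) hp.symm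
    · exact ⟨y, hy, b', Or.inl hsnd, by rw [← hb]; cases κ <;> cases par y <;> rfl⟩
    · rw [← lineNode_succ] at hsnd
      exact ⟨y, hy, b', Or.inr hsnd, by rw [← hb]; cases κ <;> cases par y <;> rfl⟩
  · rintro ⟨y, hy, b', hsnd, heq⟩
    have hreach : ∀ y < L, ∀ κ : Bool, G.Reachable (gpin K S (lineNode v g 0) g κ)
        (gpin K S (lineNode v g y) g (κ ^^ par y)) := by
      intro y
      induction y with
      | zero => intro _ κ; simp [hpar, crossParity]
      | succ y ih =>
        intro hy κ
        refine (ih (by omega) κ).trans ?_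
        have hs := h.side y (by omega)
        have := hG.2 (lineNode v g (y + 1)) (g + 3) (κ ^^ par y) (h.side_back (by omega))
          (by rw [add_three_add_three]; exact h.side (y + 1) hy)
        rw [add_three_add_three] at this
        rw [← gpin_opposite hs, ← lineNode_succ]
        convert this using 2
        rw [hcr, hsucc]
        cases κ <;> cases par y <;> cases cr (lineNode v g (y + 1)) g <;> rfl
    have h1 := hreach y hy (b' ^^ par y)
    have h2 := hreach x hx (b ^^ par x)
    rw [heq] at h2
    have e1 : (b' ^^ par y ^^ par y) = b' := by cases b' <;> cases par y <;> rfl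
    have e2 : (b' ^^ par y ^^ par x) = b := by
      rw [← heq]; cases b <;> cases par x <;> rfl
    rw [e1] at h1
    rw [e2] at h2
    have h3 := h1.symm.trans h2
    rcases hsnd with hs | hs
    · exact ⟨_, _, b', h.side y hy, hs, h3⟩
    · refine ⟨_, _, b', h.side_back hy, hs, ?_⟩
      rw [lineNode_succ, gpin_opposite (h.side y hy)]
      exact h3

/-! ### Circuits of an algorithm -/

namespace AmoebotAlgorithm

variable {K : ℕ} (A : AmoebotAlgorithm (K + 2)) (S : Finset Node) (frame : Node → Frame)

/-- The mask of a node in terms of its own labels. -/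
def lmask (u : Node) : Mask := gmask S u ∘ (frame u).dir

theorem side_lmask (u : Node) (i : Dir) :
    side (lmask S frame u) i = side (gmask S u) ((frame u).dir i) :=
  (frame u).side_comp_dir _ _

theorem circuitGraph_eq_bot {σ : Node → A.State} (h : ∀ u ∈ S, A.wires (σ u) = ⊥) :
    A.circuitGraph S frame σ = ⊥ := by
  ext x y
  simp only [circuitGraph, SimpleGraph.fromRel_adj, SimpleGraph.bot_adj, iff_false, not_and, not_or,
    not_exists]
  intro _
  constructor <;> · intro u hu a b hab; rw [h u hu] at hab; exact hab.elim

theorem circuitGraph_reachable {σ : Node → A.State} {u : Node} (hu : u ∈ S)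
    {a b : LocalPin (K + 2)} (hab : (A.wires (σ u)).Adj a b) :
    (A.circuitGraph S frame σ).Reachable ((frame u).pin u a) ((frame u).pin u b) := by
  by_cases hne : (frame u).pin u a = (frame u).pin u b
  · rw [hne]
  · apply SimpleGraph.Adj.reachable
    rw [circuitGraph, SimpleGraph.fromRel_adj]
    exact ⟨hne, Or.inl ⟨u, hu, a, b, hab, rfl, rfl⟩⟩

theorem sideCircuits {σ : Node → A.State} {c : Node → Dir → Bool}
    (hw : ∀ u ∈ S, A.wires (σ u) = lineWires K (lmask S frame u) (c u))
    (hc : ∀ u i, c u (i + 3) = c u i) :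
    SideCircuits (A.circuitGraph S frame σ) S (fun u g => c u ((frame u).lab g)) := by
  have hpin : ∀ {u i b}, side (lmask S frame u) i = true →
      (frame u).pin u (i, trackPin K (lmask S frame u) i b) = gpin K S u ((frame u).dir i) b := by
    intro u i b hs
    rw [side_lmask] at hs
    exact (frame u).pin_trackPin hs b
  have key : ∀ p q : Pin (K + 2), ∀ u ∈ S, ∀ a b, (A.wires (σ u)).Adj a b →
      (frame u).pin u a = p → (frame u).pin u b = q →
      ∃ u g β, GSide S u g ∧ GSide S u (g + 3) ∧ p = gpin K S u g β ∧
        q = gpin K S u (g + 3) (β ^^ c u ((frame u).lab g)) := by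
    rintro p q u hu a b hab rfl rfl
    rw [hw u hu, lineWires, SimpleGraph.fromRel_adj] at hab
    rcases hab.2 with ⟨i, β, h1, h2, rfl, rfl⟩ | ⟨i, β, h1, h2, rfl, rfl⟩
    · refine ⟨u, (frame u).dir i, β, ⟨hu, by rwa [← side_lmask S frame]⟩, ⟨hu, ?_⟩, hpin h1, ?_⟩
      · rw [← Frame.dir_add_three, ← side_lmask S frame]; exact h2
      · rw [hpin h2, Frame.dir_add_three, Frame.lab_dir]
    · refine ⟨u, (frame u).dir (i + 3), β ^^ c u i, ⟨hu, by rwa [← side_lmask S frame]⟩,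
        ⟨hu, ?_⟩, hpin h2, ?_⟩
      · rw [Frame.dir_add_three, add_three_add_three, ← side_lmask S frame]; exact h1
      · rw [hpin h1, Frame.lab_dir, Frame.dir_add_three, add_three_add_three, hc]
        congr 1
        cases β <;> cases c u i <;> rfl
  constructor
  · intro p q hpq
    rw [circuitGraph, SimpleGraph.fromRel_adj] at hpq
    rcases hpq.2 with ⟨u, hu, a, b, hab, h1, h2⟩ | ⟨u, hu, a, b, hab, h1, h2⟩
    · exact key p q u hu a b hab h1 h2
    · exact key p q u hu b a hab.symm h2 h1
  · intro u g β h1 h2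
    have e1 : side (lmask S frame u) ((frame u).lab g) = true := by
      rw [side_lmask, Frame.dir_lab]; exact h1.2
    have e2 : side (lmask S frame u) ((frame u).lab g + 3) = true := by
      rw [side_lmask, Frame.dir_add_three, Frame.dir_lab]; exact h2.2
    have := A.circuitGraph_reachable S frame (σ := σ) h1.1
      (a := ((frame u).lab g, trackPin K (lmask S frame u) ((frame u).lab g) β))
      (b := ((frame u).lab g + 3, trackPin K (lmask S frame u) ((frame u).lab g + 3)
        (β ^^ c u ((frame u).lab g)))) (by
        rw [hw u h1.1, lineWires, SimpleGraph.fromRel_adj]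
        refine ⟨?_, Or.inl ⟨_, β, e1, e2, rfl, rfl⟩⟩
        intro h
        have := (Prod.ext_iff.1 h).1
        simp only at this
        have h3 : (3 : Dir) = 0 := by simpa using this
        exact absurd h3 (by decide))
    rw [hpin e1, hpin e2, Frame.dir_add_three, Frame.dir_lab] at this
    exact this

/-- The beeps of a state that beeps on tracks of side edges only. -/
def trackBeeps (K : ℕ) (N : Mask) (s : Dir → Bool → Prop) : Set (LocalPin (K + 2)) :=
  {a | ∃ i b, side N i = true ∧ a = (i, trackPin K N i b) ∧ s i b}

theorem heard_track_iff {σ : Node → A.State} {s : Node → Dir → Bool → Prop}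
    (hb : ∀ u ∈ S, A.beeps (σ u) = trackBeeps K (lmask S frame u) (s u))
    {u : Node} {i : Dir} (hs : side (lmask S frame u) i = true) (b : Bool) :
    (i, trackPin K (lmask S frame u) i b) ∈ A.heard S frame σ u ↔
      Hears (A.circuitGraph S frame σ) S (fun v g b => s v ((frame v).lab g) b) u
        ((frame u).dir i) b := by
  have hpin : ∀ {u i b}, side (lmask S frame u) i = true →
      (frame u).pin u (i, trackPin K (lmask S frame u) i b) = gpin K S u ((frame u).dir i) b := by
    intro u i b hs
    rw [side_lmask] at hs
    exact (frame u).pin_trackPin hs b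
  constructor
  · rintro ⟨v, hv, a, ha, hr⟩
    rw [hb v hv] at ha
    obtain ⟨i', b', h1, rfl, h3⟩ := ha
    refine ⟨v, (frame v).dir i', b', ⟨hv, by rwa [← side_lmask S frame]⟩, by simpa using h3, ?_⟩
    rw [hpin h1, hpin hs] at hr
    exact hr
  · rintro ⟨v, g', b', h1, h2, hr⟩
    have e1 : side (lmask S frame v) ((frame v).lab g') = true := by
      rw [side_lmask, Frame.dir_lab]; exact h1.2
    refine ⟨v, h1.1, ((frame v).lab g', trackPin K (lmask S frame v) ((frame v).lab g') b'), ?_, ?_⟩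
    · rw [hb v h1.1]
      exact ⟨_, _, e1, rfl, h2⟩
    · rw [hpin e1, hpin hs, Frame.dir_lab]
      exact hr

/-- If all nodes connect all their pins, every beep is received everywhere. -/
theorem heard_of_wires_top (hS : IsAmoebotStructure S) {σ : Node → A.State}
    (hw : ∀ u ∈ S, A.wires (σ u) = ⊤) {u : Node} (hu : u ∈ S) (a : LocalPin (K + 2)) :
    a ∈ A.heard S frame σ u ↔ ∃ v ∈ S, (A.beeps (σ v)).Nonempty := by
  constructor
  · rintro ⟨v, hv, b, hb, -⟩
    exact ⟨v, hv, b, hb⟩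
  · rintro ⟨v, hv, b, hb⟩
    refine ⟨v, hv, b, hb, ?_⟩
    have hown : ∀ u ∈ S, ∀ a b, (A.circuitGraph S frame σ).Reachable ((frame u).pin u a)
        ((frame u).pin u b) := by
      intro u hu a b
      by_cases hab : a = b
      · rw [hab]
      · exact A.circuitGraph_reachable S frame hu (by rw [hw u hu]; exact hab)
    have hnb : ∀ u ∈ S, ∀ w ∈ S, triGrid.Adj u w → ∀ a b,
        (A.circuitGraph S frame σ).Reachable ((frame u).pin u a) ((frame w).pin w b) := by
      rintro u hu w hw' ⟨g, rfl⟩ a b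
      set f := frame u with hf
      set f' := frame (u + dirVec g) with hf'
      have e : f.pin u (f.lab g, if f.clockwise then (0 : Fin (K + 2)).rev else 0) =
          f'.pin (u + dirVec g) (f'.lab (g + 3), if f'.clockwise then (0 : Fin (K + 2)) else
            (0 : Fin (K + 2)).rev) := by
        rw [Frame.pin_eq_pinAt, Frame.pin_eq_pinAt, Frame.dir_lab, Frame.dir_lab,
          ← pinAt_opposite u g]
        congr 1
        cases f.clockwise <;> cases f'.clockwise <;> simp
      have h1 := hown u hu a (f.lab g, if f.clockwise then (0 : Fin (K + 2)).rev else 0)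
      rw [← hf, e] at h1
      exact h1.trans (hown _ hw' _ b)
    obtain ⟨walk⟩ := hS.preconnected ⟨v, hv⟩ ⟨u, hu⟩
    suffices H : ∀ (x y : (S : Set Node)), (triGrid.induce (S : Set Node)).Walk x y → ∀ a b,
        (A.circuitGraph S frame σ).Reachable ((frame x).pin x a) ((frame y).pin y b) from
      H _ _ walk b a
    intro x y p
    induction p with
    | nil => intro a b; exact hown _ (Subtype.coe_prop _) a b
    | @cons x y z hadj _ ih =>
      intro a b
      exact (hnb x x.2 y y.2 hadj a a).trans (ih a b)

end AmoebotAlgorithm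

/-! ### The algorithm -/

/-- The mask consists of `r` consecutive directions. -/
def isArc (N : Mask) (r : ℕ) : Prop := ∃ j : Dir, ∀ s, N s = decide ((s - j).val < r)

instance (N : Mask) (r : ℕ) : Decidable (isArc N r) := by unfold isArc; infer_instance

/-- The mask of a node of a straight line segment of at least two nodes. -/
def isSeg (N : Mask) : Prop := isArc N 1 ∨ ∃ j : Dir, ∀ s, N s = decide (s = j ∨ s = j + 3)

instance (N : Mask) : Decidable (isSeg N) := by unfold isSeg; infer_instance

/-- The masks that occur in a nondegenerate convex polygon: corners of 60 and of 120 degrees, other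
nodes of the boundary, interior nodes. -/
def isConvex (N : Mask) : Prop := isArc N 2 ∨ isArc N 3 ∨ isArc N 4 ∨ isArc N 6

instance (N : Mask) : Decidable (isConvex N) := by unfold isConvex; infer_instance

/-- The data of a detector for parallelograms with `D * l = q h`, where `q` is an integer
polynomial. -/
structure Detector where
  /-- an edge carries `K + 2` pins, two of which are used as tracks -/
  K : ℕ
  /-- a bound for the degree of `q` -/
  d : ℕ
  /-- the coefficients of `q` in Horner order, `coef 0` belonging to the degree `d` -/
  coef : Fin (d + 1) → ℤ
  D : ℕ
  /-- a bound for all carries -/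
  B : ℕ
  /-- the length of the admitted line segment, if there is one -/
  seg : Option ℕ
  /-- a random symbol is one of `2 * (m + 1)` numbers: its parity serves as a fair coin, and `0`,
  which is rare if `m` is large, makes an amoebot leave the clock -/
  m : ℕ
  one_le_B : 1 ≤ B
  D_le : D ≤ B
  coef_le : ∀ j, |coef j| ≤ B

namespace Detector

/-- The program counter. All amoebots always have the same one. From `tie` and `tieAll`, which toss
the coins of the side edges, the program proceeds to the orientation of the sides (`orient`, `check`),
to the test of the length of a segment (`hop`, `hopAll`), and to the passes from `parity` to `clock`,
each of which treats one binary digit. -/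
inductive PC (d r₀ : ℕ) : Type
  | init | tie | tieAll | orient | check
  | hop (r : Fin (r₀ + 1))
  | hopAll | parity | length | token
  | mul (j : Fin (d + 1))
  | shift (j : Fin (d + 1))
  | compare | clock | final
  | done (b : Bool)

instance (d r₀ : ℕ) : Finite (PC d r₀) := by
  let f : PC d r₀ → Fin 16 × Fin (r₀ + 1) × Fin (d + 1) × Bool := fun
    | .init => (0, 0, 0, false)
    | .tie => (1, 0, 0, false)
    | .tieAll => (2, 0, 0, false)
    | .orient => (3, 0, 0, false)
    | .check => (4, 0, 0, false)
    | .hop r => (5, r, 0, false)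
    | .hopAll => (6, 0, 0, false)
    | .parity => (7, 0, 0, false)
    | .length => (8, 0, 0, false)
    | .token => (9, 0, 0, false)
    | .mul j => (10, 0, j, false)
    | .shift j => (11, 0, j, false)
    | .compare => (12, 0, 0, false)
    | .clock => (13, 0, 0, false)
    | .final => (14, 0, 0, false)
    | .done b => (15, 0, 0, b)
  refine Finite.of_injective f ?_
  intro a b h
  cases a <;> cases b <;> simp_all [f]

/-- The next value of the program counter; `h` says whether a beep has been received. -/
def PC.next {d r₀ : ℕ} (h : Bool) : PC d r₀ → PC d r₀
  | init => tie
  | tie => tieAll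
  | tieAll => if h then tie else orient
  | orient => check
  | check => hop 0
  | hop r => if hr : r.val < r₀ then hop ⟨r + 1, by omega⟩ else hopAll
  | hopAll => parity
  | parity => length
  | length => token
  | token => mul 0
  | mul j => shift j
  | shift j => if hj : j.val < d then mul ⟨j + 1, by omega⟩ else compare
  | compare => clock
  | clock => if h then parity else final
  | final => done (!h)
  | done b => done b

/-- A bounded carry. -/
abbrev Carry (B : ℕ) : Type := Set.Icc (-(B : ℤ)) (B : ℤ)

theorem neg_le_self (B : ℕ) : -(B : ℤ) ≤ B := by omega

/-- The carry with the given value, provided that this is in range. -/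
def clamp (B : ℕ) (z : ℤ) : Carry B := Set.projIcc _ _ (neg_le_self B) z

theorem clamp_coe {B : ℕ} {z : ℤ} (h : |z| ≤ B) : (clamp B z : ℤ) = z := by
  have := Set.projIcc_of_mem (neg_le_self B) (x := z) ⟨(abs_le.1 h).1, (abs_le.1 h).2⟩
  unfold clamp; rw [this]

/-- What a node remembers for each of its ports. From `bit` on, the fields are used at the port
towards the acute corner of a side; the node at distance `i + 1` from that corner holds the `i`-th
binary digits. -/
structure Port (d B : ℕ) where
  /-- the result of the coin tossing for the edge, once it is decided -/
  own : Option Bool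
  /-- the port leads towards the acute corner -/
  pred : Bool
  /-- the distance to the acute corner is divisible by the current power of two -/
  act : Bool
  /-- the current binary digit of the distance to the acute corner -/
  bit : Bool
  /-- the node holds a digit already -/
  cap : Bool
  /-- the digit has been received in the current pass -/
  fresh : Bool
  /-- the node is next to the acute corner -/
  first : Bool
  /-- the current binary digit of the length of the side -/
  len : Bool
  /-- the stored digit of the length -/
  xd : Bool
  /-- the stored digits of the factors -/
  yd : Fin (d + 1) → Bool
  /-- the redundant digits of what remains of the products; they never reach `8`, by
  `accumMid_lt` -/
  acc : Fin (d + 1) → Fin 8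
  /-- the current digit of the present intermediate result -/
  y : Bool
  /-- the carries of the additions -/
  u : Fin (d + 1) → Carry B
  /-- a mismatch of the two sides of the equation has been detected -/
  mism : Bool
  /-- the length of this side is at most that of the other one, judged by the digits so far -/
  le : Bool
  /-- the carry of the comparison -/
  w : Carry B

instance (d B : ℕ) : Finite (Port d B) := by
  let f : Port d B → Option Bool × (Fin 10 → Bool) × (Fin (d + 1) → Bool) × (Fin (d + 1) → Fin 8) ×
      (Fin (d + 1) → Carry B) × Carry B := fun r =>
    (r.own, ![r.pred, r.act, r.bit, r.cap, r.fresh, r.first, r.len, r.xd, r.y, (r.mism)],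
      r.yd, r.acc, r.u, r.w)
  refine Finite.of_injective (fun r => (f r, r.le)) ?_
  intro a b h
  cases a; cases b
  simp only [f, Prod.mk.injEq] at h
  obtain ⟨⟨h1, h2, h3, h4, h5, h6⟩, h7⟩ := h
  have e := fun i => congrFun h2 i
  have e0 := e 0; have e1 := e 1; have e2 := e 2; have e3 := e 3; have e4 := e 4
  have e5 := e 5; have e6 := e 6; have e7 := e 7; have e8 := e 8; have e9 := e 9
  simp at e0 e1 e2 e3 e4 e5 e6 e7 e8 e9
  simp_all

variable (P : Detector)

/-- The number of rounds in which nodes are removed from both ends of a segment. In a segment of the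
admitted length with `r₀` nodes removed from each end, one node is left, or two neighbours. -/
def r₀ : ℕ := P.seg.getD 0 / 2

/-- The state of an amoebot. -/
structure St where
  /-- the program counter -/
  pc : PC P.d P.r₀
  /-- the occupied neighbours -/
  nb : Mask
  /-- the last coin toss -/
  coin : Bool
  /-- still participating in the clock -/
  alive : Bool
  /-- the structure has been rejected -/
  fail : Bool
  /-- reached from an end, if the structure is a segment -/
  dead : Bool
  /-- what is remembered for each of the six ports -/
  port : Dir → Port P.d P.B

instance : Finite P.St := by
  refine Finite.of_injective
    (fun q : P.St => (q.pc, q.nb, q.coin, q.alive, q.fail, q.dead, q.port)) ?_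
  intro a b h
  cases a; cases b
  simpa using h

/-- The initial memory of a port. Adding the coefficients in Horner's scheme is done by the initial
carries. -/
def initPort : Port P.d P.B where
  own := none
  pred := false
  act := true
  bit := false
  cap := false
  fresh := false
  first := false
  len := false
  xd := false
  yd := fun _ => false
  acc := fun _ => 0
  y := false
  u := fun j => clamp P.B (P.coef j)
  mism := false
  le := true
  w := clamp P.B 0

/-- The initial state. -/
def initSt : P.St where
  pc := .init
  nb := fun _ => false
  coin := false
  alive := true
  fail := false
  dead := false
  port := fun _ => P.initPort

/-- The signals received at a port of a side edge: on the outer track, on the inner track, and on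
the outer track of the opposite port. The last entry is the current digit of the other side, at an
obtuse corner. -/
structure Signals where
  outer : Bool
  inner : Bool
  back : Bool
  other : Bool

/-- The new memory of a port. Here `sd` says whether the edge is a side edge.

In pass `s` the multiplier `j` reads the digits of weight `2 ^ s` of its factors `x` and `y`, and the
cell `i ≤ s` adds the partial products `x i * y s` and `x s * y i`. In the cell `i = s`, which is
`fresh`, these coincide and only one is added. -/
def stepPort (pc : PC P.d P.r₀) (coin sd : Bool) (x : Signals) (r : Port P.d P.B) :
    Port P.d P.B :=
  match pc with
  | .tie => { r with
      own := if r.own = none ∧ sd = true then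
        (if (if coin then x.outer else x.inner) then some coin else none) else r.own }
  | .orient => { r with pred := sd && (r.own != some x.inner) }
  | .parity => if r.pred then { r with
      bit := x.inner ^^ r.act
      act := r.act && !(x.inner ^^ r.act) } else r
  | .length => if r.pred then { r with len := x.outer } else r
  | .token => if r.pred then { r with
      cap := r.cap || x.outer
      fresh := !r.cap && x.outer
      first := x.inner
      xd := if !r.cap && x.outer then r.len else r.xd } else r
  | .mul j => if r.pred then { r with
      yd := Function.update r.yd j (if r.fresh then x.outer else r.yd j)
      acc := Function.update r.acc j (Fin.ofNat 8 ((r.acc j).val +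
        if r.cap then (r.xd && x.outer).toNat + (!r.fresh && r.len && r.yd j).toNat else 0)) } else r
  | .shift j => if r.pred then { r with
      acc := Function.update r.acc j (Fin.ofNat 8 ((r.acc j).val / 2 + x.back.toNat))
      y := decide (((r.u j : ℤ) + ((r.acc j).val % 2 : ℕ)) % 2 = 1)
      u := Function.update r.u j (clamp P.B (((r.u j : ℤ) + ((r.acc j).val % 2 : ℕ)) / 2)) } else r
  | .compare => if r.pred then { r with
      y := false
      mism := r.mism || decide (((r.w : ℤ) + P.D * x.other.toNat - x.outer.toNat) % 2 = 1)
      w := clamp P.B (((r.w : ℤ) + P.D * x.other.toNat - x.outer.toNat) / 2)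
      le := if r.bit = x.other then r.le else x.other } else r
  | _ => r

/-- The signals on tracks that a state sends in the rounds that use single tracks. -/
def sends (q : P.St) (i : Dir) (b : Bool) : Prop :=
  match q.pc with
  | .tie => (q.port i).own = none ∧ b = q.coin
  | .orient => isArc q.nb 2 ∧ (q.port i).own = some b
  | .check => isArc q.nb 3 ∧ b = false
  | .parity => isArc q.nb 2 ∧ b = false
  | .length => isArc q.nb 3 ∧ (q.port i).pred = true ∧ (q.port i).bit = true ∧ b = false
  | .token => isArc q.nb 2 ∨ ((q.port i).pred = false ∧ (q.port (i + 3)).cap = true ∧ b = false)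
  | .mul _ => (q.port i).pred = true ∧ (q.port i).first = true ∧ (q.port i).y = true ∧ b = false
  | .shift j => (q.port i).pred = true ∧ (q.port i).cap = true ∧ ((q.port i).acc j).val % 2 = 1 ∧
      b = false
  | .compare => (q.port i).pred = true ∧ (q.port i).first = true ∧ (q.port i).y = true ∧ b = false
  | _ => False

/-- The amoebot rejects in the end: it has done so before, its mask does not occur in an admitted
shape, or it is an obtuse corner at which neither side has the right length. -/
def rejects (q : P.St) : Prop :=
  q.fail = true ∨ ¬ (isConvex q.nb ∨ (isSeg q.nb ∧ P.seg.isSome = true)) ∨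
    (isArc q.nb 3 ∧ ¬ ∃ i, (q.port i).pred = true ∧ (q.port i).mism = false ∧ (q.port i).le = true)

/-- The state beeps on all pins. -/
def shouts (q : P.St) : Prop :=
  match q.pc with
  | .tieAll => ∃ i, side q.nb i = true ∧ (q.port i).own = none
  | .hop _ => q.dead = true
  | .hopAll => q.dead = false
  | .clock => q.alive = true
  | .final => P.rejects q
  | _ => False

/-- Which straight nodes exchange the tracks. For the orientation, a node does so if the pin that
belongs to the nearer end lies on different tracks of its two edges, which is the case if it owns the
same track of both. -/
def cross (q : P.St) (i : Dir) : Bool :=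
  match q.pc with
  | .orient => (q.port i).own == (q.port (i + 3)).own
  | .parity => ((q.port i).pred && (q.port i).act) || ((q.port (i + 3)).pred && (q.port (i + 3)).act)
  | _ => false

theorem cross_add_three (q : P.St) (i : Dir) : P.cross q (i + 3) = P.cross q i := by
  unfold cross
  split
  · rw [add_three_add_three, Bool.beq_comm]
  · rw [add_three_add_three, Bool.or_comm]
  · rfl

/-- The wires of a state: none, those along the sides, or all. -/
def wires (q : P.St) : SimpleGraph (LocalPin (P.K + 2)) :=
  match q.pc with
  | .tieAll | .hopAll | .clock | .final => ⊤
  | .orient | .check | .parity | .length | .mul _ | .compare => lineWires P.K q.nb (P.cross q)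
  | _ => ⊥

open scoped Classical in
/-- The pins on which a state beeps. -/
def beeps (q : P.St) : Set (LocalPin (P.K + 2)) :=
  if P.shouts q then Set.univ else AmoebotAlgorithm.trackBeeps P.K q.nb (P.sends q)

open scoped Classical in
/-- A signal has been received on the given track of a side edge. -/
noncomputable def gets (q : P.St) (H : Set (LocalPin (P.K + 2))) (i : Dir) (b : Bool) : Bool :=
  side q.nb i && decide ((i, trackPin P.K q.nb i b) ∈ H)

open scoped Classical in
/-- The signals received at a port. -/
noncomputable def signals (q : P.St) (H : Set (LocalPin (P.K + 2))) (i : Dir) : Signals where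
  outer := P.gets q H i false
  inner := P.gets q H i true
  back := P.gets q H (i + 3) false
  other := decide (∃ i', i' ≠ i ∧ (q.port i').pred = true ∧ (q.port i').bit = true)

open scoped Classical in
/-- Number of neighbours from which no beep has been received. -/
noncomputable def silent (N : Mask) (H : Set (LocalPin (P.K + 2))) : ℕ :=
  (Finset.univ.filter fun i => N i = true ∧ ∀ j, (i, j) ∉ H).card

/-- A new reason for rejection. -/
def detects (q : P.St) (H : Set (LocalPin (P.K + 2))) : Prop :=
  match q.pc with
  | .orient => isArc q.nb 3 ∧
      ∃ i, side q.nb i = true ∧ P.gets q H i false = false ∧ P.gets q H i true = false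
  | .check => isArc q.nb 2 ∧ ∃ i, side q.nb i = true ∧ P.gets q H i false = false
  | .hop r => r = Fin.last P.r₀ ∧ isSeg q.nb ∧ q.dead = false ∧
      P.silent q.nb H ≠ P.seg.getD 0 % 2
  | .hopAll => isSeg q.nb ∧ H = ∅
  | _ => False

/-- The node of a segment is reached from an end. -/
def reached (q : P.St) (H : Set (LocalPin (P.K + 2))) : Prop :=
  match q.pc with
  | .hop r => r ≠ Fin.last P.r₀ ∧ (isArc q.nb 1 ∨ H.Nonempty)
  | _ => False

open scoped Classical in
/-- The transition function. -/
noncomputable def step (q : P.St) (N : Set Dir) (H : Set (LocalPin (P.K + 2)))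
    (r : Fin (2 * (P.m + 1))) : P.St :=
  match q.pc with
  | .done _ => q
  | _ => {
    pc := q.pc.next (decide H.Nonempty)
    nb := fun i => decide (i ∈ N)
    coin := decide (r.val % 2 = 1)
    alive := q.alive && decide (r.val ≠ 0)
    fail := q.fail || decide (P.detects q H)
    dead := q.dead || decide (P.reached q H)
    port := fun i => P.stepPort q.pc q.coin (side q.nb i) (P.signals q H i) (q.port i) }

/-- The answer, which is known once the program counter is `done`. -/
def verdict (q : P.St) : Option Bool :=
  match q.pc with
  | .done b => some b
  | _ => none

/-- The algorithm that detects parallelograms with `D * l = q h`. -/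
noncomputable def alg : AmoebotAlgorithm (P.K + 2) where
  State := P.St
  finite_state := inferInstance
  init := P.initSt
  symbols := 2 * (P.m + 1)
  coin := PMF.uniformOfFintype (Fin (2 * (P.m + 1)))
  step := P.step
  wires := P.wires
  beeps := P.beeps
  init_silent := by
    have h : ¬ P.shouts P.initSt := by simp [shouts, initSt]
    rw [beeps, if_neg h]
    ext a
    simp [AmoebotAlgorithm.trackBeeps, sends, initSt]
  verdict := P.verdict
  step_of_verdict := by
    intro q N H r h
    unfold verdict at h
    unfold step
    split at h
    · rfl
    · exact absurd rfl h

end Detector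

/-! ### One round of the algorithm, in terms of global directions -/

theorem isArc_comp_dir (f : Frame) (N : Mask) {r : ℕ} (hr : r ∈ [1, 2, 3, 4, 6]) :
    isArc (N ∘ f.dir) r ↔ isArc N r := by
  have key : ∀ z : Dir, ∀ r ∈ [1, 2, 3, 4, 6], ((((r : ℕ) : Dir) - 1 - z).val < r ↔ z.val < r) := by
    decide
  constructor
  · rintro ⟨j, hj⟩
    cases hc : f.clockwise
    · refine ⟨f.dir j, fun s => ?_⟩
      have := hj (f.lab s)
      simp only [Function.comp, Frame.dir_lab] at this
      rw [this]
      congr 3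
      simp only [Frame.lab, Frame.dir, hc]
      simp; ring
    · refine ⟨f.dir j - ((r : ℕ) : Dir) + 1, fun s => ?_⟩
      have := hj (f.lab s)
      simp only [Function.comp, Frame.dir_lab] at this
      rw [this, decide_eq_decide, ← key _ r hr]
      simp only [Frame.lab, Frame.dir, hc, if_true]
      have : ((r : ℕ) : Dir) - 1 - (f.compass - s - j) = s - (f.compass - j - ((r : ℕ) : Dir) + 1) := by
        ring
      rw [this]
  · rintro ⟨j, hj⟩
    cases hc : f.clockwise
    · refine ⟨f.lab j, fun s => ?_⟩
      simp only [Function.comp, hj]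
      congr 3
      simp only [Frame.lab, Frame.dir, hc]
      simp; ring
    · refine ⟨f.lab j - ((r : ℕ) : Dir) + 1, fun s => ?_⟩
      simp only [Function.comp, hj]
      rw [decide_eq_decide, ← key _ r hr]
      simp only [Frame.lab, Frame.dir, hc, if_true]
      have : ((r : ℕ) : Dir) - 1 - (f.compass - s - j) = s - (f.compass - j - ((r : ℕ) : Dir) + 1) := by
        ring
      rw [this]

theorem isSeg_comp_dir (f : Frame) (N : Mask) : isSeg (N ∘ f.dir) ↔ isSeg N := by
  unfold isSeg
  rw [isArc_comp_dir f N (by simp)]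
  refine or_congr Iff.rfl ⟨?_, ?_⟩
  · rintro ⟨j, hj⟩
    refine ⟨f.dir j, fun s => ?_⟩
    have := hj (f.lab s)
    simp only [Function.comp, Frame.dir_lab] at this
    rw [this, decide_eq_decide, ← f.dir_add_three]
    refine or_congr ⟨fun h => ?_, fun h => ?_⟩ ⟨fun h => ?_, fun h => ?_⟩
    all_goals first | (rw [← h]; simp) | (rw [h]; simp)
  · rintro ⟨j, hj⟩
    refine ⟨f.lab j, fun s => ?_⟩
    simp only [Function.comp, hj]
    rw [decide_eq_decide, ← f.lab_add_three]
    refine or_congr ⟨fun h => ?_, fun h => ?_⟩ ⟨fun h => ?_, fun h => ?_⟩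
    all_goals first | (rw [← h]; simp) | (rw [h]; simp)

theorem isConvex_comp_dir (f : Frame) (N : Mask) : isConvex (N ∘ f.dir) ↔ isConvex N := by
  unfold isConvex
  rw [isArc_comp_dir f N (by simp), isArc_comp_dir f N (by simp), isArc_comp_dir f N (by simp),
    isArc_comp_dir f N (by simp)]

namespace Detector

open AmoebotAlgorithm

variable (P : Detector) (S : Finset Node) (frame : Node → Frame)
  (ω : ℕ × Node → Fin (2 * (P.m + 1)))

/-- The state of the amoebot at `u` after `t` rounds. -/
noncomputable def st (t : ℕ) (u : Node) : P.St := P.alg.run S frame ω t u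

/-- The port of `u` in the global direction `g`. -/
noncomputable def gport (t : ℕ) (u : Node) (g : Dir) : Port P.d P.B :=
  (P.st S frame ω t u).port ((frame u).lab g)

/-- The pins on which the amoebot at `u` receives a beep after `t` rounds. -/
noncomputable def heardAt (t : ℕ) (u : Node) : Set (LocalPin (P.K + 2)) :=
  P.alg.heard S frame (P.st S frame ω t) u

/-- After `t ≥ 1` rounds, all amoebots have the program counter `c`. As `t ≥ 1`, they know their
neighbours. -/
def At (t : ℕ) (c : PC P.d P.r₀) : Prop :=
  ∀ u ∈ S, (P.st S frame ω t u).pc = c ∧ (P.st S frame ω t u).nb = lmask S frame u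

theorem st_succ (t : ℕ) (u : Node) : P.st S frame ω (t + 1) u =
    P.step (P.st S frame ω t u) (neighbors S frame u) (P.heardAt S frame ω t u) (ω (t, u)) := rfl

open scoped Classical in
theorem st_succ_of_ne_done {t : ℕ} {u : Node} (h : ∀ b, (P.st S frame ω t u).pc ≠ .done b) :
    P.st S frame ω (t + 1) u =
    { pc := (P.st S frame ω t u).pc.next (decide (P.heardAt S frame ω t u).Nonempty)
      nb := lmask S frame u
      coin := decide ((ω (t, u)).val % 2 = 1)
      alive := (P.st S frame ω t u).alive && decide ((ω (t, u)).val ≠ 0)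
      fail := (P.st S frame ω t u).fail ||
        decide (P.detects (P.st S frame ω t u) (P.heardAt S frame ω t u))
      dead := (P.st S frame ω t u).dead ||
        decide (P.reached (P.st S frame ω t u) (P.heardAt S frame ω t u))
      port := fun i => P.stepPort (P.st S frame ω t u).pc (P.st S frame ω t u).coin
        (side (P.st S frame ω t u).nb i)
        (P.signals (P.st S frame ω t u) (P.heardAt S frame ω t u) i)
        ((P.st S frame ω t u).port i) } := by
  rw [st_succ, step]
  split
  · rename_i b hb; exact absurd hb (h b)
  · congr 1
    funext i
    exact decide_eq_decide.2 Iff.rfl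

theorem st_succ_of_done {t : ℕ} {u : Node} {b : Bool} (h : (P.st S frame ω t u).pc = .done b) :
    P.st S frame ω (t + 1) u = P.st S frame ω t u := by
  rw [st_succ, step]
  split
  · rfl
  · rename_i h'; exact absurd h (h' b)

variable {P S frame ω}

section

variable {t : ℕ} {c : PC P.d P.r₀}

theorem At.pc (h : P.At S frame ω t c) {u : Node} (hu : u ∈ S) :
    (P.st S frame ω t u).pc = c := (h u hu).1

theorem At.nb (h : P.At S frame ω t c) {u : Node} (hu : u ∈ S) :
    (P.st S frame ω t u).nb = lmask S frame u := (h u hu).2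

theorem At.isArc_iff (h : P.At S frame ω t c) {u : Node} (hu : u ∈ S) {r : ℕ}
    (hr : r ∈ [1, 2, 3, 4, 6]) : isArc (P.st S frame ω t u).nb r ↔ isArc (gmask S u) r := by
  rw [h.nb hu, lmask, isArc_comp_dir _ _ hr]

theorem At.isSeg_iff (h : P.At S frame ω t c) {u : Node} (hu : u ∈ S) :
    isSeg (P.st S frame ω t u).nb ↔ isSeg (gmask S u) := by
  rw [h.nb hu, lmask, isSeg_comp_dir]

theorem At.isConvex_iff (h : P.At S frame ω t c) {u : Node} (hu : u ∈ S) :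
    isConvex (P.st S frame ω t u).nb ↔ isConvex (gmask S u) := by
  rw [h.nb hu, lmask, isConvex_comp_dir]

theorem At.side_lab (h : P.At S frame ω t c) {u : Node} (hu : u ∈ S) (g : Dir) :
    side (P.st S frame ω t u).nb ((frame u).lab g) = side (gmask S u) g := by
  rw [h.nb hu, side_lmask, Frame.dir_lab]

open scoped Classical in
theorem At.coin_succ (h : P.At S frame ω t c) (hc : ∀ b, c ≠ .done b) {u : Node} (hu : u ∈ S) :
    (P.st S frame ω (t + 1) u).coin = decide ((ω (t, u)).val % 2 = 1) := by
  rw [st_succ_of_ne_done _ _ _ _ (by rw [h.pc hu]; exact hc)]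

open scoped Classical in
theorem At.fail_succ (h : P.At S frame ω t c) (hc : ∀ b, c ≠ .done b) {u : Node} (hu : u ∈ S) :
    (P.st S frame ω (t + 1) u).fail = ((P.st S frame ω t u).fail ||
        decide (P.detects (P.st S frame ω t u) (P.heardAt S frame ω t u))) := by
  rw [st_succ_of_ne_done _ _ _ _ (by rw [h.pc hu]; exact hc)]

open scoped Classical in
theorem At.dead_succ (h : P.At S frame ω t c) (hc : ∀ b, c ≠ .done b) {u : Node} (hu : u ∈ S) :
    (P.st S frame ω (t + 1) u).dead = ((P.st S frame ω t u).dead ||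
        decide (P.reached (P.st S frame ω t u) (P.heardAt S frame ω t u))) := by
  rw [st_succ_of_ne_done _ _ _ _ (by rw [h.pc hu]; exact hc)]

open scoped Classical in
theorem At.port_succ (h : P.At S frame ω t c) (hc : ∀ b, c ≠ .done b) {u : Node} (hu : u ∈ S)
    (g : Dir) : P.gport S frame ω (t + 1) u g =
      P.stepPort c (P.st S frame ω t u).coin (side (gmask S u) g)
        (P.signals (P.st S frame ω t u) (P.heardAt S frame ω t u) ((frame u).lab g))
        (P.gport S frame ω t u g) := by
  unfold gport
  rw [st_succ_of_ne_done _ _ _ _ (by rw [h.pc hu]; exact hc)]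
  simp only [h.pc hu, h.side_lab hu]

/-- The rounds in which an amoebot need not listen in order to know the next program counter. -/
theorem At.next_of_forall (h : P.At S frame ω t c) (hc : ∀ b, c ≠ .done b) {c' : PC P.d P.r₀}
    (hn : ∀ b, c.next b = c') : P.At S frame ω (t + 1) c' := by
  intro u hu
  rw [st_succ_of_ne_done _ _ _ _ (by rw [h.pc hu]; exact hc)]
  exact ⟨by rw [h.pc hu]; exact hn _, rfl⟩

theorem nonempty_heardAt_iff (hS : IsAmoebotStructure S)
    (hw : ∀ u ∈ S, P.wires (P.st S frame ω t u) = ⊤) {u : Node} (hu : u ∈ S) :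
    (P.heardAt S frame ω t u).Nonempty ↔ ∃ v ∈ S, (P.beeps (P.st S frame ω t v)).Nonempty := by
  constructor
  · rintro ⟨a, ha⟩
    exact (P.alg.heard_of_wires_top S frame hS hw hu a).1 ha
  · intro hv
    exact ⟨(0, 0), (P.alg.heard_of_wires_top S frame hS hw hu _).2 hv⟩

theorem beeps_of_shouts {q : P.St} (h : P.shouts q) : P.beeps q = Set.univ := by
  rw [beeps, if_pos h]

theorem beeps_of_not_shouts {q : P.St} (h : ¬ P.shouts q) :
    P.beeps q = trackBeeps P.K q.nb (P.sends q) := by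
  rw [beeps, if_neg h]

theorem beeps_eq_empty {q : P.St} (h : ¬ P.shouts q) (h' : ∀ i b, ¬ P.sends q i b) :
    P.beeps q = ∅ := by
  rw [beeps_of_not_shouts h]
  ext a
  simp [trackBeeps, h']

/-- In the rounds with a single circuit, all amoebots learn whether one of them shouts. -/
theorem At.nonempty_iff_of_global (h : P.At S frame ω t c) (hS : IsAmoebotStructure S)
    (hc : c = .tieAll ∨ c = .hopAll ∨ c = .clock ∨ c = .final) {u : Node} (hu : u ∈ S) :
    (P.heardAt S frame ω t u).Nonempty ↔ ∃ v ∈ S, P.shouts (P.st S frame ω t v) := by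
  rw [nonempty_heardAt_iff hS _ hu]
  · refine exists_congr fun v => and_congr_right fun hv => ?_
    by_cases hs : P.shouts (P.st S frame ω t v)
    · simp [beeps_of_shouts hs, hs]
    · rw [beeps_eq_empty hs]
      · simp [hs]
      · intro i b
        have := h.pc hv
        unfold sends
        rcases hc with rfl | rfl | rfl | rfl <;> simp [this]
  · intro v hv
    have := h.pc hv
    unfold wires
    rcases hc with rfl | rfl | rfl | rfl <;> simp [this]

open scoped Classical in
theorem At.next_of_global (h : P.At S frame ω t c) (hS : IsAmoebotStructure S)
    (hc : c = .tieAll ∨ c = .hopAll ∨ c = .clock ∨ c = .final) :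
    P.At S frame ω (t + 1) (c.next (decide (∃ v ∈ S, P.shouts (P.st S frame ω t v)))) := by
  have hd : ∀ b, c ≠ .done b := by rcases hc with rfl | rfl | rfl | rfl <;> simp
  intro u hu
  rw [st_succ_of_ne_done _ _ _ _ (by rw [h.pc hu]; exact hd)]
  refine ⟨?_, rfl⟩
  simp only [h.pc hu]
  congr 1
  rw [decide_eq_decide]
  exact h.nonempty_iff_of_global hS hc hu

/-- The signal on track `b` of the edge of `u` in direction `g`. -/
def Sig (P : Detector) (S : Finset Node) (frame : Node → Frame)
    (ω : ℕ × Node → Fin (2 * (P.m + 1))) (t : ℕ) (u : Node) (g : Dir) (b : Bool) : Prop :=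
  GSide S u g ∧ Hears (P.alg.circuitGraph S frame (P.st S frame ω t)) S
    (fun v g b => P.sends (P.st S frame ω t v) ((frame v).lab g) b) u g b

/-- The rounds in which the signals are sent on single tracks. -/
def Quiet (P : Detector) (c : PC P.d P.r₀) : Prop :=
  c = .tie ∨ c = .orient ∨ c = .check ∨ c = .parity ∨ c = .length ∨ c = .token ∨
    (∃ j, c = .mul j) ∨ (∃ j, c = .shift j) ∨ c = .compare

theorem At.not_shouts (h : P.At S frame ω t c) (hc : Quiet P c) {u : Node} (hu : u ∈ S) :
    ¬ P.shouts (P.st S frame ω t u) := by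
  have := h.pc hu
  unfold shouts
  rcases hc with rfl | rfl | rfl | rfl | rfl | rfl | ⟨j, rfl⟩ | ⟨j, rfl⟩ | rfl <;> simp [this]

open scoped Classical in
theorem At.gets_iff (h : P.At S frame ω t c) (hc : Quiet P c) {u : Node} (hu : u ∈ S) (g : Dir)
    (b : Bool) : P.gets (P.st S frame ω t u) (P.heardAt S frame ω t u) ((frame u).lab g) b = true ↔
      P.Sig S frame ω t u g b := by
  have hb : ∀ u ∈ S, P.alg.beeps (P.st S frame ω t u) =
      trackBeeps P.K (lmask S frame u) (P.sends (P.st S frame ω t u)) := by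
    intro u hu
    have := beeps_of_not_shouts (h.not_shouts hc hu)
    rw [h.nb hu] at this
    exact this
  unfold gets Sig GSide
  rw [Bool.and_eq_true, h.side_lab hu, decide_eq_true_eq]
  simp only [hu, true_and]
  refine and_congr_right fun hs => ?_
  rw [h.nb hu]
  have hs' : side (lmask S frame u) ((frame u).lab g) = true := by
    rw [side_lmask, Frame.dir_lab]; exact hs
  have := P.alg.heard_track_iff S frame hb hs' b
  rw [Frame.dir_lab] at this
  exact this

/-- The signals that a port receives. -/
theorem At.signals_eq (h : P.At S frame ω t c) (hc : Quiet P c) {u : Node} (hu : u ∈ S) (g : Dir) :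
    let x := P.signals (P.st S frame ω t u) (P.heardAt S frame ω t u) ((frame u).lab g)
    (x.outer = true ↔ P.Sig S frame ω t u g false) ∧ (x.inner = true ↔ P.Sig S frame ω t u g true) ∧
    (x.back = true ↔ P.Sig S frame ω t u (g + 3) false) ∧
    (x.other = true ↔ ∃ g', g' ≠ g ∧ (P.gport S frame ω t u g').pred = true ∧
      (P.gport S frame ω t u g').bit = true) := by
  refine ⟨h.gets_iff hc hu g false, h.gets_iff hc hu g true, ?_, ?_⟩
  · rw [← h.gets_iff hc hu (g + 3) false, Frame.lab_add_three]; rfl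
  · simp only [signals, decide_eq_true_eq, gport]
    constructor
    · rintro ⟨i', h1, h2, h3⟩
      refine ⟨(frame u).dir i', ?_, by simpa using h2, by simpa using h3⟩
      rintro rfl
      exact h1 (by simp)
    · rintro ⟨g', h1, h2, h3⟩
      refine ⟨(frame u).lab g', ?_, h2, h3⟩
      intro he
      apply h1
      rw [← (frame u).dir_lab g', he, Frame.dir_lab]

/-- Signals in the rounds without wires. -/
theorem At.sig_iff_of_local (h : P.At S frame ω t c)
    (hc : c = .tie ∨ c = .token ∨ ∃ j, c = .shift j) {u : Node} {g : Dir} (hs : GSide S u g)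
    (b : Bool) : P.Sig S frame ω t u g b ↔
      P.sends (P.st S frame ω t u) ((frame u).lab g) b ∨
      P.sends (P.st S frame ω t (u + dirVec g)) ((frame (u + dirVec g)).lab (g + 3)) b := by
  unfold Sig
  have hbot : P.alg.circuitGraph S frame (P.st S frame ω t) = ⊥ := by
    apply circuitGraph_eq_bot
    intro u hu
    have := h.pc hu
    change P.wires _ = ⊥
    unfold wires
    rcases hc with rfl | rfl | ⟨j, rfl⟩ <;> simp [this]
  rw [hbot, hears_bot hs]
  simp [hs]

/-- The rounds in which the signals are transmitted along the sides. -/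
def Lined (P : Detector) (c : PC P.d P.r₀) : Prop :=
  c = .orient ∨ c = .check ∨ c = .parity ∨ c = .length ∨ (∃ j, c = .mul j) ∨ c = .compare

theorem At.sideCircuits (h : P.At S frame ω t c) (hc : Lined P c) :
    SideCircuits (P.alg.circuitGraph S frame (P.st S frame ω t)) S
      (fun u g => P.cross (P.st S frame ω t u) ((frame u).lab g)) := by
  refine P.alg.sideCircuits S frame (c := fun u => P.cross (P.st S frame ω t u)) ?_
    (fun u i => P.cross_add_three _ i)
  intro u hu
  have := h.pc hu
  rw [← h.nb hu]
  change P.wires _ = _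
  unfold wires
  rcases hc with rfl | rfl | rfl | rfl | ⟨j, rfl⟩ | rfl <;> simp [this]

/-- Signals in the rounds with wires along the sides. -/
theorem At.sig_iff_of_lined (h : P.At S frame ω t c) (hc : Lined P c) {v : Node} {g : Dir} {L : ℕ}
    (hrun : IsRun S v g L) {x : ℕ} (hx : x < L) (b : Bool) :
    P.Sig S frame ω t (lineNode v g x) g b ↔ ∃ y < L, ∃ b',
      (P.sends (P.st S frame ω t (lineNode v g y)) ((frame (lineNode v g y)).lab g) b' ∨
       P.sends (P.st S frame ω t (lineNode v g (y + 1)))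
        ((frame (lineNode v g (y + 1))).lab (g + 3)) b') ∧
      (b ^^ crossParity (fun z => P.cross (P.st S frame ω t (lineNode v g z))
          ((frame (lineNode v g z)).lab g)) x) =
        (b' ^^ crossParity (fun z => P.cross (P.st S frame ω t (lineNode v g z))
          ((frame (lineNode v g z)).lab g)) y) := by
  unfold Sig
  have := hrun.hears_iff (h.sideCircuits hc) (fun u g => by
    rw [Frame.lab_add_three, P.cross_add_three]) (snd := fun v g b =>
      P.sends (P.st S frame ω t v) ((frame v).lab g) b) hx b
  rw [this]
  simp [hrun.side x hx]

theorem sig_opposite {u : Node} {g : Dir} (hs : GSide S u g) (b : Bool) :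
    P.Sig S frame ω t (u + dirVec g) (g + 3) b ↔ P.Sig S frame ω t u g b := by
  unfold Sig
  rw [hears_opposite hs]
  simp [hs, hs.opposite]

end

end Detector

/-! ### Convex structures -/

theorem isArc_shift (N : Mask) (g : Dir) (r : ℕ) : isArc (fun s => N (g + s)) r ↔ isArc N r := by
  constructor
  · rintro ⟨j, hj⟩
    refine ⟨g + j, fun s => ?_⟩
    have := hj (s - g)
    simp only [add_sub_cancel] at this
    rw [this, sub_sub]
  · rintro ⟨j, hj⟩
    refine ⟨j - g, fun s => ?_⟩
    simp only [hj]
    congr 3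
    ring

theorem isConvex_shift (N : Mask) (g : Dir) : isConvex (fun s => N (g + s)) ↔ isConvex N := by
  simp only [isConvex, isArc_shift]

theorem side_shift (N : Mask) (g s : Dir) : side (fun s => N (g + s)) s = side N (g + s) := by
  simp only [side, add_assoc, add_sub_assoc]

theorem isSeg_shift (N : Mask) (g : Dir) : isSeg (fun s => N (g + s)) ↔ isSeg N := by
  unfold isSeg
  rw [isArc_shift]
  refine or_congr Iff.rfl ⟨?_, ?_⟩
  · rintro ⟨j, hj⟩
    refine ⟨g + j, fun s => ?_⟩
    have := hj (s - g)
    simp only [add_sub_cancel] at this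
    rw [this, decide_eq_decide, sub_eq_iff_eq_add, sub_eq_iff_eq_add]
    refine or_congr ?_ ?_ <;> rw [eq_comm, eq_comm (a := s)] <;> constructor <;> rintro rfl <;> ring
  · rintro ⟨j, hj⟩
    refine ⟨j - g, fun s => ?_⟩
    simp only [hj]
    rw [decide_eq_decide]
    refine or_congr ⟨fun h => ?_, fun h => ?_⟩ ⟨fun h => ?_, fun h => ?_⟩ <;>
      linear_combination h

/-- A set of nodes that contains a node of a connected structure and is closed under passing to
occupied neighbours contains the whole structure. -/
theorem forall_mem_of_closed {S : Finset Node} (hS : IsAmoebotStructure S) (T : Node → Prop)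
    {u : Node} (hu : u ∈ S) (hT : T u)
    (hcl : ∀ w ∈ S, T w → ∀ g, w + dirVec g ∈ S → T (w + dirVec g)) : ∀ w ∈ S, T w := by
  intro w hw
  obtain ⟨walk⟩ := hS.preconnected ⟨u, hu⟩ ⟨w, hw⟩
  suffices H : ∀ (x y : (S : Set Node)), (triGrid.induce (S : Set Node)).Walk x y → T x → T y from
    H _ _ walk hT
  intro x y p
  induction p with
  | nil => exact id
  | @cons x y z hadj _ ih =>
    intro hx
    obtain ⟨g, hg⟩ := hadj
    apply ih
    simp only [Function.Embedding.subtype_apply] at hg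
    rw [hg]
    exact hcl x x.2 hx g (by rw [← hg]; exact y.2)

theorem lineNode_injective (v : Node) (g : Dir) : Function.Injective (lineNode v g) := by
  intro x y h
  simp only [lineNode, add_right_inj] at h
  by_contra hne
  have h0 := dirVec_ne_zero g
  have : ((x : ℤ) - y) • dirVec g = 0 := by
    rw [sub_smul, natCast_zsmul, natCast_zsmul, h, sub_self]
  rcases smul_eq_zero.1 this with h1 | h1
  · omega
  · exact h0 h1

theorem exists_lineNode_not (S : Finset Node) (v : Node) (g : Dir) : ∃ x, lineNode v g x ∉ S := by
  by_contra! h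
  exact Set.infinite_of_injective_forall_mem (lineNode_injective v g) h S.finite_toSet

theorem exists_isRun {S : Finset Node} {v : Node} {g : Dir} (h : GSide S v g)
    (h' : ¬ GSide S v (g + 3)) : ∃ L, IsRun S v g L := by
  classical
  have hex : ∃ x, ¬ GSide S (lineNode v g x) g := by
    obtain ⟨x, hx⟩ := exists_lineNode_not S v g
    exact ⟨x, fun hs => hx hs.1⟩
  refine ⟨Nat.find hex, ?_, fun x hx => not_not.1 (Nat.find_min hex hx), h', Nat.find_spec hex⟩
  rw [Nat.one_le_iff_ne_zero]
  intro h0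
  have := Nat.find_spec hex
  rw [h0, lineNode_zero] at this
  exact this h

theorem IsRun.mem {S : Finset Node} {v : Node} {g : Dir} {L : ℕ} (h : IsRun S v g L) {x : ℕ}
    (hx : x ≤ L) : lineNode v g x ∈ S := by
  rcases hx.lt_or_eq with hx | rfl
  · exact (h.side x hx).mem
  · obtain ⟨y, rfl⟩ := Nat.exists_eq_succ_of_ne_zero (Nat.one_le_iff_ne_zero.1 h.pos)
    exact (h.side_back (Nat.lt_succ_self y)).mem

set_option maxRecDepth 10000 in
theorem isConvex_inner : ∀ N : Mask, isConvex N → side N 3 = true → side N 0 = true →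
    ¬ isArc N 2 ∧ ¬ isArc N 3 := by decide

set_option maxRecDepth 10000 in
theorem isArc_side_opposite : ∀ N : Mask, isArc N 2 ∨ isArc N 3 → side N 0 = true →
    side N 3 = false := by decide

set_option maxRecDepth 10000 in
theorem isArc_three_side : ∀ N : Mask, isArc N 3 → ∃ g, side N g = true := by decide

set_option maxRecDepth 10000 in
theorem isConvex_extreme : ∀ N : Mask, isConvex N → N 0 = false → N 1 = false → N 5 = false →
    isArc N 2 ∨ isArc N 3 := by decide

theorem GSide.not_opposite_of_isArc {S : Finset Node} {u : Node} {g : Dir} (h : GSide S u g)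
    (hu : isArc (gmask S u) 2 ∨ isArc (gmask S u) 3) : ¬ GSide S u (g + 3) := by
  intro h'
  have := isArc_side_opposite (fun s => gmask S u (g + s)) (by simpa only [isArc_shift] using hu)
    (by rw [side_shift, add_zero]; exact h.2)
  rw [side_shift, h'.2] at this
  exact absurd this (by simp)

theorem IsRun.inner {S : Finset Node} (hc : ∀ u ∈ S, isConvex (gmask S u)) {v : Node} {g : Dir}
    {L : ℕ} (h : IsRun S v g L) {x : ℕ} (h0 : 0 < x) (hx : x < L) :
    ¬ isArc (gmask S (lineNode v g x)) 2 ∧ ¬ isArc (gmask S (lineNode v g x)) 3 := by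
  obtain ⟨y, rfl⟩ := Nat.exists_eq_succ_of_ne_zero h0.ne'
  have := isConvex_inner (fun s => gmask S (lineNode v g (y + 1)) (g + s))
    (by rw [isConvex_shift]; exact hc _ (h.mem hx.le))
    (by rw [side_shift]; exact (h.side_back (by omega)).2)
    (by rw [side_shift, add_zero]; exact (h.side _ hx).2)
  simpa only [isArc_shift] using this

/-- Every side has an acute and an obtuse corner. -/
def Alternating (S : Finset Node) : Prop :=
  ∀ v g L, IsRun S v g L →
    (isArc (gmask S v) 2 → isArc (gmask S (lineNode v g L)) 3) ∧
    (isArc (gmask S v) 3 → isArc (gmask S (lineNode v g L)) 2)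

/-! ### Parallelograms in a normal form -/

/-- The node with coordinates `a` and `b` with respect to the corner `v` and the directions `g` and
`g + 1`. -/
def cell (v : Node) (g : Dir) (a b : ℤ) : Node := v + a • dirVec g + b • dirVec (g + 1)

theorem dirVec_two (g : Dir) : dirVec (g + 2) = dirVec (g + 1) - dirVec g := by revert g; decide
theorem dirVec_four (g : Dir) : dirVec (g + 4) = -dirVec (g + 1) := by revert g; decide
theorem dirVec_five (g : Dir) : dirVec (g + 5) = dirVec g - dirVec (g + 1) := by revert g; decide

section cell

variable (v : Node) (g : Dir) (a b : ℤ)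

theorem cell_step0 : cell v g a b + dirVec (g + 0) = cell v g (a + 1) b := by
  rw [add_zero]; unfold cell; module
theorem cell_step1 : cell v g a b + dirVec (g + 1) = cell v g a (b + 1) := by
  unfold cell; module
theorem cell_step2 : cell v g a b + dirVec (g + 2) = cell v g (a - 1) (b + 1) := by
  rw [dirVec_two]; unfold cell; module
theorem cell_step3 : cell v g a b + dirVec (g + 3) = cell v g (a - 1) b := by
  rw [dirVec_add_three]; unfold cell; module
theorem cell_step4 : cell v g a b + dirVec (g + 4) = cell v g a (b - 1) := by
  rw [dirVec_four]; unfold cell; module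
theorem cell_step5 : cell v g a b + dirVec (g + 5) = cell v g (a + 1) (b - 1) := by
  rw [dirVec_five]; unfold cell; module

theorem cell_zero : cell v g 0 0 = v := by simp [cell]

theorem lineNode_cell (x : ℕ) : lineNode (cell v g a b) g x = cell v g (a + x) b := by
  unfold lineNode cell; rw [← natCast_zsmul]; module

theorem lineNode_cell' (x : ℕ) : lineNode (cell v g a b) (g + 1) x = cell v g a (b + x) := by
  unfold lineNode cell; rw [← natCast_zsmul]; module

end cell

theorem cell_injective {v : Node} {g : Dir} {a b a' b' : ℤ} (h : cell v g a b = cell v g a' b') :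
    a = a' ∧ b = b' := by
  unfold cell at h
  rw [add_assoc, add_assoc, add_right_inj] at h
  have h1 := congrArg Prod.fst h
  have h2 := congrArg Prod.snd h
  have key : ∀ g : Dir, (dirVec g).1 * (dirVec (g + 1)).2 - (dirVec g).2 * (dirVec (g + 1)).1 = 1 := by
    decide
  have hk := key g
  simp only [Prod.fst_add, Prod.snd_add, Prod.smul_fst, Prod.smul_snd, smul_eq_mul] at h1 h2
  constructor
  · linear_combination (dirVec (g + 1)).2 * h1 - (dirVec (g + 1)).1 * h2 - (a - a') * hk
  · linear_combination -(dirVec g).2 * h1 + (dirVec g).1 * h2 - (b - b') * hk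

/-- The structure is the parallelogram with an acute corner `v`, with `m` edges in direction `g` and
`n` edges in direction `g + 1`. -/
def IsPara (S : Finset Node) (v : Node) (g : Dir) (m n : ℕ) : Prop :=
  ∀ w, w ∈ S ↔ ∃ a b : ℤ, (0 ≤ a ∧ a ≤ m) ∧ (0 ≤ b ∧ b ≤ n) ∧ w = cell v g a b

theorem IsPara.cell_mem {S : Finset Node} {v : Node} {g : Dir} {m n : ℕ} (h : IsPara S v g m n)
    (a b : ℤ) : cell v g a b ∈ S ↔ (0 ≤ a ∧ a ≤ m) ∧ (0 ≤ b ∧ b ≤ n) := by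
  rw [h]
  constructor
  · rintro ⟨a', b', h1, h2, h3⟩
    obtain ⟨rfl, rfl⟩ := cell_injective h3
    exact ⟨h1, h2⟩
  · rintro ⟨h1, h2⟩
    exact ⟨a, b, h1, h2, rfl⟩

theorem IsPara.rotate {S : Finset Node} {v : Node} {g : Dir} {m n : ℕ} (h : IsPara S v g m n) :
    IsPara S (cell v g m n) (g + 3) m n := by
  have key : ∀ a b : ℤ, cell (cell v g m n) (g + 3) a b = cell v g (m - a) (n - b) := by
    intro a b
    have : g + 3 + 1 = g + 4 := by ring
    unfold cell
    rw [this, dirVec_add_three, dirVec_four]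
    module
  intro w
  rw [h]
  constructor
  · rintro ⟨a, b, h1, h2, rfl⟩
    exact ⟨m - a, n - b, by omega, by omega, by rw [key]; simp⟩
  · rintro ⟨a, b, h1, h2, rfl⟩
    exact ⟨m - a, n - b, by omega, by omega, key _ _⟩

/-- The mask of a node of a parallelogram relative to the direction `g`, depending on which of the
sides `a = 0`, `a = m`, `b = 0`, `b = n` the node lies on. -/
def paraMask (a0 a1 b0 b1 : Bool) : Mask :=
  (![!a1, !b1, !a0 && !b1, !a0, !b0, !a1 && !b0] : Fin 6 → Bool)

theorem forall_dir {p : Dir → Prop} (h0 : p 0) (h1 : p 1) (h2 : p 2) (h3 : p 3) (h4 : p 4)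
    (h5 : p 5) : ∀ s, p s := by
  intro s
  change Fin 6 at s
  fin_cases s
  · exact h0
  · exact h1
  · exact h2
  · exact h3
  · exact h4
  · exact h5

theorem IsPara.mask {S : Finset Node} {v : Node} {g : Dir} {m n : ℕ} (h : IsPara S v g m n)
    {a b : ℤ} (ha : 0 ≤ a ∧ a ≤ m) (hb : 0 ≤ b ∧ b ≤ n) :
    (fun s => gmask S (cell v g a b) (g + s)) =
      paraMask (decide (a = 0)) (decide (a = m)) (decide (b = 0)) (decide (b = n)) := by
  funext s
  revert s
  apply forall_dir
  · simp only [gmask, cell_step0, h.cell_mem]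
    change _ = !decide (a = m)
    rw [← decide_not, decide_eq_decide]; omega
  · simp only [gmask, cell_step1, h.cell_mem]
    change _ = !decide (b = n)
    rw [← decide_not, decide_eq_decide]; omega
  · simp only [gmask, cell_step2, h.cell_mem]
    change _ = (!decide (a = 0) && !decide (b = n))
    rw [← decide_not, ← decide_not, ← Bool.decide_and, decide_eq_decide]; omega
  · simp only [gmask, cell_step3, h.cell_mem]
    change _ = !decide (a = 0)
    rw [← decide_not, decide_eq_decide]; omega
  · simp only [gmask, cell_step4, h.cell_mem]
    change _ = !decide (b = 0)
    rw [← decide_not, decide_eq_decide]; omega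
  · simp only [gmask, cell_step5, h.cell_mem]
    change _ = (!decide (a = m) && !decide (b = 0))
    rw [← decide_not, ← decide_not, ← Bool.decide_and, decide_eq_decide]; omega

/-- A side of length `L` from the acute corner `v` to an obtuse corner, in direction `g`. -/
structure IsLine (S : Finset Node) (v : Node) (g : Dir) (L : ℕ) : Prop extends IsRun S v g L where
  acute : isArc (gmask S v) 2
  obtuse : isArc (gmask S (lineNode v g L)) 3

section

variable {S : Finset Node} {v : Node} {g : Dir} {m n : ℕ}

theorem IsPara.isArc_iff (h : IsPara S v g m n)
    {a b : ℤ} (ha : 0 ≤ a ∧ a ≤ m) (hb : 0 ≤ b ∧ b ≤ n) (r : ℕ) :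
    isArc (gmask S (cell v g a b)) r ↔
      isArc (paraMask (decide (a = 0)) (decide (a = m)) (decide (b = 0)) (decide (b = n))) r := by
  rw [← h.mask ha hb, isArc_shift]

theorem IsPara.side_eq (h : IsPara S v g m n)
    {a b : ℤ} (ha : 0 ≤ a ∧ a ≤ m) (hb : 0 ≤ b ∧ b ≤ n) (s : Dir) :
    GSide S (cell v g a b) (g + s) ↔
      side (paraMask (decide (a = 0)) (decide (a = m)) (decide (b = 0)) (decide (b = n))) s
        = true := by
  rw [← h.mask ha hb, side_shift, GSide, h.cell_mem]
  exact ⟨fun h => h.2, fun h => ⟨⟨ha, hb⟩, h⟩⟩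

theorem IsPara.isConvex (h : IsPara S v g m n) (hm : 1 ≤ m) (hn : 1 ≤ n) :
    ∀ u ∈ S, isConvex (gmask S u) := by
  intro u hu
  obtain ⟨a, b, ha, hb, rfl⟩ := (h u).1 hu
  rw [← isConvex_shift _ g, h.mask ha hb]
  have key : ∀ a0 a1 b0 b1 : Bool, ¬ (a0 = true ∧ a1 = true) → ¬ (b0 = true ∧ b1 = true) →
      _root_.isConvex (paraMask a0 a1 b0 b1) := by decide
  apply key
  · simp only [decide_eq_true_eq]; omega
  · simp only [decide_eq_true_eq]; omega

theorem paraMask_side : ∀ a0 a1 b0 b1 : Bool,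
    side (paraMask a0 a1 b0 b1) 0 = (!a1 && (!b1 != (!a1 && !b0))) ∧
    side (paraMask a0 a1 b0 b1) 1 = (!b1 && ((!a0 && !b1) != !a1)) ∧
    side (paraMask a0 a1 b0 b1) 3 = (!a0 && (!b0 != (!a0 && !b1))) ∧
    side (paraMask a0 a1 b0 b1) 4 = (!b0 && ((!a1 && !b0) != !a0)) := by decide

theorem IsPara.isLine (h : IsPara S v g m n) (hm : 1 ≤ m) (hn : 1 ≤ n) :
    IsLine S v g m ∧ IsLine S v (g + 1) n := by
  have e0 : ∀ x, lineNode v g x = cell v g x 0 := fun x => by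
    conv_lhs => rw [← cell_zero v g]
    rw [lineNode_cell, zero_add]
  have e1 : ∀ x, lineNode v (g + 1) x = cell v g 0 x := fun x => by
    conv_lhs => rw [← cell_zero v g]
    rw [lineNode_cell', zero_add]
  have hm' : (m : ℤ) ≠ 0 := by omega
  have hn' : (n : ℤ) ≠ 0 := by omega
  refine ⟨⟨⟨hm, ?_, ?_, ?_⟩, ?_, ?_⟩, ⟨⟨hn, ?_, ?_, ?_⟩, ?_, ?_⟩⟩
  · intro x hx
    have := h.side_eq (a := x) (b := 0) ⟨by omega, by omega⟩ ⟨by omega, by omega⟩ 0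
    rw [add_zero] at this
    rw [e0, this, (paraMask_side _ _ _ _).1]
    have : (x : ℤ) ≠ m := by omega
    simp [this, hn'.symm]
  · have := h.side_eq (a := 0) (b := 0) ⟨by omega, by omega⟩ ⟨by omega, by omega⟩ 3
    rw [cell_zero] at this
    rw [this, (paraMask_side _ _ _ _).2.2.1]
    simp
  · have := h.side_eq (a := m) (b := 0) ⟨by omega, by omega⟩ ⟨by omega, by omega⟩ 0
    rw [add_zero] at this
    rw [e0, this, (paraMask_side _ _ _ _).1]
    simp
  · have := h.isArc_iff (a := 0) (b := 0) ⟨by omega, by omega⟩ ⟨by omega, by omega⟩ 2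
    rw [cell_zero] at this
    rw [this]
    simp only [hm'.symm, hn'.symm, decide_true, decide_false]
    decide
  · rw [e0, h.isArc_iff ⟨by omega, by omega⟩ ⟨by omega, by omega⟩]
    simp only [hm', hn'.symm, decide_true, decide_false]
    decide
  · intro x hx
    rw [e1, h.side_eq ⟨by omega, by omega⟩ ⟨by omega, by omega⟩, (paraMask_side _ _ _ _).2.1]
    have : (x : ℤ) ≠ n := by omega
    simp [this, hm'.symm]
  · have := h.side_eq (a := 0) (b := 0) ⟨by omega, by omega⟩ ⟨by omega, by omega⟩ 4
    rw [cell_zero] at this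
    rw [show g + 1 + 3 = g + 4 by ring, this, (paraMask_side _ _ _ _).2.2.2]
    simp
  · rw [e1, h.side_eq ⟨by omega, by omega⟩ ⟨by omega, by omega⟩, (paraMask_side _ _ _ _).2.1]
    simp
  · have := h.isArc_iff (a := 0) (b := 0) ⟨by omega, by omega⟩ ⟨by omega, by omega⟩ 2
    rw [cell_zero] at this
    rw [this]
    simp only [hm'.symm, hn'.symm, decide_true, decide_false]
    decide
  · rw [e1, h.isArc_iff ⟨by omega, by omega⟩ ⟨by omega, by omega⟩]
    simp only [hn', hm'.symm, decide_true, decide_false]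
    decide

/-- At every obtuse corner of a parallelogram, one side of each length ends. -/
theorem IsPara.obtuse (h : IsPara S v g m n) (hm : 1 ≤ m) (hn : 1 ≤ n) {u : Node} (hu : u ∈ S)
    (h3 : isArc (gmask S u) 3) : ∃ v₁ g₁ v₂ g₂, IsLine S v₁ g₁ m ∧ IsLine S v₂ g₂ n ∧
      lineNode v₁ g₁ m = u ∧ lineNode v₂ g₂ n = u ∧ g₁ ≠ g₂ ∧
      ∀ d, GSide S u d → d = g₁ + 3 ∨ d = g₂ + 3 := by
  have hm' : (m : ℤ) ≠ 0 := by omega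
  have hn' : (n : ℤ) ≠ 0 := by omega
  have main : ∀ {v g}, IsPara S v g m n → u = cell v g m 0 → 
      ∃ v₁ g₁ v₂ g₂, IsLine S v₁ g₁ m ∧ IsLine S v₂ g₂ n ∧
      lineNode v₁ g₁ m = u ∧ lineNode v₂ g₂ n = u ∧ g₁ ≠ g₂ ∧
      ∀ d, GSide S u d → d = g₁ + 3 ∨ d = g₂ + 3 := by
    intro v g h huc
    refine ⟨v, g, cell v g m n, g + 3 + 1, (h.isLine hm hn).1, (h.rotate.isLine hm hn).2, ?_, ?_,
      ?_, ?_⟩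
    · conv_lhs => rw [← cell_zero v g]
      rw [lineNode_cell, zero_add, huc]
    · rw [huc, show g + 3 + 1 = g + 4 by ring]
      unfold lineNode cell
      rw [dirVec_four, ← natCast_zsmul]
      module
    · exact (by decide : ∀ g : Dir, g ≠ g + 3 + 1) g
    · intro d hd
      obtain ⟨s, rfl⟩ : ∃ s, d = g + s := ⟨d - g, by ring⟩
      rw [huc, h.side_eq ⟨by omega, le_rfl⟩ ⟨le_rfl, by omega⟩] at hd
      simp only [hm', hn'.symm, decide_true, decide_false] at hd
      have : ∀ s : Dir, side (paraMask false true true false) s = true → s = 3 ∨ s = 1 := by decide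
      rcases this s hd with rfl | rfl
      · exact Or.inl rfl
      · right
        have : (4 : Dir) + 3 = 1 := by decide
        rw [show g + 3 + 1 + 3 = g + (4 + 3) by ring, this]
  obtain ⟨a, b, ha, hb, rfl⟩ := (h u).1 hu
  rw [h.isArc_iff ha hb] at h3
  have key : ∀ a0 a1 b0 b1 : Bool, isArc (paraMask a0 a1 b0 b1) 3 →
    ¬ (a0 = true ∧ a1 = true) → ¬ (b0 = true ∧ b1 = true) →
    (a1 = true ∧ b0 = true) ∨ (a0 = true ∧ b1 = true) := by decide
  have h4 := key _ _ _ _ h3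
  simp only [decide_eq_true_eq] at h4
  rcases h4 (by omega) (by omega) with ⟨rfl, rfl⟩ | ⟨rfl, rfl⟩
  · exact main h rfl
  · refine main h.rotate ?_
    have : g + 3 + 1 = g + 4 := by ring
    unfold cell
    rw [this, dirVec_add_three, dirVec_four]
    module

/-- At every acute corner of a parallelogram, all side edges belong to sides that start there. -/
theorem IsPara.acute (h : IsPara S v g m n) (hm : 1 ≤ m) (hn : 1 ≤ n) {u : Node} {d : Dir}
    (hu : GSide S u d) (h2 : isArc (gmask S u) 2) : ∃ L, IsLine S u d L := by
  have hm' : (m : ℤ) ≠ 0 := by omega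
  have hn' : (n : ℤ) ≠ 0 := by omega
  have main : ∀ {v g}, IsPara S v g m n → u = v → ∃ L, IsLine S u d L := by
    rintro v g h rfl
    obtain ⟨s, rfl⟩ : ∃ s, d = g + s := ⟨d - g, by ring⟩
    have := h.side_eq (a := 0) (b := 0) ⟨by omega, by omega⟩ ⟨by omega, by omega⟩ s
    rw [cell_zero] at this
    rw [this] at hu
    simp only [hm'.symm, hn'.symm, decide_true, decide_false] at hu
    have : ∀ s : Dir, side (paraMask true false true false) s = true → s = 0 ∨ s = 1 := by decide
    rcases this s hu with rfl | rfl
    · rw [add_zero]; exact ⟨m, (h.isLine hm hn).1⟩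
    · exact ⟨n, (h.isLine hm hn).2⟩
  obtain ⟨a, b, ha, hb, rfl⟩ := (h u).1 hu.1
  rw [h.isArc_iff ha hb] at h2
  have key : ∀ a0 a1 b0 b1 : Bool, isArc (paraMask a0 a1 b0 b1) 2 →
    ¬ (a0 = true ∧ a1 = true) → ¬ (b0 = true ∧ b1 = true) →
    (a0 = true ∧ b0 = true) ∨ (a1 = true ∧ b1 = true) := by decide
  have h4 := key _ _ _ _ h2
  simp only [decide_eq_true_eq] at h4
  rcases h4 (by omega) (by omega) with ⟨rfl, rfl⟩ | ⟨rfl, rfl⟩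
  · exact main h (cell_zero _ _)
  · exact main h.rotate rfl

end

/-! ### Recognising parallelograms by their masks and sides -/

set_option maxRecDepth 10000 in
theorem isArc_two_cases : ∀ N : Mask, isArc N 2 → ∃ j : Dir, side N j = true ∧
    side N (j + 1) = true ∧ ∀ s, N (j + s) = decide (s = 0 ∨ s = 1) := by decide

set_option maxRecDepth 10000 in
theorem convex_bottom : ∀ N : Mask, isConvex N → side N 0 = true → side N 3 = true → N 2 = true →
    N 1 = true ∧ N 4 = false ∧ N 5 = false := by decide

set_option maxRecDepth 10000 in
theorem convex_bottom_end : ∀ N : Mask, isArc N 3 → side N 3 = true → N 2 = true →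
    N 1 = true ∧ side N 1 = true ∧ N 0 = false ∧ N 4 = false ∧ N 5 = false := by decide

set_option maxRecDepth 10000 in
theorem convex_left : ∀ N : Mask, isConvex N → side N 1 = true → side N 4 = true → N 5 = true →
    N 0 = true ∧ N 2 = false ∧ N 3 = false := by decide

set_option maxRecDepth 10000 in
theorem convex_left_end : ∀ N : Mask, isArc N 3 → side N 4 = true → N 5 = true →
    N 0 = true ∧ N 1 = false ∧ N 2 = false ∧ N 3 = false := by decide

set_option maxRecDepth 10000 in
theorem convex_right : ∀ N : Mask, isConvex N → side N 1 = true → side N 4 = true → N 3 = true →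
    N 2 = true ∧ N 0 = false ∧ N 5 = false := by decide

set_option maxRecDepth 10000 in
theorem convex_right_end : ∀ N : Mask, isArc N 2 → side N 4 = true → N 3 = true →
    N 0 = false ∧ N 1 = false ∧ N 2 = false ∧ N 5 = false := by decide

set_option maxRecDepth 10000 in
theorem convex_full : ∀ N : Mask, isConvex N → N 0 = true → N 2 = true → N 3 = true → N 4 = true →
    N 5 = true → N 1 = true := by decide

set_option maxRecDepth 10000 in
theorem convex_top : ∀ N : Mask, isConvex N → N 0 = true → N 2 = false → N 3 = true →
    N 4 = true → N 5 = true → N 1 = false := by decide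

theorem exists_corner {S : Finset Node} (hS : S.Nonempty) (hc : ∀ u ∈ S, isConvex (gmask S u)) :
    ∃ u ∈ S, isArc (gmask S u) 2 ∨ isArc (gmask S u) 3 := by
  -- a linear functional that distinguishes adjacent nodes is maximal at a corner
  obtain ⟨u, hu, hmax⟩ := S.exists_max_image (fun w : Node => 2 * w.1 + w.2) hS
  refine ⟨u, hu, isConvex_extreme _ (hc u hu) ?_ ?_ ?_⟩
  all_goals
    simp only [gmask, decide_eq_false_iff_not]
    intro h
    have := hmax _ h
    simp only [Prod.fst_add, Prod.snd_add] at this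
  · have e : dirVec 0 = (1, 0) := by decide
    rw [e] at this; simp at this
  · have e : dirVec 1 = (0, 1) := by decide
    rw [e] at this; simp at this
  · have e : dirVec 5 = (1, -1) := by decide
    rw [e] at this; simp at this; omega

theorem exists_acute {S : Finset Node} (hS : S.Nonempty) (hc : ∀ u ∈ S, isConvex (gmask S u))
    (ha : Alternating S) : ∃ u ∈ S, isArc (gmask S u) 2 := by
  obtain ⟨u, hu, h2 | h3⟩ := exists_corner hS hc
  · exact ⟨u, hu, h2⟩
  · obtain ⟨g, hg⟩ := isArc_three_side _ h3
    have hs : GSide S u g := ⟨hu, hg⟩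
    obtain ⟨L, hL⟩ := exists_isRun hs (hs.not_opposite_of_isArc (Or.inr h3))
    exact ⟨_, hL.mem le_rfl, (ha _ _ _ hL).2 h3⟩

/-- A structure with convex masks, each side of which has an acute and an obtuse corner, is a
parallelogram: starting from an acute corner, the rows are filled one after the other, and the two
sides at its neighbouring corners have the same length, since the top row would not fit otherwise.
-/
theorem exists_isPara {S : Finset Node} (hS : IsAmoebotStructure S)
    (hc : ∀ u ∈ S, isConvex (gmask S u)) (ha : Alternating S) :
    ∃ v g m n, 1 ≤ m ∧ 1 ≤ n ∧ IsPara S v g m n := by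
  have hne : S.Nonempty := by
    obtain ⟨x⟩ := hS.nonempty
    exact ⟨x, x.2⟩
  obtain ⟨v, hv, h2⟩ := exists_acute hne hc ha
  obtain ⟨g, hg, hg1, hmask⟩ := isArc_two_cases _ h2
  have hgs : GSide S v g := ⟨hv, hg⟩
  have hgs1 : GSide S v (g + 1) := ⟨hv, hg1⟩
  obtain ⟨m, hm⟩ := exists_isRun hgs (hgs.not_opposite_of_isArc (Or.inl h2))
  obtain ⟨n, hn⟩ := exists_isRun hgs1 (hgs1.not_opposite_of_isArc (Or.inl h2))
  have hmO := (ha _ _ _ hm).1 h2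
  have hnO := (ha _ _ _ hn).1 h2
  have e0 : ∀ x : ℕ, lineNode v g x = cell v g x 0 := fun x => by
    conv_lhs => rw [← cell_zero v g]
    rw [lineNode_cell, zero_add]
  have e1 : ∀ x : ℕ, lineNode v (g + 1) x = cell v g 0 x := fun x => by
    conv_lhs => rw [← cell_zero v g]
    rw [lineNode_cell', zero_add]
  -- membership of the node with given coordinates, and masks relative to `g`
  set Q : ℤ → ℤ → Prop := fun a b => cell v g a b ∈ S with hQ
  set M : ℤ → ℤ → Mask := fun a b s => gmask S (cell v g a b) (g + s) with hM
  have M0 : ∀ a b, M a b 0 = true ↔ Q (a + 1) b := fun a b => by simp [hM, hQ, gmask, ← cell_step0]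
  have M1 : ∀ a b, M a b 1 = true ↔ Q a (b + 1) := fun a b => by simp [hM, hQ, gmask, cell_step1]
  have M2 : ∀ a b, M a b 2 = true ↔ Q (a - 1) (b + 1) := fun a b => by
    simp [hM, hQ, gmask, cell_step2]
  have M3 : ∀ a b, M a b 3 = true ↔ Q (a - 1) b := fun a b => by simp [hM, hQ, gmask, cell_step3]
  have M4 : ∀ a b, M a b 4 = true ↔ Q a (b - 1) := fun a b => by simp [hM, hQ, gmask, cell_step4]
  have M5 : ∀ a b, M a b 5 = true ↔ Q (a + 1) (b - 1) := fun a b => by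
    simp [hM, hQ, gmask, cell_step5]
  have F : ∀ {x : Bool} {p : Prop}, (x = true ↔ p) → (x = false ↔ ¬ p) := fun h => by
    rw [← h, Bool.not_eq_true]
  have Mc : ∀ {a b}, Q a b → isConvex (M a b) := fun {a b} h => (isConvex_shift _ g).2 (hc _ h)
  have Ms : ∀ a b s, side (M a b) s = side (gmask S (cell v g a b)) (g + s) := fun a b s =>
    side_shift _ _ _
  have Ma : ∀ a b r, isArc (M a b) r ↔ isArc (gmask S (cell v g a b)) r := fun a b r =>
    isArc_shift _ _ _
  have hcorner : ∀ s, M 0 0 s = decide (s = 0 ∨ s = 1) := fun s => by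
    simp only [hM, cell_zero]; exact hmask s
  have hmpos := hm.pos
  have hnpos := hn.pos
  -- the side in direction `g`
  have bQ : ∀ x : ℕ, x ≤ m → Q x 0 := fun x hx => by
    have := hm.mem hx; rwa [e0] at this
  have bmid : ∀ x : ℕ, 0 < x → x < m → Q x 1 ∧ ¬ Q x (-1) ∧ ¬ Q (x + 1) (-1) := by
    intro x
    induction x with
    | zero => intro h; omega
    | succ x ih =>
      intro _ hx
      have h2 : M (x + 1) 0 2 = true := by
        rw [M2]
        simp only [add_sub_cancel_right, zero_add]
        rcases Nat.eq_zero_or_pos x with rfl | h0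
        · have := (M1 0 0).1 (by rw [hcorner]; simp)
          simpa using this
        · exact (ih h0 (by omega)).1
      have s0 := (hm.side _ hx).2
      have s3 := (hm.side_back (x := x) (by omega)).2
      rw [e0] at s0 s3
      have hq := bQ (x + 1) hx.le
      push_cast at *
      obtain ⟨h1, h4, h5⟩ := convex_bottom (M (x + 1) 0) (Mc hq) (by rw [Ms, add_zero]; exact s0)
        (by rw [Ms]; exact s3) h2
      rw [F (M4 _ _)] at h4
      rw [F (M5 _ _)] at h5
      rw [M1] at h1
      exact ⟨by simpa using h1, by simpa using h4, by simpa using h5⟩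
  have bend : Q m 1 ∧ side (M m 0) 1 = true ∧ ¬ Q (m + 1) 0 ∧ ¬ Q m (-1) ∧ ¬ Q (m + 1) (-1) := by
    obtain ⟨x, rfl⟩ := Nat.exists_eq_succ_of_ne_zero (Nat.one_le_iff_ne_zero.1 hmpos)
    have h2 : M (x + 1) 0 2 = true := by
      rw [M2]
      simp only [add_sub_cancel_right, zero_add]
      rcases Nat.eq_zero_or_pos x with rfl | h0
      · have := (M1 0 0).1 (by rw [hcorner]; simp)
        simpa using this
      · exact (bmid x h0 (by omega)).1
    have s3 := (hm.side_back (x := x) (by omega)).2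
    rw [e0] at s3 hmO
    push_cast at *
    obtain ⟨h1, h1', h0, h4, h5⟩ := convex_bottom_end (M (x + 1) 0) ((Ma _ _ _).2 hmO)
      (by rw [Ms]; exact s3) h2
    rw [F (M4 _ _)] at h4
    rw [F (M5 _ _)] at h5
    rw [F (M0 _ _)] at h0
    rw [M1] at h1
    exact ⟨by simpa using h1, h1', by simpa using h0, by simpa using h4, by simpa using h5⟩
  -- the side in direction `g + 1`
  have lQ : ∀ x : ℕ, x ≤ n → Q 0 x := fun x hx => by
    have := hn.mem hx; rwa [e1] at this
  have lmid : ∀ x : ℕ, 0 < x → x < n → Q 1 x ∧ ¬ Q (-1) x ∧ ¬ Q (-1) (x + 1) := by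
    intro x
    induction x with
    | zero => intro h; omega
    | succ x ih =>
      intro _ hx
      have h2 : M 0 (x + 1) 5 = true := by
        rw [M5]
        simp only [add_sub_cancel_right, zero_add]
        rcases Nat.eq_zero_or_pos x with rfl | h0
        · have := (M0 0 0).1 (by rw [hcorner]; simp)
          simpa using this
        · exact (ih h0 (by omega)).1
      have s0 := (hn.side _ hx).2
      have s3 := (hn.side_back (x := x) (by omega)).2
      rw [e1] at s0 s3
      have hq := lQ (x + 1) hx.le
      push_cast at *
      obtain ⟨h1, h4, h5⟩ := convex_left (M 0 (x + 1)) (Mc hq) (by rw [Ms]; exact s0)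
        (by rw [Ms, show (4 : Dir) = 1 + 3 by decide, ← add_assoc]; exact s3) h2
      rw [F (M2 _ _)] at h4
      rw [F (M3 _ _)] at h5
      rw [M0] at h1
      exact ⟨by simpa using h1, by simpa using h5, by simpa using h4⟩
  have lend : Q 1 n ∧ ¬ Q 0 (n + 1) ∧ ¬ Q (-1) (n + 1) ∧ ¬ Q (-1) n := by
    obtain ⟨x, rfl⟩ := Nat.exists_eq_succ_of_ne_zero (Nat.one_le_iff_ne_zero.1 hnpos)
    have h2 : M 0 (x + 1) 5 = true := by
      rw [M5]
      simp only [add_sub_cancel_right, zero_add]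
      rcases Nat.eq_zero_or_pos x with rfl | h0
      · have := (M0 0 0).1 (by rw [hcorner]; simp)
        simpa using this
      · exact (lmid x h0 (by omega)).1
    have s3 := (hn.side_back (x := x) (by omega)).2
    rw [e1] at s3 hnO
    push_cast at *
    obtain ⟨h0, h1, h4, h5⟩ := convex_left_end (M 0 (x + 1)) ((Ma _ _ _).2 hnO)
      (by rw [Ms, show (4 : Dir) = 1 + 3 by decide, ← add_assoc]; exact s3) h2
    rw [F (M1 _ _)] at h1
    rw [F (M2 _ _)] at h4
    rw [F (M3 _ _)] at h5
    rw [M0] at h0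
    exact ⟨by simpa using h0, by simpa using h1, by simpa using h4, by simpa using h5⟩
  -- the side that leaves the corner at the end of the first side in direction `g + 1`
  have hrs : GSide S (cell v g m 0) (g + 1) := ⟨bQ m le_rfl, by rw [← Ms]; exact bend.2.1⟩
  rw [e0] at hmO
  obtain ⟨n', hn'⟩ := exists_isRun hrs (hrs.not_opposite_of_isArc (Or.inr hmO))
  have hnA := (ha _ _ _ hn').2 hmO
  have e2 : ∀ x : ℕ, lineNode (cell v g m 0) (g + 1) x = cell v g m x := fun x => by
    rw [lineNode_cell', zero_add]
  have hn'pos := hn'.pos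
  have rQ : ∀ x : ℕ, x ≤ n' → Q m x := fun x hx => by
    have := hn'.mem hx; rwa [e2] at this
  have rmid : ∀ x : ℕ, 0 < x → x < n' → Q (m - 1) (x + 1) ∧ ¬ Q (m + 1) x ∧
      ¬ Q (m + 1) (x - 1) := by
    intro x
    induction x with
    | zero => intro h; omega
    | succ x ih =>
      intro _ hx
      have h2 : M m (x + 1) 3 = true := by
        rw [M3]
        rcases Nat.eq_zero_or_pos x with rfl | h0
        · have := bmid (m - 1)
          rcases Nat.lt_or_ge 1 m with h1 | h1
          · have := (this (by omega) (by omega)).1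
            rw [Nat.cast_sub hmpos] at this
            simpa using this
          · have : m = 1 := by omega
            have h3 := (M1 0 0).1 (by rw [hcorner]; simp)
            rw [this]
            simpa using h3
        · exact (ih h0 (by omega)).1
      have s0 := (hn'.side _ hx).2
      have s3 := (hn'.side_back (x := x) (by omega)).2
      rw [e2] at s0 s3
      have hq := rQ (x + 1) hx.le
      push_cast at *
      obtain ⟨h1, h4, h5⟩ := convex_right (M m (x + 1)) (Mc hq) (by rw [Ms]; exact s0)
        (by rw [Ms, show (4 : Dir) = 1 + 3 by decide, ← add_assoc]; exact s3) h2
      rw [F (M0 _ _)] at h4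
      rw [F (M5 _ _)] at h5
      rw [M2] at h1
      exact ⟨by simpa using h1, by simpa using h4, by simpa using h5⟩
  have rend : ¬ Q (m + 1) n' ∧ ¬ Q m (n' + 1) ∧ ¬ Q (m - 1) (n' + 1) ∧ ¬ Q (m + 1) (n' - 1) := by
    obtain ⟨x, rfl⟩ := Nat.exists_eq_succ_of_ne_zero (Nat.one_le_iff_ne_zero.1 hn'pos)
    have h2 : M m (x + 1) 3 = true := by
      rw [M3]
      rcases Nat.eq_zero_or_pos x with rfl | h0
      · have := bmid (m - 1)
        rcases Nat.lt_or_ge 1 m with h1 | h1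
        · have := (this (by omega) (by omega)).1
          rw [Nat.cast_sub hmpos] at this
          simpa using this
        · have : m = 1 := by omega
          have h3 := (M1 0 0).1 (by rw [hcorner]; simp)
          rw [this]
          simpa using h3
      · exact (rmid x h0 (by omega)).1
    have s3 := (hn'.side_back (x := x) (by omega)).2
    rw [e2] at s3 hnA
    push_cast at *
    obtain ⟨h0, h1, h4, h5⟩ := convex_right_end (M m (x + 1)) ((Ma _ _ _).2 hnA)
      (by rw [Ms, show (4 : Dir) = 1 + 3 by decide, ← add_assoc]; exact s3) h2
    rw [F (M0 _ _)] at h0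
    rw [F (M1 _ _)] at h1
    rw [F (M2 _ _)] at h4
    rw [F (M5 _ _)] at h5
    exact ⟨by simpa using h0, by simpa using h1, by simpa using h4, by simpa using h5⟩
  -- the rows between the two sides
  have rows : ∀ b : ℕ, b ≤ n → b ≤ n' → ∀ a : ℕ, a ≤ m → Q a b := by
    intro b
    induction b using Nat.strong_induction_on with
    | _ b ihb =>
      intro hbn hbn' a
      rcases Nat.eq_zero_or_pos b with rfl | hb
      · intro h; exact bQ a h
      obtain ⟨b, rfl⟩ := Nat.exists_eq_succ_of_ne_zero hb.ne'
      have row := ihb b (by omega) (by omega) (by omega)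
      induction a with
      | zero => intro _; exact lQ _ hbn
      | succ a iha =>
        intro ham
        rcases ham.lt_or_eq with ham | ham
        · rcases Nat.eq_zero_or_pos b with rfl | hb0
          · have := (bmid (a + 1) (by omega) ham).1
            push_cast at *; simpa using this
          · have row' := ihb (b - 1) (by omega) (by omega) (by omega)
            rw [Nat.cast_sub hb0] at row'
            have h0 := row (a + 2) (by omega)
            have h2 := iha (by omega)
            have h3 := row a (by omega)
            have h4 := row' (a + 1) (by omega)
            have h5 := row' (a + 2) (by omega)
            have hq := row (a + 1) (by omega)
            push_cast at *
            have := convex_full (M (a + 1) b) (Mc hq)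
              ((M0 _ _).2 (by rw [add_assoc, one_add_one_eq_two]; exact h0))
              ((M2 _ _).2 (by simpa using h2)) ((M3 _ _).2 (by simpa using h3))
              ((M4 _ _).2 h4) ((M5 _ _).2 (by rw [add_assoc, one_add_one_eq_two]; exact h5))
            exact (M1 _ _).1 this
        · have := rQ (b + 1) hbn'
          rw [ham]; exact this
  -- nothing lies above the row `n`
  have above : n ≤ n' → ∀ a : ℕ, a < m → ¬ Q a (n + 1) := by
    intro hnn a
    induction a with
    | zero => intro _; exact lend.2.1
    | succ a iha =>
      intro ham
      have row := rows n le_rfl hnn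
      have row' := rows (n - 1) (by omega) (by omega)
      rw [Nat.cast_sub hnpos] at row'
      have h0 := row (a + 2) (by omega)
      have h2 := iha (by omega)
      have h3 := row a (by omega)
      have h4 := row' (a + 1) (by omega)
      have h5 := row' (a + 2) (by omega)
      have hq := row (a + 1) (by omega)
      push_cast at *
      have := convex_top (M (a + 1) n) (Mc hq)
        ((M0 _ _).2 (by rw [add_assoc, one_add_one_eq_two]; exact h0))
        ((F (M2 _ _)).2 (by simpa using h2)) ((M3 _ _).2 (by simpa using h3))
        ((M4 _ _).2 h4) ((M5 _ _).2 (by rw [add_assoc, one_add_one_eq_two]; exact h5))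
      exact (F (M1 _ _)).1 this
  have hnn : n = n' := by
    rcases Nat.lt_trichotomy n n' with h | h | h
    · exfalso
      have h1 := (rmid n (by omega) h).1
      have h2 := above h.le (m - 1) (by omega)
      rw [Nat.cast_sub hmpos] at h2
      exact h2 h1
    · exact h
    · exfalso
      have key : ∀ a : ℕ, a < m → Q a (n' + 1) := by
        intro a
        induction a with
        | zero => intro _; exact_mod_cast lQ (n' + 1) h
        | succ a iha =>
          intro ham
          have row := rows n' h.le le_rfl
          have row' := rows (n' - 1) (by omega) (by omega)
          rw [Nat.cast_sub hn'pos] at row'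
          have h0 := row (a + 2) (by omega)
          have h2 := iha (by omega)
          have h3 := row a (by omega)
          have h4 := row' (a + 1) (by omega)
          have h5 := row' (a + 2) (by omega)
          have hq := row (a + 1) (by omega)
          push_cast at *
          have := convex_full (M (a + 1) n') (Mc hq)
            ((M0 _ _).2 (by rw [add_assoc, one_add_one_eq_two]; exact h0))
            ((M2 _ _).2 (by simpa using h2)) ((M3 _ _).2 (by simpa using h3))
            ((M4 _ _).2 h4) ((M5 _ _).2 (by rw [add_assoc, one_add_one_eq_two]; exact h5))
          exact (M1 _ _).1 this
      have h2 := key (m - 1) (by omega)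
      rw [Nat.cast_sub hmpos] at h2
      exact rend.2.2.1 h2
  subst hnn
  -- no neighbour outside is occupied
  have bottom : ∀ a : ℤ, 0 ≤ a → a ≤ m → ¬ Q a (-1) ∧ ¬ Q (a + 1) (-1) := by
    intro a h0 h1
    lift a to ℕ using h0
    rcases Nat.eq_zero_or_pos a with rfl | h0
    · have h4 := (F (M4 0 0)).1 (by rw [hcorner]; decide)
      have h5 := (F (M5 0 0)).1 (by rw [hcorner]; decide)
      exact ⟨by simpa using h4, by simpa using h5⟩
    · rcases (Nat.cast_le.1 h1).lt_or_eq with h1 | rfl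
      · exact (bmid a h0 h1).2
      · exact bend.2.2.2
  have left : ∀ b : ℤ, 0 ≤ b → b ≤ n → ¬ Q (-1) b ∧ ¬ Q (-1) (b + 1) := by
    intro a h0 h1
    lift a to ℕ using h0
    rcases Nat.eq_zero_or_pos a with rfl | h0
    · have h4 := (F (M3 0 0)).1 (by rw [hcorner]; decide)
      have h5 := (F (M2 0 0)).1 (by rw [hcorner]; decide)
      exact ⟨by simpa using h4, by simpa using h5⟩
    · rcases (Nat.cast_le.1 h1).lt_or_eq with h1 | rfl
      · exact (lmid a h0 h1).2
      · exact ⟨lend.2.2.2, lend.2.2.1⟩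
  have right : ∀ b : ℤ, 0 ≤ b → b ≤ n → ¬ Q (m + 1) b ∧ ¬ Q (m + 1) (b - 1) := by
    intro a h0 h1
    lift a to ℕ using h0
    rcases Nat.eq_zero_or_pos a with rfl | h0
    · exact ⟨by simpa using bend.2.2.1, by simpa using bend.2.2.2.2⟩
    · rcases (Nat.cast_le.1 h1).lt_or_eq with h1 | rfl
      · exact (rmid a h0 h1).2
      · exact ⟨rend.1, rend.2.2.2⟩
  have top : ∀ a : ℤ, 0 ≤ a → a ≤ m → ¬ Q a (n + 1) ∧ ¬ Q (a - 1) (n + 1) := by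
    have top' : ∀ a : ℕ, a ≤ m → ¬ Q a (n + 1) := by
      intro a h1
      rcases h1.lt_or_eq with h1 | rfl
      · exact above le_rfl a h1
      · exact rend.2.1
    intro a h0 h1
    lift a to ℕ using h0
    refine ⟨top' a (Nat.cast_le.1 h1), ?_⟩
    rcases Nat.eq_zero_or_pos a with rfl | h0
    · simpa using lend.2.2.1
    · have := top' (a - 1) (by have := Nat.cast_le.1 h1; omega)
      rwa [Nat.cast_sub h0] at this
  refine ⟨v, g, m, n, hmpos, hnpos, ?_⟩
  have hall := forall_mem_of_closed hS
    (fun w => ∃ a b : ℤ, (0 ≤ a ∧ a ≤ m) ∧ (0 ≤ b ∧ b ≤ n) ∧ w = cell v g a b) hv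
    ⟨0, 0, by omega, by omega, (cell_zero _ _).symm⟩ (by
      rintro w - ⟨a, b, hA, hB, rfl⟩ d hd
      obtain ⟨s, rfl⟩ : ∃ s, d = g + s := ⟨d - g, by ring⟩
      revert s
      apply forall_dir
      · rw [cell_step0]; intro hq
        refine ⟨_, _, ⟨by omega, ?_⟩, hB, rfl⟩
        by_contra hcon
        obtain rfl : a = m := by omega
        exact (right b hB.1 hB.2).1 hq
      · rw [cell_step1]; intro hq
        refine ⟨_, _, hA, ⟨by omega, ?_⟩, rfl⟩
        by_contra hcon
        obtain rfl : b = n := by omega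
        exact (top a hA.1 hA.2).1 hq
      · rw [cell_step2]; intro hq
        refine ⟨_, _, ⟨?_, by omega⟩, ⟨by omega, ?_⟩, rfl⟩
        · by_contra hcon
          obtain rfl : a = 0 := by omega
          exact (left b hB.1 hB.2).2 hq
        · by_contra hcon
          obtain rfl : b = n := by omega
          exact (top a hA.1 hA.2).2 hq
      · rw [cell_step3]; intro hq
        refine ⟨_, _, ⟨?_, by omega⟩, hB, rfl⟩
        by_contra hcon
        obtain rfl : a = 0 := by omega
        exact (left b hB.1 hB.2).1 hq
      · rw [cell_step4]; intro hq
        refine ⟨_, _, hA, ⟨?_, by omega⟩, rfl⟩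
        by_contra hcon
        obtain rfl : b = 0 := by omega
        exact (bottom a hA.1 hA.2).1 hq
      · rw [cell_step5]; intro hq
        refine ⟨_, _, ⟨by omega, ?_⟩, ⟨?_, by omega⟩, rfl⟩
        · by_contra hcon
          obtain rfl : a = m := by omega
          exact (right b hB.1 hB.2).2 hq
        · by_contra hcon
          obtain rfl : b = 0 := by omega
          exact (bottom a hA.1 hA.2).2 hq)
  intro w
  refine ⟨hall w, ?_⟩
  rintro ⟨a, b, hA, hB, rfl⟩
  obtain ⟨hA1, hA2⟩ := hA
  obtain ⟨hB1, hB2⟩ := hB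
  lift a to ℕ using hA1
  lift b to ℕ using hB1
  exact rows b (Nat.cast_le.1 hB2) (Nat.cast_le.1 hB2) a (Nat.cast_le.1 hA2)

/-! ### Segments, and the notion of a parallelogram -/

/-- The structure is the line segment that starts in `v` and has `l` edges in direction `g`. -/
def IsSegment (S : Finset Node) (v : Node) (g : Dir) (l : ℕ) : Prop :=
  ∀ w, w ∈ S ↔ ∃ x ≤ l, w = lineNode v g x

theorem IsSegment.mem {S : Finset Node} {v : Node} {g : Dir} {l : ℕ} (h : IsSegment S v g l)
    {x : ℕ} : lineNode v g x ∈ S ↔ x ≤ l := by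
  rw [h]
  constructor
  · rintro ⟨y, hy, he⟩
    rwa [lineNode_injective v g he]
  · intro hx; exact ⟨x, hx, rfl⟩

theorem lineNode_cell_zero (v : Node) (g : Dir) (x : ℕ) : lineNode v g x = cell v g x 0 := by
  conv_lhs => rw [← cell_zero v g]
  rw [lineNode_cell, zero_add]

theorem IsSegment.cell_mem {S : Finset Node} {v : Node} {g : Dir} {l : ℕ} (h : IsSegment S v g l)
    (a b : ℤ) : cell v g a b ∈ S ↔ b = 0 ∧ 0 ≤ a ∧ a ≤ l := by
  rw [h]
  constructor
  · rintro ⟨x, hx, he⟩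
    rw [lineNode_cell_zero] at he
    obtain ⟨rfl, rfl⟩ := cell_injective he
    omega
  · rintro ⟨rfl, h0, h1⟩
    lift a to ℕ using h0
    exact ⟨a, by omega, (lineNode_cell_zero _ _ _).symm⟩

/-- The mask of a node of a segment relative to its direction. -/
def segMask (a0 a1 : Bool) : Mask := (![!a1, false, false, !a0, false, false] : Fin 6 → Bool)

theorem IsSegment.mask {S : Finset Node} {v : Node} {g : Dir} {l : ℕ} (h : IsSegment S v g l)
    {x : ℕ} (hx : x ≤ l) : (fun s => gmask S (lineNode v g x) (g + s)) =
      segMask (decide (x = 0)) (decide (x = l)) := by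
  funext s
  rw [lineNode_cell_zero]
  revert s
  apply forall_dir
  · simp only [gmask, cell_step0, h.cell_mem]
    change _ = !decide (x = l)
    rw [← decide_not, decide_eq_decide, true_and]; omega
  · simp only [gmask, cell_step1, h.cell_mem]
    change _ = false
    rw [decide_eq_false_iff_not]; omega
  · simp only [gmask, cell_step2, h.cell_mem]
    change _ = false
    rw [decide_eq_false_iff_not]; omega
  · simp only [gmask, cell_step3, h.cell_mem]
    change _ = !decide (x = 0)
    rw [← decide_not, decide_eq_decide, true_and]; omega
  · simp only [gmask, cell_step4, h.cell_mem]
    change _ = false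
    rw [decide_eq_false_iff_not]; omega
  · simp only [gmask, cell_step5, h.cell_mem]
    change _ = false
    rw [decide_eq_false_iff_not]; omega

theorem segMask_facts : ∀ a0 a1 : Bool, ¬ (a0 = true ∧ a1 = true) →
    isSeg (segMask a0 a1) ∧ (isArc (segMask a0 a1) 1 ↔ a0 = true ∨ a1 = true) ∧
    ¬ isArc (segMask a0 a1) 2 ∧ ¬ isArc (segMask a0 a1) 3 := by decide

theorem IsSegment.isSeg {S : Finset Node} {v : Node} {g : Dir} {l : ℕ} (h : IsSegment S v g l)
    (hl : 1 ≤ l) {x : ℕ} (hx : x ≤ l) : isSeg (gmask S (lineNode v g x)) ∧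
      (isArc (gmask S (lineNode v g x)) 1 ↔ x = 0 ∨ x = l) ∧
      ¬ isArc (gmask S (lineNode v g x)) 2 ∧ ¬ isArc (gmask S (lineNode v g x)) 3 := by
  rw [← isSeg_shift _ g, ← isArc_shift _ g 1, ← isArc_shift _ g 2, ← isArc_shift _ g 3, h.mask hx]
  have := segMask_facts (decide (x = 0)) (decide (x = l))
  simp only [decide_eq_true_eq] at this
  exact this (by omega)

set_option maxRecDepth 10000 in
theorem isSeg_next : ∀ N : Mask, isConvex N ∨ isSeg N → N 3 = true → N 2 = false → N 4 = false →
    isSeg N ∧ ∀ s, N s = true → s = 0 ∨ s = 3 := by decide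

set_option maxRecDepth 10000 in
theorem isSeg_cases : ∀ N : Mask, isSeg N → ∃ g, N g = true ∧ ∀ s, N s = true → s = g ∨ s = g + 3 := by
  decide

theorem exists_last {S : Finset Node} {u : Node} (hu : u ∈ S) (g : Dir) :
    ∃ x, (∀ y ≤ x, lineNode u g y ∈ S) ∧ lineNode u g (x + 1) ∉ S := by
  classical
  have hex := exists_lineNode_not S u g
  have h0 : Nat.find hex ≠ 0 := by
    intro h0
    have := Nat.find_spec hex
    rw [h0, lineNode_zero] at this
    exact this hu
  obtain ⟨x, hx⟩ := Nat.exists_eq_succ_of_ne_zero h0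
  refine ⟨x, fun y hy => not_not.1 (Nat.find_min hex (by omega)), ?_⟩
  have := Nat.find_spec hex
  rwa [hx] at this

/-- If all masks are those of segments or convex polygons and one is that of a segment, then the
structure is a segment. -/
theorem exists_isSegment {S : Finset Node} (hS : IsAmoebotStructure S)
    (hc : ∀ u ∈ S, isConvex (gmask S u) ∨ isSeg (gmask S u)) {u : Node} (hu : u ∈ S)
    (hseg : isSeg (gmask S u)) : ∃ v g l, 1 ≤ l ∧ IsSegment S v g l := by
  obtain ⟨g, hg, hg'⟩ := isSeg_cases _ hseg
  have hmask : ∀ w ∈ S, ∀ s, gmask S w s = true → s = g ∨ s = g + 3 := by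
    refine forall_mem_of_closed hS (fun w => ∀ s, gmask S w s = true → s = g ∨ s = g + 3) hu hg' ?_
    intro w hw hT d hd s hs
    have hopp := gmask_opposite (S := S) (u := w) (g := d)
    have hd' : d = g ∨ d = g + 3 := hT d (by simpa [gmask] using hd)
    have hno : ∀ e, e ≠ g → e ≠ g + 3 → gmask S w e = false := by
      intro e h1 h2
      by_contra hcon
      rcases hT e (by simpa using hcon) with h | h
      · exact h1 h
      · exact h2 h
    have key : ∀ g d : Dir, d = g ∨ d = g + 3 → d - 1 ≠ g ∧ d - 1 ≠ g + 3 ∧ d + 1 ≠ g ∧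
      d + 1 ≠ g + 3 := by decide
    obtain ⟨k1, k2, k3, k4⟩ := key g d hd'
    have := isSeg_next (fun s => gmask S (w + dirVec d) (d + s))
      (by rw [isConvex_shift, isSeg_shift]; exact hc _ hd) (hopp.2.2 hw)
      (by
        have e : d + 2 = d + 3 - 1 := by ring
        rw [e, hopp.2.1]; exact hno _ k3 k4)
      (by
        have e : d + 4 = d + 3 + 1 := by ring
        rw [e, hopp.1]; exact hno _ k1 k2)
    have := this.2 (s - d) (by simpa using hs)
    rcases this with h | h
    · rw [sub_eq_zero] at h; rw [h]; exact hd'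
    · rw [sub_eq_iff_eq_add] at h
      rw [h]
      rcases hd' with rfl | rfl
      · right; ring
      · left; rw [add_comm, add_three_add_three]
  obtain ⟨x, -, hx⟩ := exists_last hu (g + 3)
  obtain ⟨x', hx', hx2⟩ := exists_last hu (g + 3)
  set v := lineNode u (g + 3) x' with hv
  have hvS : v ∈ S := hx' x' le_rfl
  obtain ⟨l, hl, hl2⟩ := exists_last hvS g
  have hall := forall_mem_of_closed hS (fun w => ∃ y ≤ l, w = lineNode v g y) hvS
    ⟨0, by omega, by simp⟩ (by
      rintro w hw ⟨y, hy, rfl⟩ d hd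
      rcases hmask _ hw d (by simpa [gmask] using hd) with rfl | rfl
      · rw [← lineNode_succ] at hd ⊢
        refine ⟨y + 1, ?_, rfl⟩
        by_contra hcon
        obtain rfl : y = l := by omega
        exact hl2 hd
      · cases y with
        | zero =>
          rw [lineNode_zero, hv, ← lineNode_succ] at hd
          exact absurd hd hx2
        | succ y =>
          rw [lineNode_succ, add_dirVec_add_three]
          exact ⟨y, by omega, rfl⟩)
  refine ⟨v, g, l, ?_, fun w => ⟨hall w, ?_⟩⟩
  · by_contra hl0
    obtain rfl : l = 0 := by omega
    have h1 : u + dirVec g ∈ S := by simpa [gmask] using hg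
    obtain ⟨y, hy, h2⟩ := hall _ hu
    obtain ⟨y', hy', h3⟩ := hall _ h1
    obtain rfl : y = 0 := by omega
    obtain rfl : y' = 0 := by omega
    rw [← h2] at h3
    exact dirVec_ne_zero g (by simpa using h3)
  · rintro ⟨y, hy, rfl⟩; exact hl y hy

theorem IsSegment.formsParallelogram {S : Finset Node} {v : Node} {g : Dir} {l : ℕ}
    (h : IsSegment S v g l) : FormsParallelogram S 0 l := by
  refine ⟨v, g + 1, g, ?_, ?_, fun w => ?_⟩
  · exact (by decide : ∀ g : Dir, g ≠ g + 1) g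
  · exact (by decide : ∀ g : Dir, g ≠ g + 1 + 3) g
  · rw [h]
    constructor
    · rintro ⟨x, hx, rfl⟩; exact ⟨0, le_rfl, x, hx, by simp [lineNode]⟩
    · rintro ⟨a, ha, x, hx, rfl⟩
      obtain rfl : a = 0 := by omega
      exact ⟨x, hx, by simp [lineNode]⟩

theorem FormsParallelogram.exists_isSegment {S : Finset Node} {l : ℕ}
    (h : FormsParallelogram S 0 l) : ∃ v g, IsSegment S v g l := by
  obtain ⟨v, i, j, -, -, h⟩ := h
  refine ⟨v, j, fun w => ?_⟩
  rw [h]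
  constructor
  · rintro ⟨a, ha, x, hx, rfl⟩
    obtain rfl : a = 0 := by omega
    exact ⟨x, hx, by simp [lineNode]⟩
  · rintro ⟨x, hx, rfl⟩; exact ⟨0, le_rfl, x, hx, by simp [lineNode]⟩

theorem IsPara.formsParallelogram {S : Finset Node} {v : Node} {g : Dir} {m n : ℕ}
    (h : IsPara S v g m n) : FormsParallelogram S m n ∧ FormsParallelogram S n m := by
  have key : ∀ w, w ∈ S ↔ ∃ a ≤ m, ∃ b ≤ n, w = v + a • dirVec g + b • dirVec (g + 1) := by
    intro w
    rw [h]
    constructor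
    · rintro ⟨a, b, ⟨ha, ha'⟩, ⟨hb, hb'⟩, rfl⟩
      lift a to ℕ using ha
      lift b to ℕ using hb
      exact ⟨a, by omega, b, by omega, by simp [cell]⟩
    · rintro ⟨a, ha, b, hb, rfl⟩
      exact ⟨a, b, by omega, by omega, by simp [cell]⟩
  refine ⟨⟨v, g, g + 1, ?_, ?_, key⟩, ⟨v, g + 1, g, ?_, ?_, ?_⟩⟩
  · exact (by decide : ∀ g : Dir, g + 1 ≠ g) g
  · exact (by decide : ∀ g : Dir, g + 1 ≠ g + 3) g
  · exact (by decide : ∀ g : Dir, g ≠ g + 1) g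
  · exact (by decide : ∀ g : Dir, g ≠ g + 1 + 3) g
  · intro w
    rw [key]
    constructor
    · rintro ⟨a, ha, b, hb, rfl⟩; exact ⟨b, hb, a, ha, by abel⟩
    · rintro ⟨a, ha, b, hb, rfl⟩; exact ⟨b, hb, a, ha, by abel⟩

/-- The directions of the sides may enclose angles of 60 or 120 degrees; in the second case, the
normal form starts from another corner. -/
theorem FormsParallelogram.exists_isPara {S : Finset Node} {h l : ℕ}
    (H : FormsParallelogram S h l) : ∃ v g, IsPara S v g h l ∨ IsPara S v g l h := by
  have main : ∀ (v : Node) (i j : Dir) (h l : ℕ), (j = i + 1 ∨ j = i + 2) →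
      (∀ w, w ∈ S ↔ ∃ a ≤ h, ∃ b ≤ l, w = v + a • dirVec i + b • dirVec j) →
      ∃ v g, IsPara S v g h l ∨ IsPara S v g l h := by
    rintro v i j h l (rfl | rfl) H
    · refine ⟨v, i, Or.inl fun w => ?_⟩
      rw [H]
      constructor
      · rintro ⟨a, ha, b, hb, rfl⟩
        exact ⟨a, b, by omega, by omega, by simp [cell]⟩
      · rintro ⟨a, b, ⟨ha, ha'⟩, ⟨hb, hb'⟩, rfl⟩
        lift a to ℕ using ha
        lift b to ℕ using hb
        exact ⟨a, by omega, b, by omega, by simp [cell]⟩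
    · have e : i + 2 + 1 = i + 3 := by ring
      refine ⟨v + h • dirVec i, i + 2, Or.inr fun w => ?_⟩
      rw [H]
      constructor
      · rintro ⟨a, ha, b, hb, rfl⟩
        refine ⟨b, h - a, by omega, by omega, ?_⟩
        unfold cell
        rw [e, dirVec_add_three, ← natCast_zsmul, ← natCast_zsmul, ← natCast_zsmul]
        module
      · rintro ⟨a, b, ⟨ha, ha'⟩, ⟨hb, hb'⟩, rfl⟩
        lift a to ℕ using ha
        lift b to ℕ using hb
        refine ⟨h - b, by omega, a, by omega, ?_⟩
        unfold cell
        have hb'' : b ≤ h := by omega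
        rw [e, dirVec_add_three, ← natCast_zsmul, ← natCast_zsmul, ← natCast_zsmul,
          Nat.cast_sub hb'']
        module
  obtain ⟨v, i, j, h1, h2, H⟩ := H
  have H' : ∀ w, w ∈ S ↔ ∃ b ≤ l, ∃ a ≤ h, w = v + b • dirVec j + a • dirVec i := by
    intro w
    rw [H]
    constructor
    · rintro ⟨a, ha, b, hb, rfl⟩; exact ⟨b, hb, a, ha, by abel⟩
    · rintro ⟨b, hb, a, ha, rfl⟩; exact ⟨a, ha, b, hb, by abel⟩
  have cases : ∀ i j : Dir, j ≠ i → j ≠ i + 3 →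
      (j = i + 1 ∨ j = i + 2) ∨ (i = j + 1 ∨ i = j + 2) := by decide
  rcases cases i j h1 h2 with hij | hij
  · exact main v i j h l hij H
  · obtain ⟨v, g, h3⟩ := main v j i l h hij H'
    exact ⟨v, g, h3.symm⟩

/-! ### Orienting the sides -/

namespace Detector

open AmoebotAlgorithm

variable {P : Detector} {S : Finset Node} {frame : Node → Frame}
  {ω : ℕ × Node → Fin (2 * (P.m + 1))}

theorem at_one (P : Detector) (S : Finset Node) (frame : Node → Frame)
    (ω : ℕ × Node → Fin (2 * (P.m + 1))) : P.At S frame ω 1 .tie := by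
  intro u _
  have h0 : P.st S frame ω 0 u = P.initSt := rfl
  rw [show 1 = 0 + 1 from rfl, st_succ_of_ne_done P S frame ω (by rw [h0]; simp [initSt])]
  exact ⟨by rw [h0]; rfl, rfl⟩

theorem gport_one (u : Node) (g : Dir) : P.gport S frame ω 1 u g = P.initPort := by
  have h0 : P.st S frame ω 0 u = P.initSt := rfl
  unfold gport
  rw [show 1 = 0 + 1 from rfl, st_succ_of_ne_done P S frame ω (by rw [h0]; simp [initSt])]
  rw [h0]
  rfl

theorem fail_one (u : Node) : (P.st S frame ω 1 u).fail = false ∧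
    (P.st S frame ω 1 u).dead = false := by
  have h0 : P.st S frame ω 0 u = P.initSt := rfl
  rw [show 1 = 0 + 1 from rfl, st_succ_of_ne_done P S frame ω (by rw [h0]; simp [initSt])]
  simp [h0, initSt, detects, reached]

theorem coin_one (u : Node) : (P.st S frame ω 1 u).coin = decide ((ω (0, u)).val % 2 = 1) := by
  have h0 : P.st S frame ω 0 u = P.initSt := rfl
  exact congrArg St.coin
    (st_succ_of_ne_done P S frame ω (t := 0) (u := u) (by rw [h0]; simp [initSt]))

theorem bool_eq_iff {x y : Bool} (h : x = true ↔ y = true) : x = y := by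
  cases x <;> cases y <;> simp_all

/-- The state of affairs while coins are tossed for the side edges, after `s` tosses. -/
structure Tossing (P : Detector) (S : Finset Node) (frame : Node → Frame)
    (ω : ℕ × Node → Fin (2 * (P.m + 1))) (t s : ℕ) : Prop where
  port : ∀ u ∈ S, ∀ g, ∃ o, P.gport S frame ω t u g = { P.initPort with own := o }
  own : ∀ u g, GSide S u g →
    ((P.gport S frame ω t u g).own = none ∧
      (P.gport S frame ω t (u + dirVec g) (g + 3)).own = none ∧
      ∀ s' < s, ((ω (2 * s', u)).val % 2 = 1 ↔ (ω (2 * s', u + dirVec g)).val % 2 = 1)) ∨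
    ∃ β, (P.gport S frame ω t u g).own = some β ∧
      (P.gport S frame ω t (u + dirVec g) (g + 3)).own = some (!β)
  fail : ∀ u ∈ S, (P.st S frame ω t u).fail = false
  dead : ∀ u ∈ S, (P.st S frame ω t u).dead = false

theorem tossing_one : Tossing P S frame ω 1 0 where
  port u _ g := ⟨none, by rw [gport_one]; rfl⟩
  own u g _ := by left; rw [gport_one, gport_one]; simp [initPort]
  fail u _ := (fail_one u).1
  dead u _ := (fail_one u).2

theorem Tossing.tie {s : ℕ} (h : Tossing P S frame ω (1 + 2 * s) s)
    (hat : P.At S frame ω (1 + 2 * s) .tie)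
    (hcoin : ∀ u ∈ S, (P.st S frame ω (1 + 2 * s) u).coin = decide ((ω (2 * s, u)).val % 2 = 1)) :
    Tossing P S frame ω (1 + 2 * s + 1) (s + 1) := by
  have hnd : ∀ b, (PC.tie : PC P.d P.r₀) ≠ .done b := by simp
  have hq : Quiet P .tie := Or.inl rfl
  refine ⟨fun u hu g => ?_, fun u g hs => ?_, fun u hu => ?_, fun u hu => ?_⟩
  · obtain ⟨o, ho⟩ := h.port u hu g
    rw [hat.port_succ hnd hu, ho]
    exact ⟨_, rfl⟩
  · have hsend : ∀ w ∈ S, ∀ d b, P.sends (P.st S frame ω (1 + 2 * s) w) ((frame w).lab d) b ↔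
        (P.gport S frame ω (1 + 2 * s) w d).own = none ∧
          b = (P.st S frame ω (1 + 2 * s) w).coin := by
      intro w hw d b
      unfold sends
      rw [hat.pc hw]
      rfl
    -- both end nodes of an edge compute their decision in the same way
    have key : ∀ w d, GSide S w d → (P.gport S frame ω (1 + 2 * s) w d).own = none →
        (P.gport S frame ω (1 + 2 * s) (w + dirVec d) (d + 3)).own = none →
        (P.gport S frame ω (1 + 2 * s + 1) w d).own =
          if (P.st S frame ω (1 + 2 * s) w).coin = (P.st S frame ω (1 + 2 * s) (w + dirVec d)).coin
          then none else some (P.st S frame ω (1 + 2 * s) w).coin := by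
      intro w d hw h1 h2
      obtain ⟨x1, x2, -, -⟩ := hat.signals_eq hq hw.mem d
      have hsig := fun b => hat.sig_iff_of_local (Or.inl rfl) hw b
      simp only [hsend _ hw.mem, hsend _ hw.next_mem, h1, h2, true_and] at hsig
      rw [hsig] at x1 x2
      rw [hat.port_succ hnd hw.mem]
      simp only [stepPort, h1, hw.2, and_self, if_true]
      cases h3 : (P.st S frame ω (1 + 2 * s) w).coin <;>
        cases h4 : (P.st S frame ω (1 + 2 * s) (w + dirVec d)).coin <;>
        simp_all
    have keep : ∀ w d β, w ∈ S → (P.gport S frame ω (1 + 2 * s) w d).own = some β →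
        (P.gport S frame ω (1 + 2 * s + 1) w d).own = some β := by
      intro w d β hw h1
      rw [hat.port_succ hnd hw]
      simp [stepPort, h1]
    rcases h.own u g hs with ⟨h1, h2, h3⟩ | ⟨β, h1, h2⟩
    · have k1 := key u g hs h1 h2
      have k2 := key _ _ hs.opposite h2 (by rw [add_three_add_three, add_dirVec_add_three]; exact h1)
      rw [add_dirVec_add_three] at k2
      have c1 := hcoin u hs.mem
      have c2 := hcoin _ hs.next_mem
      by_cases hc : (P.st S frame ω (1 + 2 * s) u).coin =
          (P.st S frame ω (1 + 2 * s) (u + dirVec g)).coin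
      · left
        rw [if_pos hc] at k1
        rw [if_pos hc.symm] at k2
        refine ⟨k1, k2, fun s' hs' => ?_⟩
        rcases (Nat.lt_succ_iff.1 hs').lt_or_eq with h' | rfl
        · exact h3 s' h'
        · rw [c1, c2, decide_eq_decide] at hc
          exact hc
      · right
        rw [if_neg hc] at k1
        rw [if_neg (Ne.symm hc)] at k2
        refine ⟨_, k1, ?_⟩
        rw [k2]
        revert hc
        cases (P.st S frame ω (1 + 2 * s) u).coin <;>
          cases (P.st S frame ω (1 + 2 * s) (u + dirVec g)).coin <;> simp
    · right
      exact ⟨β, keep _ _ _ hs.mem h1, keep _ _ _ hs.next_mem h2⟩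
  · rw [hat.fail_succ hnd hu, h.fail u hu]
    simp [detects, hat.pc hu]
  · rw [hat.dead_succ hnd hu, h.dead u hu]
    simp [reached, hat.pc hu]

theorem Tossing.tieAll {t s : ℕ} (h : Tossing P S frame ω t s)
    (hat : P.At S frame ω t .tieAll) : Tossing P S frame ω (t + 1) s := by
  have hnd : ∀ b, (PC.tieAll : PC P.d P.r₀) ≠ .done b := by simp
  have hport : ∀ u ∈ S, ∀ g, P.gport S frame ω (t + 1) u g = P.gport S frame ω t u g := by
    intro u hu g
    rw [hat.port_succ hnd hu]
    rfl
  refine ⟨fun u hu g => ?_, fun u g hs => ?_, fun u hu => ?_, fun u hu => ?_⟩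
  · rw [hport u hu]; exact h.port u hu g
  · rw [hport u hs.mem, hport _ hs.next_mem]; exact h.own u g hs
  · rw [hat.fail_succ hnd hu, h.fail u hu]
    simp [detects, hat.pc hu]
  · rw [hat.dead_succ hnd hu, h.dead u hu]
    simp [reached, hat.pc hu]

/-- The coins have been tossed until all side edges are decided. -/
theorem tossing_or_orient (hS : IsAmoebotStructure S) (s : ℕ) :
    (P.At S frame ω (1 + 2 * s) .tie ∧ Tossing P S frame ω (1 + 2 * s) s ∧
      (∀ u ∈ S, (P.st S frame ω (1 + 2 * s) u).coin = decide ((ω (2 * s, u)).val % 2 = 1)) ∧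
      (s ≠ 0 → ∃ u g, GSide S u g ∧ (P.gport S frame ω (1 + 2 * s) u g).own = none)) ∨
    ∃ R ≤ s, 1 ≤ R ∧ P.At S frame ω (1 + 2 * R) .orient ∧ Tossing P S frame ω (1 + 2 * R) R ∧
      ∀ u g, GSide S u g → (P.gport S frame ω (1 + 2 * R) u g).own ≠ none := by
  induction s with
  | zero =>
    left
    exact ⟨at_one P S frame ω, tossing_one, fun u _ => coin_one u, fun h => absurd rfl h⟩
  | succ s ih =>
    rcases ih with ⟨h1, h2, h3, -⟩ | ⟨R, hR, h⟩
    · have hnd : ∀ b, (PC.tie : PC P.d P.r₀) ≠ .done b := by simp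
      have hnd' : ∀ b, (PC.tieAll : PC P.d P.r₀) ≠ .done b := by simp
      have hat1 : P.At S frame ω (1 + 2 * s + 1) .tieAll := h1.next_of_forall hnd fun b => rfl
      have ht1 := h2.tie h1 h3
      have ht2 := ht1.tieAll hat1
      have e : 1 + 2 * (s + 1) = 1 + 2 * s + 1 + 1 := by ring
      have hport : ∀ u ∈ S, ∀ g, P.gport S frame ω (1 + 2 * s + 1 + 1) u g =
          P.gport S frame ω (1 + 2 * s + 1) u g := by
        intro u hu g
        rw [hat1.port_succ hnd' hu]
        rfl
      have hsh : ∀ v ∈ S, P.shouts (P.st S frame ω (1 + 2 * s + 1) v) ↔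
          ∃ g, GSide S v g ∧ (P.gport S frame ω (1 + 2 * s + 1) v g).own = none := by
        intro v hv
        unfold shouts
        rw [hat1.pc hv]
        constructor
        · rintro ⟨i, hi, ho⟩
          refine ⟨(frame v).dir i, ⟨hv, ?_⟩, by unfold gport; rwa [Frame.lab_dir]⟩
          rw [← hat1.side_lab hv, Frame.lab_dir]; exact hi
        · rintro ⟨g, hg, ho⟩
          exact ⟨(frame v).lab g, by rw [hat1.side_lab hv]; exact hg.2, ho⟩
      have hnext := hat1.next_of_global hS (Or.inl rfl)
      by_cases hex : ∃ v ∈ S, P.shouts (P.st S frame ω (1 + 2 * s + 1) v)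
      · left
        rw [e]
        refine ⟨?_, ht2, fun u hu => ?_, fun _ => ?_⟩
        · simpa [PC.next, hex] using hnext
        · rw [hat1.coin_succ hnd' hu, show 1 + 2 * s + 1 = 2 * (s + 1) by ring]
        · obtain ⟨v, hv, hv'⟩ := hex
          obtain ⟨g, hg, ho⟩ := (hsh v hv).1 hv'
          exact ⟨v, g, hg, by rw [hport v hv]; exact ho⟩
      · right
        refine ⟨s + 1, le_rfl, by omega, ?_⟩
        rw [e]
        refine ⟨?_, ht2, fun u g hg ho => ?_⟩
        · simpa [PC.next, hex] using hnext
        · rw [hport u hg.mem] at ho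
          exact hex ⟨u, hg.mem, (hsh u hg.mem).2 ⟨g, hg, ho⟩⟩
    · right
      exact ⟨R, by omega, h⟩

/-- If the ends of every side edge draw different coins in one of the first `R₁` tosses, then all side
edges are decided after at most `R₁` tosses. -/
theorem exists_orient (hS : IsAmoebotStructure S) {R₁ : ℕ} (hR₁ : 1 ≤ R₁)
    (hdiff : ∀ u g, GSide S u g → ∃ s < R₁,
      ¬ ((ω (2 * s, u)).val % 2 = 1 ↔ (ω (2 * s, u + dirVec g)).val % 2 = 1)) :
    ∃ R ≤ R₁, 1 ≤ R ∧ P.At S frame ω (1 + 2 * R) .orient ∧ Tossing P S frame ω (1 + 2 * R) R ∧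
      ∀ u g, GSide S u g → (P.gport S frame ω (1 + 2 * R) u g).own ≠ none := by
  rcases tossing_or_orient (P := P) (frame := frame) (ω := ω) hS R₁ with ⟨-, h2, -, h4⟩ | h
  · exfalso
    obtain ⟨u, g, hg, ho⟩ := h4 (by omega)
    rcases h2.own u g hg with ⟨-, -, h5⟩ | ⟨β, h5, -⟩
    · obtain ⟨s, hs, hne⟩ := hdiff u g hg
      exact hne (h5 s hs)
    · rw [ho] at h5; exact absurd h5 (by simp)
  · exact h

theorem isArc_two_three : ∀ N : Mask, isArc N 2 → ¬ isArc N 3 := by decide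

theorem _root_.IsRun.arc_end {S : Finset Node} (hc : ∀ u ∈ S, isConvex (gmask S u)) {v : Node} {g : Dir}
    {L r : ℕ} (h : IsRun S v g L) (hr : r = 2 ∨ r = 3) (hv : ¬ isArc (gmask S v) r) {y : ℕ}
    (hy : y < L) (ha : isArc (gmask S (lineNode v g y)) r ∨ isArc (gmask S (lineNode v g (y + 1))) r) :
    y + 1 = L ∧ isArc (gmask S (lineNode v g L)) r := by
  have key : ∀ z ≤ L, isArc (gmask S (lineNode v g z)) r → z = L := by
    intro z hz hz'
    by_contra hne
    rcases Nat.eq_zero_or_pos z with rfl | h0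
    · rw [lineNode_zero] at hz'; exact hv hz'
    · have := h.inner hc h0 (by omega)
      rcases hr with rfl | rfl
      · exact this.1 hz'
      · exact this.2 hz'
  rcases ha with ha | ha
  · have := key y hy.le ha; omega
  · have := key (y + 1) hy ha
    exact ⟨this, by rwa [this] at ha⟩

section

variable {t : ℕ}

theorem At.sends_orient (h : P.At S frame ω t .orient) {u : Node} (hu : u ∈ S) (g : Dir) (b : Bool) :
    P.sends (P.st S frame ω t u) ((frame u).lab g) b ↔
      isArc (gmask S u) 2 ∧ (P.gport S frame ω t u g).own = some b := by
  rw [← h.isArc_iff hu (by simp)]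
  unfold sends
  rw [h.pc hu]
  rfl

theorem At.sends_check (h : P.At S frame ω t .check) {u : Node} (hu : u ∈ S) (g : Dir) (b : Bool) :
    P.sends (P.st S frame ω t u) ((frame u).lab g) b ↔ isArc (gmask S u) 3 ∧ b = false := by
  rw [← h.isArc_iff hu (by simp)]
  unfold sends
  rw [h.pc hu]

theorem crossParity_false {c : ℕ → Bool} (h : ∀ x, 1 ≤ x → c x = false) (x : ℕ) :
    crossParity c x = false := by
  induction x with
  | zero => rfl
  | succ x ih => rw [crossParity, ih, h (x + 1) (by omega)]; rfl

theorem crossParity_congr {c c' : ℕ → Bool} {x : ℕ} (h : ∀ z, 1 ≤ z → z ≤ x → c z = c' z) :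
    crossParity c x = crossParity c' x := by
  induction x with
  | zero => rfl
  | succ x ih =>
    rw [crossParity, crossParity, ih fun z h1 h2 => h z h1 (by omega), h (x + 1) (by omega) le_rfl]

/-- The rounds of signals along the sides in which no node exchanges the tracks. -/
theorem At.sig_iff_of_straight {c : PC P.d P.r₀} (h : P.At S frame ω t c) (hc : Lined P c)
    (hc' : c ≠ .orient ∧ c ≠ .parity) {v : Node} {g : Dir} {L : ℕ} (hrun : IsRun S v g L) {x : ℕ}
    (hx : x < L) (b : Bool) :
    P.Sig S frame ω t (lineNode v g x) g b ↔ ∃ y < L,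
      (P.sends (P.st S frame ω t (lineNode v g y)) ((frame (lineNode v g y)).lab g) b ∨
       P.sends (P.st S frame ω t (lineNode v g (y + 1)))
        ((frame (lineNode v g (y + 1))).lab (g + 3)) b) := by
  rw [h.sig_iff_of_lined hc hrun hx]
  set cr := (fun z => P.cross (P.st S frame ω t (lineNode v g z)) ((frame (lineNode v g z)).lab g))
    with hcr
  have hf : ∀ z, z < L → crossParity cr z = false := by
    intro z hz
    rw [crossParity_congr (c' := fun _ => false), crossParity_false (fun _ _ => rfl)]
    intro z' h1 h2
    have hm := hrun.mem (x := z') (by omega)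
    simp only [hcr, cross, h.pc hm]
    rcases hc with rfl | rfl | rfl | rfl | ⟨j, rfl⟩ | rfl <;> simp_all
  constructor
  · rintro ⟨y, hy, b', hs, he⟩
    rw [hf x hx, hf y hy, Bool.xor_false, Bool.xor_false] at he
    exact ⟨y, hy, by rw [he]; exact hs⟩
  · rintro ⟨y, hy, hs⟩
    exact ⟨y, hy, b, hs, by rw [hf x hx, hf y hy]⟩

theorem _root_.IsLine.arc_two_iff {v : Node} {g : Dir} {L : ℕ} (hc : ∀ u ∈ S, isConvex (gmask S u))
    (h : IsLine S v g L) {x : ℕ} (hx : x ≤ L) : isArc (gmask S (lineNode v g x)) 2 ↔ x = 0 := by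
  constructor
  · intro h2
    by_contra h0
    rcases hx.lt_or_eq with hx | rfl
    · exact (h.toIsRun.inner hc (by omega) hx).1 h2
    · exact isArc_two_three _ h2 h.obtuse
  · rintro rfl; rw [lineNode_zero]; exact h.acute

theorem _root_.IsLine.arc_three_iff {v : Node} {g : Dir} {L : ℕ} (hc : ∀ u ∈ S, isConvex (gmask S u))
    (h : IsLine S v g L) {x : ℕ} (hx : x ≤ L) : isArc (gmask S (lineNode v g x)) 3 ↔ x = L := by
  constructor
  · intro h2
    by_contra h0
    rcases Nat.eq_zero_or_pos x with rfl | hx'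
    · rw [lineNode_zero] at h2
      exact isArc_two_three _ h.acute h2
    · exact (h.toIsRun.inner hc hx' (by omega)).2 h2
  · rintro rfl; exact h.obtuse

/-- In the round of orientation, the signal on an edge of a side tells whether the edge belongs to
its end node that is closer to the acute corner. -/
theorem Tossing.sig_orient {s : ℕ} (h : Tossing P S frame ω t s) (hat : P.At S frame ω t .orient)
    (hown : ∀ u g, GSide S u g → (P.gport S frame ω t u g).own ≠ none)
    (hc : ∀ u ∈ S, isConvex (gmask S u)) {v : Node} {g : Dir} {L : ℕ} (hl : IsLine S v g L)
    {x : ℕ} (hx : x < L) (b : Bool) : P.Sig S frame ω t (lineNode v g x) g b ↔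
      (P.gport S frame ω t (lineNode v g x) g).own = some b := by
  rw [hat.sig_iff_of_lined (Or.inl rfl) hl.toIsRun hx]
  set cr := (fun z => P.cross (P.st S frame ω t (lineNode v g z)) ((frame (lineNode v g z)).lab g))
    with hcr
  have ho : ∀ z < L, ∃ β, (P.gport S frame ω t (lineNode v g z) g).own = some β ∧
      (P.gport S frame ω t (lineNode v g (z + 1)) (g + 3)).own = some (!β) := by
    intro z hz
    have hs := hl.side z hz
    rcases h.own _ _ hs with ⟨h1, -⟩ | h1
    · exact absurd h1 (hown _ _ hs)
    · rw [lineNode_succ]; exact h1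
  choose! o ho1 ho2 using ho
  have hpar : ∀ z < L, crossParity cr z = (o z ^^ o 0) := by
    intro z
    induction z with
    | zero => intro _; simp [crossParity]
    | succ z ih =>
      intro hz
      rw [crossParity, ih (by omega)]
      have hm := hl.mem (x := z + 1) (by omega)
      have e1 := ho1 (z + 1) hz
      have e2 := ho2 z (by omega)
      unfold gport at e1 e2
      simp only [hcr, cross, hat.pc hm, ← Frame.lab_add_three, e1, e2]
      cases o z <;> cases o 0 <;> cases o (z + 1) <;> rfl
  have hsend : ∀ z ≤ L, ∀ d b, P.sends (P.st S frame ω t (lineNode v g z))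
      ((frame (lineNode v g z)).lab d) b ↔ z = 0 ∧
        (P.gport S frame ω t (lineNode v g z) d).own = some b := by
    intro z hz d b
    rw [hat.sends_orient (hl.mem hz), hl.arc_two_iff hc hz]
  rw [ho1 x hx, Option.some_inj]
  constructor
  · rintro ⟨y, hy, b', hs, he⟩
    rw [hsend y hy.le, hsend (y + 1) hy] at hs
    rcases hs with ⟨rfl, hs⟩ | ⟨h0, -⟩
    · rw [ho1 0 hy, Option.some_inj] at hs
      rw [hpar x hx, hpar 0 hy, ← hs] at he
      revert he
      cases b <;> cases o x <;> cases o 0 <;> simp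
    · omega
  · intro hb
    refine ⟨0, hl.pos, o 0, Or.inl ((hsend 0 (by omega) g _).2 ⟨rfl, ho1 0 hl.pos⟩), ?_⟩
    rw [hpar x hx, hpar 0 hl.pos, hb]
    cases b <;> cases o 0 <;> rfl

/-- The state of affairs between the orientation of the sides and the main loop. -/
structure Oriented (P : Detector) (S : Finset Node) (frame : Node → Frame)
    (ω : ℕ × Node → Fin (2 * (P.m + 1))) (t : ℕ) : Prop where
  port : ∀ u ∈ S, ∀ g, ∃ o p, P.gport S frame ω t u g = { P.initPort with own := o, pred := p }
  side : ∀ u ∈ S, ∀ g, (P.gport S frame ω t u g).pred = true → GSide S u g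
  pred : (∀ u ∈ S, isConvex (gmask S u)) → ∀ v g L, IsLine S v g L → ∀ x < L,
    (P.gport S frame ω t (lineNode v g x) g).pred = false ∧
    (P.gport S frame ω t (lineNode v g (x + 1)) (g + 3)).pred = true

theorem Tossing.oriented {s : ℕ} (h : Tossing P S frame ω t s) (hat : P.At S frame ω t .orient)
    (hown : ∀ u g, GSide S u g → (P.gport S frame ω t u g).own ≠ none) :
    Oriented P S frame ω (t + 1) := by
  have hnd : ∀ b, (PC.orient : PC P.d P.r₀) ≠ .done b := by simp
  have hq : Quiet P .orient := Or.inr (Or.inl rfl)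
  refine ⟨fun u hu g => ?_, fun u hu g hp => ?_, fun hc v g L hl x hx => ?_⟩
  · obtain ⟨o, ho⟩ := h.port u hu g
    rw [hat.port_succ hnd hu, ho]
    exact ⟨_, _, rfl⟩
  · rw [hat.port_succ hnd hu] at hp
    simp only [stepPort, Bool.and_eq_true] at hp
    exact ⟨hu, hp.1⟩
  · have hs := hl.side x hx
    have hs' := hl.toIsRun.side_back hx
    have hsig := fun b => h.sig_orient hat hown hc hl hx b
    obtain ⟨-, x2, -, -⟩ := hat.signals_eq hq hs.mem g
    obtain ⟨-, y2, -, -⟩ := hat.signals_eq hq hs'.mem (g + 3)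
    have hsig' := sig_opposite (P := P) (frame := frame) (ω := ω) (t := t) hs true
    rw [← lineNode_succ] at hsig'
    rw [hsig', hsig] at y2
    rw [hsig] at x2
    rw [hat.port_succ hnd hs.mem, hat.port_succ hnd hs'.mem]
    simp only [stepPort, hs.2, hs'.2, Bool.true_and]
    rcases h.own _ _ hs with ⟨h1, -⟩ | ⟨β, h1, h2⟩
    · exact absurd h1 (hown _ _ hs)
    · rw [← lineNode_succ] at h2
      rw [h1, Option.some_inj] at x2 y2
      have x3 := bool_eq_iff (x2.trans Iff.rfl)
      have y3 := bool_eq_iff (y2.trans Iff.rfl)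
      rw [x3, y3, h1, h2]
      cases β <;> simp

theorem Oriented.of_port_eq (h : Oriented P S frame ω t)
    (hp : ∀ u ∈ S, ∀ g, P.gport S frame ω (t + 1) u g = P.gport S frame ω t u g) :
    Oriented P S frame ω (t + 1) := by
  refine ⟨fun u hu g => ?_, fun u hu g => ?_, fun hc v g L hl x hx => ?_⟩
  · rw [hp u hu]; exact h.port u hu g
  · rw [hp u hu]; exact h.side u hu g
  · rw [hp _ (hl.side x hx).mem, hp _ (hl.toIsRun.side_back hx).mem]; exact h.pred hc v g L hl x hx

/-- A structure with convex masks in which no amoebot has rejected after the first two signals along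
the sides is alternating. -/
theorem At.alternating (hat : P.At S frame ω t .orient)
    (hc : ∀ u ∈ S, isConvex (gmask S u))
    (hf : ∀ u ∈ S, (P.st S frame ω (t + 2) u).fail = false) : Alternating S := by
  have hnd : ∀ b, (PC.orient : PC P.d P.r₀) ≠ .done b := by simp
  have hnd' : ∀ b, (PC.check : PC P.d P.r₀) ≠ .done b := by simp
  have hq : Quiet P .orient := Or.inr (Or.inl rfl)
  have hq' : Quiet P .check := Or.inr (Or.inr (Or.inl rfl))
  have hat1 : P.At S frame ω (t + 1) .check := hat.next_of_forall hnd fun b => rfl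
  have hf2 : ∀ u ∈ S, ¬ P.detects (P.st S frame ω t u) (P.heardAt S frame ω t u) ∧
      ¬ P.detects (P.st S frame ω (t + 1) u) (P.heardAt S frame ω (t + 1) u) := by
    intro u hu
    have := hf u hu
    rw [show t + 2 = t + 1 + 1 from rfl, hat1.fail_succ hnd' hu, hat.fail_succ hnd hu] at this
    simp only [Bool.or_eq_false_iff, decide_eq_false_iff_not] at this
    exact ⟨this.1.2, this.2⟩
  intro v g L hrun
  have hs := hrun.side 0 hrun.pos
  have hv := hs.mem
  rw [lineNode_zero] at hs hv
  constructor
  · intro h2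
    have := (hf2 v hv).2
    unfold detects at this
    rw [hat1.pc hv] at this
    simp only [hat1.isArc_iff hv (r := 2) (by simp), h2, true_and, not_exists, not_and] at this
    have := this ((frame v).lab g) (by rw [hat1.side_lab hv]; exact hs.2)
    rw [Bool.not_eq_false, hat1.gets_iff hq' hv] at this
    have hsig := hat1.sig_iff_of_straight (Or.inr (Or.inl rfl)) (by simp) hrun hrun.pos false
    rw [lineNode_zero] at hsig
    obtain ⟨y, hy, hsend⟩ := hsig.1 this
    rw [hat1.sends_check (hrun.mem hy.le), hat1.sends_check (hrun.mem hy)] at hsend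
    exact (hrun.arc_end hc (Or.inr rfl) (isArc_two_three _ h2) hy
      (hsend.imp And.left And.left)).2
  · intro h3
    have := (hf2 v hv).1
    unfold detects at this
    rw [hat.pc hv] at this
    simp only [hat.isArc_iff hv (r := 3) (by simp), h3, true_and, not_exists, not_and] at this
    have := this ((frame v).lab g) (by rw [hat.side_lab hv]; exact hs.2)
    have hex : ∃ b, P.Sig S frame ω t v g b := by
      by_cases h0 : P.gets (P.st S frame ω t v) (P.heardAt S frame ω t v) ((frame v).lab g) false
          = false
      · have := this h0
        rw [Bool.not_eq_false, hat.gets_iff hq hv] at this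
        exact ⟨_, this⟩
      · rw [Bool.not_eq_false, hat.gets_iff hq hv] at h0
        exact ⟨_, h0⟩
    obtain ⟨b, hb⟩ := hex
    have hsig := hat.sig_iff_of_lined (Or.inl rfl) hrun hrun.pos b
    rw [lineNode_zero] at hsig
    obtain ⟨y, hy, b', hsend, -⟩ := hsig.1 hb
    rw [hat.sends_orient (hrun.mem hy.le), hat.sends_orient (hrun.mem hy)] at hsend
    exact (hrun.arc_end hc (Or.inl rfl) (fun h2 => isArc_two_three _ h2 h3) hy
      (hsend.imp And.left And.left)).2

/-- In a parallelogram, no amoebot rejects because of the first two signals along the sides. -/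
theorem Tossing.fail_para {s : ℕ} (h : Tossing P S frame ω t s) (hat : P.At S frame ω t .orient)
    (hown : ∀ u g, GSide S u g → (P.gport S frame ω t u g).own ≠ none)
    {v : Node} {g : Dir} {m n : ℕ} (hm : 1 ≤ m) (hn : 1 ≤ n) (hp : IsPara S v g m n) :
    ∀ u ∈ S, (P.st S frame ω (t + 2) u).fail = false := by
  have hc := hp.isConvex hm hn
  have hnd : ∀ b, (PC.orient : PC P.d P.r₀) ≠ .done b := by simp
  have hnd' : ∀ b, (PC.check : PC P.d P.r₀) ≠ .done b := by simp
  have hq : Quiet P .orient := Or.inr (Or.inl rfl)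
  have hq' : Quiet P .check := Or.inr (Or.inr (Or.inl rfl))
  have hat1 : P.At S frame ω (t + 1) .check := hat.next_of_forall hnd fun b => rfl
  intro u hu
  rw [show t + 2 = t + 1 + 1 from rfl, hat1.fail_succ hnd' hu, hat.fail_succ hnd hu, h.fail u hu]
  simp only [Bool.false_or, Bool.or_eq_false_iff, decide_eq_false_iff_not]
  constructor
  · unfold detects
    rw [hat.pc hu]
    simp only [hat.isArc_iff hu (r := 3) (by simp)]
    rintro ⟨h3, i, hi, h0, h1⟩
    obtain ⟨d, rfl⟩ : ∃ d, i = (frame u).lab d := ⟨(frame u).dir i, by simp⟩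
    rw [hat.side_lab hu] at hi
    have hs : GSide S u d := ⟨hu, hi⟩
    obtain ⟨v₁, g₁, v₂, g₂, l1, l2, e1, e2, -, hd⟩ := hp.obtuse hm hn hu h3
    have key : ∀ {v' g' L}, IsLine S v' g' L → lineNode v' g' L = u → d = g' + 3 → False := by
      rintro v' g' L hl rfl rfl
      obtain ⟨x, rfl⟩ := Nat.exists_eq_succ_of_ne_zero (Nat.one_le_iff_ne_zero.1 hl.pos)
      have hs' := hl.side x (Nat.lt_succ_self x)
      have hsig := fun b => h.sig_orient hat hown hc hl (Nat.lt_succ_self x) b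
      have hopp := fun b => sig_opposite (P := P) (frame := frame) (ω := ω) (t := t) hs' b
      obtain ⟨b, hb⟩ := Option.ne_none_iff_exists'.1 (hown _ _ hs')
      have : P.Sig S frame ω t (lineNode v' g' (x + 1)) (g' + 3) b := by
        rw [lineNode_succ, hopp, hsig]; exact hb
      rw [← hat.gets_iff hq hu] at this
      cases b
      · rw [this] at h0; exact absurd h0 (by simp)
      · rw [this] at h1; exact absurd h1 (by simp)
    rcases hd d hs with h4 | h4
    · exact key l1 e1 h4
    · exact key l2 e2 h4
  · unfold detects
    rw [hat1.pc hu]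
    simp only [hat1.isArc_iff hu (r := 2) (by simp)]
    rintro ⟨h2, i, hi, h0⟩
    obtain ⟨d, rfl⟩ : ∃ d, i = (frame u).lab d := ⟨(frame u).dir i, by simp⟩
    rw [hat1.side_lab hu] at hi
    obtain ⟨L, hl⟩ := hp.acute hm hn ⟨hu, hi⟩ h2
    have hsig := hat1.sig_iff_of_straight (Or.inr (Or.inl rfl)) (by simp) hl.toIsRun hl.pos false
    rw [lineNode_zero] at hsig
    have : P.Sig S frame ω (t + 1) u d false := by
      rw [hsig]
      have := hl.pos
      refine ⟨L - 1, by omega, Or.inr ?_⟩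
      rw [Nat.sub_add_cancel hl.pos, hat1.sends_check (hl.mem le_rfl)]
      exact ⟨hl.obtuse, rfl⟩
    rw [← hat1.gets_iff hq' hu, h0] at this
    exact absurd this (by simp)

theorem IsSegment.fail_check {s : ℕ} (h : Tossing P S frame ω t s)
    (hat : P.At S frame ω t .orient)
    {v : Node} {g : Dir} {l : ℕ} (hl : 1 ≤ l) (hp : IsSegment S v g l) :
    ∀ u ∈ S, (P.st S frame ω (t + 2) u).fail = false := by
  have hnd : ∀ b, (PC.orient : PC P.d P.r₀) ≠ .done b := by simp
  have hnd' : ∀ b, (PC.check : PC P.d P.r₀) ≠ .done b := by simp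
  have hat1 : P.At S frame ω (t + 1) .check := hat.next_of_forall hnd fun b => rfl
  intro u hu
  rw [show t + 2 = t + 1 + 1 from rfl, hat1.fail_succ hnd' hu, hat.fail_succ hnd hu, h.fail u hu]
  obtain ⟨x, hx, rfl⟩ := (hp u).1 hu
  have hm := hp.isSeg hl hx
  simp [detects, hat.pc hu, hat1.pc hu, hat.isArc_iff hu (r := 3) (by simp),
    hat1.isArc_iff hu (r := 2) (by simp), hm.2.2.1, hm.2.2.2]

end

end Detector

/-! ### The length of a segment -/

namespace Detector

open AmoebotAlgorithm

variable {P : Detector} {S : Finset Node} {frame : Node → Frame}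
  {ω : ℕ × Node → Fin (2 * (P.m + 1))} {t : ℕ}

theorem At.hop (hat : P.At S frame ω t .check) {r : ℕ} (hr : r ≤ P.r₀) :
    P.At S frame ω (t + 1 + r) (.hop ⟨r, by omega⟩) := by
  induction r with
  | zero => exact hat.next_of_forall (by simp) fun b => rfl
  | succ r ih =>
    refine (ih (by omega)).next_of_forall (by simp) fun b => ?_
    simp only [PC.next]
    rw [dif_pos (by omega)]

theorem At.hopAll (hat : P.At S frame ω t .check) : P.At S frame ω (t + 2 + P.r₀) .hopAll := by
  have := (hat.hop le_rfl).next_of_forall (c' := .hopAll) (by simp) fun b => by simp [PC.next]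
  rwa [show t + 1 + P.r₀ + 1 = t + 2 + P.r₀ by ring] at this

theorem At.loop (hat : P.At S frame ω t .check) : P.At S frame ω (t + 3 + P.r₀) .parity := by
  have := hat.hopAll.next_of_forall (c' := .parity) (by simp) fun b => rfl
  rwa [show t + 2 + P.r₀ + 1 = t + 3 + P.r₀ by ring] at this

theorem Oriented.loop (h : Oriented P S frame ω t) (hat : P.At S frame ω t .check) :
    Oriented P S frame ω (t + 3 + P.r₀) := by
  have h0 : ∀ r ≤ P.r₀, Oriented P S frame ω (t + 1 + r) := by
    intro r
    induction r with
    | zero => exact fun _ => h.of_port_eq fun u hu g => hat.port_succ (by simp) hu g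
    | succ r ih =>
      exact fun hr => (ih (by omega)).of_port_eq fun u hu g =>
        (hat.hop (r := r) (by omega)).port_succ (by simp) hu g
  have h1 := (h0 _ le_rfl).of_port_eq fun u hu g => (hat.hop le_rfl).port_succ (by simp) hu g
  rw [show t + 1 + P.r₀ + 1 = t + 2 + P.r₀ by ring] at h1
  have h2 := h1.of_port_eq fun u hu g => hat.hopAll.port_succ (by simp) hu g
  rwa [show t + 2 + P.r₀ + 1 = t + 3 + P.r₀ by ring] at h2

/-- While the ends of a segment are removed one after the other, a node that is still there
receives a beep from exactly those neighbours that have been removed. -/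
theorem At.mem_heardAt_hop {r : Fin (P.r₀ + 1)} (hat : P.At S frame ω t (.hop r)) {u : Node}
    (ha : (P.st S frame ω t u).dead = false) (g : Dir) (j : Fin (P.K + 2)) :
    ((frame u).lab g, j) ∈ P.heardAt S frame ω t u ↔
      u + dirVec g ∈ S ∧ (P.st S frame ω t (u + dirVec g)).dead = true := by
  have hbot : P.alg.circuitGraph S frame (P.st S frame ω t) = ⊥ := by
    apply circuitGraph_eq_bot
    intro w hw
    change P.wires _ = ⊥
    simp [wires, hat.pc hw]
  have hsh : ∀ v ∈ S, P.shouts (P.st S frame ω t v) ↔ (P.st S frame ω t v).dead = true := by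
    intro v hv
    simp [shouts, hat.pc hv]
  have hmem : ((frame u).lab g, j) ∈ P.heardAt S frame ω t u ↔ ∃ v ∈ S,
      ∃ b ∈ P.beeps (P.st S frame ω t v), (frame v).pin v b = (frame u).pin u ((frame u).lab g, j) := by
    unfold heardAt heard
    rw [Set.mem_ofPred_eq, hbot]
    simp only [SimpleGraph.reachable_bot]
    rfl
  rw [hmem]
  constructor
  · rintro ⟨v, hv, b, hb, he⟩
    have hd : (P.st S frame ω t v).dead = true := by
      by_contra hd
      rw [beeps_eq_empty (by rwa [hsh v hv])] at hb
      · exact hb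
      · intro i b; simp [sends, hat.pc hv]
    rw [Frame.pin_eq_pinAt _ u, Frame.dir_lab] at he
    obtain ⟨i, j'⟩ := b
    rw [Frame.pin_eq_pinAt] at he
    rcases pinAt_injective he.symm with ⟨h1, -, -⟩ | ⟨h1, -, -⟩
    · rw [h1, hd] at ha; exact absurd ha (by simp)
    · rw [← h1]; exact ⟨hv, hd⟩
  · rintro ⟨hv, hd⟩
    refine ⟨_, hv, ((frame (u + dirVec g)).lab (g + 3),
      if (frame (u + dirVec g)).clockwise then (if (frame u).clockwise then j.rev else j) else
        (if (frame u).clockwise then j.rev else j).rev), ?_, ?_⟩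
    · rw [beeps_of_shouts ((hsh _ hv).2 hd)]; trivial
    · rw [Frame.pin_eq_pinAt, Frame.pin_eq_pinAt, Frame.dir_lab, Frame.dir_lab,
        ← pinAt_opposite u g]
      congr 1
      cases (frame u).clockwise <;> cases (frame (u + dirVec g)).clockwise <;> simp

theorem At.nonempty_heardAt_hop {r : Fin (P.r₀ + 1)} (hat : P.At S frame ω t (.hop r)) {u : Node}
    (ha : (P.st S frame ω t u).dead = false) :
    (P.heardAt S frame ω t u).Nonempty ↔
      ∃ g, u + dirVec g ∈ S ∧ (P.st S frame ω t (u + dirVec g)).dead = true := by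
  constructor
  · rintro ⟨⟨i, j⟩, h⟩
    rw [← (frame u).lab_dir i] at h
    exact ⟨_, (hat.mem_heardAt_hop ha _ j).1 h⟩
  · rintro ⟨g, h⟩
    exact ⟨_, (hat.mem_heardAt_hop ha g 0).2 h⟩

theorem _root_.IsSegment.next_mem {v : Node} {g : Dir} {l : ℕ} (h : IsSegment S v g l) {x : ℕ}
    (hx : x ≤ l) (d : Dir) : lineNode v g x + dirVec d ∈ S ↔ (d = g ∧ x < l) ∨ (d = g + 3 ∧ 0 < x) := by
  have := congrFun (h.mask hx) (d - g)
  simp only [add_sub_cancel] at this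
  have h2 : lineNode v g x + dirVec d ∈ S ↔ segMask (decide (x = 0)) (decide (x = l)) (d - g) := by
    rw [← this]; simp [gmask]
  have e1 : d = g ↔ d - g = 0 := sub_eq_zero.symm
  have e2 : d = g + 3 ↔ d - g = 3 := by rw [sub_eq_iff_eq_add']
  rw [h2, e1, e2]
  generalize d - g = s
  have key : ∀ a0 a1 : Bool, ∀ s : Dir, segMask a0 a1 s = true ↔
      (s = 0 ∧ a1 = false) ∨ (s = 3 ∧ a0 = false) := by decide
  rw [key]
  simp only [decide_eq_false_iff_not]
  refine or_congr (and_congr_right fun _ => by omega) (and_congr_right fun _ => by omega)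

theorem lineNode_pred (v : Node) (g : Dir) {x : ℕ} (hx : 0 < x) :
    lineNode v g x + dirVec (g + 3) = lineNode v g (x - 1) := by
  obtain ⟨y, rfl⟩ := Nat.exists_eq_succ_of_ne_zero hx.ne'
  rw [lineNode_succ, add_dirVec_add_three]; rfl

open scoped Classical in
/-- After `r` rounds, the nodes at distance less than `r` from an end are removed. -/
theorem IsSegment.dead_iff {v : Node} {g : Dir} {l : ℕ} (hl : 1 ≤ l) (hp : IsSegment S v g l)
    (hat : P.At S frame ω t .check)
    (hd : ∀ u ∈ S, (P.st S frame ω (t + 1) u).dead = false) {r : ℕ} (hr : r ≤ P.r₀) {x : ℕ}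
    (hx : x ≤ l) : (P.st S frame ω (t + 1 + r) (lineNode v g x)).dead = true ↔ x < r ∨ l < x + r := by
  induction r generalizing x with
  | zero => rw [add_zero, hd _ (hp.mem.2 hx)]; simp; omega
  | succ r ih =>
    have hatr := hat.hop (r := r) (by omega)
    have ih' := fun x hx => ih (by omega) (x := x) hx
    have hm := hp.mem.2 hx
    rw [← add_assoc, hatr.dead_succ (by simp) hm, Bool.or_eq_true, decide_eq_true_eq, ih' x hx]
    by_cases ha : x < r ∨ l < x + r
    · simp only [ha, true_or, true_iff]; omega
    simp only [ha, false_or]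
    have ha' : (P.st S frame ω (t + 1 + r) (lineNode v g x)).dead = false := by
      by_contra h0
      exact ha ((ih' x hx).1 (by simpa using h0))
    unfold reached
    rw [hatr.pc hm]
    have hne : (⟨r, by omega⟩ : Fin (P.r₀ + 1)) ≠ Fin.last P.r₀ := by
      simp [Fin.ext_iff]; omega
    simp only [ne_eq, hne, not_false_eq_true, true_and]
    rw [hatr.isArc_iff hm (by simp), (hp.isSeg hl hx).2.1, hatr.nonempty_heardAt_hop ha']
    constructor
    · rintro (h | ⟨d, h1, h2⟩)
      · omega
      · rcases (hp.next_mem hx d).1 h1 with ⟨rfl, h3⟩ | ⟨rfl, h3⟩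
        · rw [← lineNode_succ, ih' _ (by omega)] at h2; omega
        · rw [lineNode_pred _ _ h3, ih' _ (by omega)] at h2; omega
    · intro h
      by_cases h0 : x = 0 ∨ x = l
      · exact Or.inl h0
      right
      rcases h with h | h
      · refine ⟨g + 3, (hp.next_mem hx _).2 (Or.inr ⟨rfl, by omega⟩), ?_⟩
        rw [lineNode_pred _ _ (by omega), ih' _ (by omega)]; omega
      · refine ⟨g, (hp.next_mem hx _).2 (Or.inl ⟨rfl, by omega⟩), ?_⟩
        rw [← lineNode_succ, ih' _ (by omega)]; omega

theorem fail_hop_of_isConvex (hat : P.At S frame ω t .check) (hc : ∀ u ∈ S, ¬ isSeg (gmask S u))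
    {u : Node} (hu : u ∈ S) :
    (P.st S frame ω (t + 3 + P.r₀) u).fail = (P.st S frame ω (t + 1) u).fail := by
  have h0 : ∀ r ≤ P.r₀, (P.st S frame ω (t + 1 + r) u).fail = (P.st S frame ω (t + 1) u).fail := by
    intro r
    induction r with
    | zero => exact fun _ => rfl
    | succ r ih =>
      intro hr
      have h1 := hat.hop (r := r) (by omega)
      rw [← add_assoc, h1.fail_succ (by simp) hu, ih (by omega)]
      simp [detects, h1.pc hu, h1.isSeg_iff hu, hc u hu]
  have h1 := hat.hop le_rfl
  rw [show t + 3 + P.r₀ = t + 2 + P.r₀ + 1 by ring, hat.hopAll.fail_succ (by simp) hu,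
    show t + 2 + P.r₀ = t + 1 + P.r₀ + 1 by ring, h1.fail_succ (by simp) hu, h0 _ le_rfl,
    show t + 1 + P.r₀ + 1 = t + 2 + P.r₀ by ring]
  simp [detects, h1.pc hu, hat.hopAll.pc hu, h1.isSeg_iff hu, hat.hopAll.isSeg_iff hu, hc u hu]

/-- The silent neighbours of a node that is left are those that are left as well. -/
theorem At.silent_eq {r : Fin (P.r₀ + 1)} (hat : P.At S frame ω t (.hop r)) {v : Node} {g : Dir}
    {l : ℕ} (hp : IsSegment S v g l) {x : ℕ} (hx : x ≤ l)
    (hdead : ∀ x ≤ l, (P.st S frame ω t (lineNode v g x)).dead = true ↔ x < r ∨ l < x + r)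
    (ha : ¬ (x < r ∨ l < x + r)) :
    P.silent (P.st S frame ω t (lineNode v g x)).nb (P.heardAt S frame ω t (lineNode v g x)) =
      (if x + 1 + r ≤ l then 1 else 0) + (if r + 1 ≤ x then 1 else 0) := by
  classical
  have hm := hp.mem.2 hx
  have ha' : (P.st S frame ω t (lineNode v g x)).dead = false := by
    by_contra h0
    exact ha ((hdead x hx).1 (by simpa using h0))
  set f := frame (lineNode v g x) with hf
  have hset : (Finset.univ.filter fun i => (P.st S frame ω t (lineNode v g x)).nb i = true ∧
      ∀ j, (i, j) ∉ P.heardAt S frame ω t (lineNode v g x)) =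
      (if x + 1 + r ≤ l then {f.lab g} else ∅) ∪ (if r + 1 ≤ x then {f.lab (g + 3)} else ∅) := by
    ext i
    obtain ⟨d, rfl⟩ : ∃ d, i = f.lab d := ⟨f.dir i, by simp⟩
    have hlab : ∀ e, f.lab d = f.lab e ↔ d = e := fun e =>
      ⟨fun h => by rw [← f.dir_lab d, h, f.dir_lab], fun h => by rw [h]⟩
    have h1 : (P.st S frame ω t (lineNode v g x)).nb (f.lab d) = true ↔
        (d = g ∧ x < l) ∨ (d = g + 3 ∧ 0 < x) := by
      rw [hat.nb hm, ← hp.next_mem hx]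
      simp [lmask, hf, gmask]
    have h2 : ∀ j, (f.lab d, j) ∈ P.heardAt S frame ω t (lineNode v g x) ↔ _ :=
      fun j => hat.mem_heardAt_hop ha' d j
    simp only [Finset.mem_filter, Finset.mem_univ, true_and, h1, h2, forall_const]
    clear h2 h1
    have hm1 : ∀ {A : Prop} [Decidable A] {e : Dir},
        f.lab d ∈ (if A then ({f.lab e} : Finset Dir) else ∅) ↔ A ∧ d = e := by
      intro A _ e
      by_cases hA : A <;> simp [hA, hlab]
    rw [Finset.mem_union, hm1, hm1]
    have hg3 : g + 3 ≠ g := by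
      intro h
      have : (3 : Dir) = 0 := by simpa using h
      exact absurd this (by decide)
    constructor
    · rintro ⟨⟨rfl, h2⟩ | ⟨rfl, h2⟩, h3⟩
      · left
        refine ⟨?_, rfl⟩
        by_contra h4
        apply h3
        rw [← lineNode_succ]
        exact ⟨hp.mem.2 h2, (hdead _ h2).2 (by omega)⟩
      · right
        refine ⟨?_, rfl⟩
        by_contra h4
        apply h3
        rw [lineNode_pred _ _ h2]
        exact ⟨hp.mem.2 (by omega), (hdead _ (by omega)).2 (by omega)⟩
    · rintro (⟨h2, rfl⟩ | ⟨h2, rfl⟩)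
      · refine ⟨Or.inl ⟨rfl, by omega⟩, ?_⟩
        rintro ⟨-, h4⟩
        rw [← lineNode_succ, hdead _ (by omega)] at h4
        omega
      · refine ⟨Or.inr ⟨rfl, by omega⟩, ?_⟩
        rintro ⟨-, h4⟩
        rw [lineNode_pred _ _ (by omega), hdead _ (by omega)] at h4
        omega
  have hne : f.lab g ≠ f.lab (g + 3) := by
    intro h
    have h2 := congrArg f.dir h
    rw [f.dir_lab, f.dir_lab] at h2
    have : (3 : Dir) = 0 := by simpa using h2.symm
    exact absurd this (by decide)
  have hcard : P.silent (P.st S frame ω t (lineNode v g x)).nb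
      (P.heardAt S frame ω t (lineNode v g x)) = (Finset.univ.filter fun i =>
      (P.st S frame ω t (lineNode v g x)).nb i = true ∧
      ∀ j, (i, j) ∉ P.heardAt S frame ω t (lineNode v g x)).card := by
    unfold silent
    congr
  rw [hcard, hset, Finset.card_union_of_disjoint]
  · split_ifs <;> simp
  · split_ifs <;> simp [hne]

/-- The amoebots of a segment do not reject if and only if it has the admitted length. -/
theorem IsSegment.fail_iff (hS : IsAmoebotStructure S) {v : Node} {g : Dir} {l : ℕ} (hl : 1 ≤ l)
    (hp : IsSegment S v g l) (hat : P.At S frame ω t .check)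
    (hd : ∀ u ∈ S, (P.st S frame ω (t + 1) u).dead = false)
    (hf : ∀ u ∈ S, (P.st S frame ω (t + 1) u).fail = false) :
    (∀ u ∈ S, (P.st S frame ω (t + 3 + P.r₀) u).fail = false) ↔ l = P.seg.getD 0 := by
  have hdead := fun r hr x hx => IsSegment.dead_iff hl hp hat hd (r := r) hr (x := x) hx
  have hseg : ∀ u ∈ S, isSeg (gmask S u) := by
    intro u hu
    obtain ⟨x, hx, rfl⟩ := (hp u).1 hu
    exact (hp.isSeg hl hx).1
  have h0 : ∀ u ∈ S, ∀ r ≤ P.r₀, (P.st S frame ω (t + 1 + r) u).fail = false := by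
    intro u hu r
    induction r with
    | zero => exact fun _ => hf u hu
    | succ r ih =>
      intro hr
      have h1 := hat.hop (r := r) (by omega)
      rw [← add_assoc, h1.fail_succ (by simp) hu, ih (by omega)]
      have hne : (⟨r, by omega⟩ : Fin (P.r₀ + 1)) ≠ Fin.last P.r₀ := by
        simp [Fin.ext_iff]; omega
      simp [detects, h1.pc hu, hne]
  have h1 := hat.hop le_rfl
  -- nobody is removed in the last step
  have hdead2 : ∀ x ≤ l, (P.st S frame ω (t + 2 + P.r₀) (lineNode v g x)).dead = true ↔
      x < P.r₀ ∨ l < x + P.r₀ := by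
    intro x hx
    have hm := hp.mem.2 hx
    rw [show t + 2 + P.r₀ = t + 1 + P.r₀ + 1 by ring, h1.dead_succ (by simp) hm,
      Bool.or_eq_true, hdead _ le_rfl _ hx]
    simp [reached, h1.pc hm, Fin.ext_iff]
  have hall : ∀ u ∈ S, (P.heardAt S frame ω (t + 2 + P.r₀) u).Nonempty ↔
      ∃ x ≤ l, ¬ (x < P.r₀ ∨ l < x + P.r₀) := by
    intro u hu
    rw [hat.hopAll.nonempty_iff_of_global hS (by simp) hu]
    constructor
    · rintro ⟨w, hw, hs⟩
      obtain ⟨x, hx, rfl⟩ := (hp w).1 hw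
      refine ⟨x, hx, ?_⟩
      rw [← hdead2 x hx]
      simpa [shouts, hat.hopAll.pc hw] using hs
    · rintro ⟨x, hx, hs⟩
      refine ⟨_, hp.mem.2 hx, ?_⟩
      rw [← hdead2 x hx] at hs
      simpa [shouts, hat.hopAll.pc (hp.mem.2 hx)] using hs
  have hfail : ∀ x ≤ l, (P.st S frame ω (t + 3 + P.r₀) (lineNode v g x)).fail = false ↔
      (¬ (x < P.r₀ ∨ l < x + P.r₀) →
        (if x + 1 + P.r₀ ≤ l then 1 else 0) + (if P.r₀ + 1 ≤ x then 1 else 0) =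
          P.seg.getD 0 % 2) ∧ ∃ x ≤ l, ¬ (x < P.r₀ ∨ l < x + P.r₀) := by
    intro x hx
    have hm := hp.mem.2 hx
    rw [show t + 3 + P.r₀ = t + 2 + P.r₀ + 1 by ring, hat.hopAll.fail_succ (by simp) hm,
      show t + 2 + P.r₀ = t + 1 + P.r₀ + 1 by ring, h1.fail_succ (by simp) hm, h0 _ hm _ le_rfl,
      show t + 1 + P.r₀ + 1 = t + 2 + P.r₀ by ring, Bool.false_or, Bool.or_eq_false_iff,
      decide_eq_false_iff_not, decide_eq_false_iff_not]
    refine and_congr ?_ ?_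
    · unfold detects
      rw [h1.pc hm]
      simp only [h1.isSeg_iff hm, hseg _ hm, Fin.last, true_and, not_and, ne_eq, not_not]
      refine ⟨fun h ha => ?_, fun h ha => ?_⟩
      · rw [← h1.silent_eq hp hx (fun x hx => hdead _ le_rfl x hx) ha]
        refine h ?_
        by_contra h2
        exact ha ((hdead _ le_rfl x hx).1 (by simpa using h2))
      · have ha' : ¬ (x < P.r₀ ∨ l < x + P.r₀) := by
          rw [← hdead _ le_rfl x hx, ha]; simp
        rw [h1.silent_eq hp hx (fun x hx => hdead _ le_rfl x hx) ha']
        exact h ha'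
    · unfold detects
      rw [hat.hopAll.pc hm]
      simp only [hat.hopAll.isSeg_iff hm, hseg _ hm, true_and]
      rw [← hall _ hm, Set.nonempty_iff_ne_empty]
  have hr₀ : P.r₀ = P.seg.getD 0 / 2 := rfl
  constructor
  · intro h
    obtain ⟨-, x, hx, ha⟩ := (hfail 0 (by omega)).1 (h _ (hp.mem.2 (by omega)))
    have h2 := ((hfail x hx).1 (h _ (hp.mem.2 hx))).1 ha
    have h3 := ((hfail P.r₀ (by omega)).1 (h _ (hp.mem.2 (by omega)))).1 (by omega)
    by_cases h5 : 2 * P.r₀ + 2 ≤ l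
    · have h4 := ((hfail (P.r₀ + 1) (by omega)).1 (h _ (hp.mem.2 (by omega)))).1 (by omega)
      rw [if_pos (by omega)] at h3
      split_ifs at h2 h3 h4 <;> omega
    · split_ifs at h2 h3 <;> omega
  · intro h u hu
    obtain ⟨x, hx, rfl⟩ := (hp u).1 hu
    rw [hfail x hx]
    refine ⟨fun ha => ?_, P.r₀, by omega, by omega⟩
    split_ifs <;> omega

end Detector

/-! ### Binary arithmetic: a bit-serial multiplier in carry-save form -/

/-- The binary digit of weight `2 ^ s` of an integer, in two's complement. -/
def digit (z : ℤ) (s : ℕ) : Bool := decide (z / 2 ^ s % 2 = 1)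

theorem emod_two_pow_succ (z : ℤ) (s : ℕ) :
    z % 2 ^ (s + 1) = z % 2 ^ s + 2 ^ s * ((digit z s).toNat : ℤ) := by
  have h2 : (0 : ℤ) < 2 ^ s := by positivity
  have h1 : ((digit z s).toNat : ℤ) = z / 2 ^ s % 2 := by
    unfold digit
    rcases Int.emod_two_eq_zero_or_one (z / 2 ^ s) with h | h <;> simp [h]
  have e1 := Int.emod_add_mul_ediv z (2 ^ s)
  have e2 := Int.emod_add_mul_ediv (z / 2 ^ s) 2
  have b1 := Int.emod_nonneg z h2.ne'
  have b2 := Int.emod_lt_of_pos z h2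
  have b3 := Int.emod_nonneg (z / 2 ^ s) two_ne_zero
  have b4 := Int.emod_lt_of_pos (z / 2 ^ s) two_pos
  have e3 : z = z % 2 ^ s + 2 ^ s * (z / 2 ^ s % 2) + 2 ^ (s + 1) * (z / 2 ^ s / 2) := by
    rw [pow_succ]; linear_combination -e1 - 2 ^ s * e2
  rw [h1]
  conv_lhs => rw [e3]
  rw [Int.add_mul_emod_self_left, Int.emod_eq_of_lt]
  · positivity
  · rw [pow_succ]; nlinarith

theorem digit_congr {z z' : ℤ} {s : ℕ} (h : z ≡ z' [ZMOD 2 ^ (s + 1)]) : digit z s = digit z' s := by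
  have h0 : z ≡ z' [ZMOD 2 ^ s] := h.of_dvd (pow_dvd_pow _ (by omega))
  have h1 := emod_two_pow_succ z s
  have h2 := emod_two_pow_succ z' s
  rw [h, h0] at h1
  have h4 : (2 : ℤ) ^ s ≠ 0 := by positivity
  have h3 : ((digit z s).toNat : ℤ) = (digit z' s).toNat := by
    apply mul_left_cancel₀ h4; linarith
  cases h5 : digit z s <;> cases h6 : digit z' s <;> simp [h5, h6] at h3 ⊢

theorem digit_eq_false_of_lt {L i : ℕ} (h : L ≤ i) : digit (L : ℤ) i = false := by
  have h1 : (L : ℤ) < 2 ^ i := by exact_mod_cast h.trans_lt Nat.lt_two_pow_self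
  rw [digit, Int.ediv_eq_zero_of_lt (by omega) h1]; rfl

mutual
/-- The contents of the cells of the multiplier for the factors with the digits `x` and `y`, before
the digits of weight `2 ^ s` are read. Cell `i` holds digits of weight `2 ^ (s + i)`. -/
def accum (x y : ℕ → Bool) : ℕ → ℕ → ℕ
  | 0, _ => 0
  | s + 1, i => accumMid x y s i / 2 + accumMid x y s (i + 1) % 2
/-- The contents of the cells after the digits of weight `2 ^ s` have been read. -/
def accumMid (x y : ℕ → Bool) : ℕ → ℕ → ℕ
  | s, i => accum x y s i +
    if i ≤ s then (x i && y s).toNat + (!decide (i = s) && x s && y i).toNat else 0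
end

section

variable {x y : ℕ → Bool}

theorem accum_succ (s i : ℕ) : accum x y (s + 1) i =
    accumMid x y s i / 2 + accumMid x y s (i + 1) % 2 := by rw [accum]

theorem accumMid_eq (s i : ℕ) : accumMid x y s i = accum x y s i +
    if i ≤ s then (x i && y s).toNat + (!decide (i = s) && x s && y i).toNat else 0 := by
  rw [accumMid]

theorem accum_le (s i : ℕ) : accum x y s i ≤ 3 := by
  induction s generalizing i with
  | zero => simp [accum]
  | succ s ih =>
    have h1 := ih i
    have h2 := Bool.toNat_le (x i && y s)
    have h3 := Bool.toNat_le (!decide (i = s) && x s && y i)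
    rw [accum_succ, accumMid_eq s i]
    split_ifs <;> omega

theorem accumMid_lt (s i : ℕ) : accumMid x y s i < 8 := by
  have h1 := accum_le (x := x) (y := y) s i
  have h2 := Bool.toNat_le (x i && y s)
  have h3 := Bool.toNat_le (!decide (i = s) && x s && y i)
  rw [accumMid_eq s i]
  split_ifs <;> omega

theorem accum_eq_zero {s i : ℕ} (h : s ≤ i) : accum x y s i = 0 := by
  induction s generalizing i with
  | zero => rw [accum]
  | succ s ih =>
    rw [accum_succ, accumMid_eq, accumMid_eq, ih (by omega), ih (by omega), if_neg (by omega),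
      if_neg (by omega)]

theorem accumMid_eq_zero {L : ℕ} (hx : ∀ i ≥ L, x i = false) (s : ℕ) {i : ℕ} (h : L ≤ i) :
    accumMid x y s i = 0 := by
  have hs : ∀ s, (∀ i ≥ L, accum x y s i = 0) → ∀ i ≥ L, accumMid x y s i = 0 := by
    intro s hs i hi
    rw [accumMid_eq, hs i hi, hx i hi]
    split_ifs with h1
    · rw [hx s (by omega)]; simp
    · rfl
  refine hs s ?_ i h
  induction s with
  | zero => intro i _; rw [accum]
  | succ s ih => intro i hi; rw [accum_succ, hs s ih i hi, hs s ih (i + 1) (by omega)]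

/-- The digits that leave the multiplier, as a number. -/
def output (x y : ℕ → Bool) (s : ℕ) : ℕ := ∑ t ∈ Finset.range s, 2 ^ t * (accumMid x y t 0 % 2)

theorem sum_accum_succ (s : ℕ) : (accumMid x y s 0 % 2) +
    2 * ∑ i ∈ Finset.range (s + 1), 2 ^ i * accum x y (s + 1) i =
      ∑ i ∈ Finset.range (s + 1), 2 ^ i * accumMid x y s i := by
  have key : ∀ N, (accumMid x y s 0 % 2) +
    2 * ∑ i ∈ Finset.range N, 2 ^ i * accum x y (s + 1) i =
      ∑ i ∈ Finset.range N, 2 ^ i * accumMid x y s i + 2 ^ N * (accumMid x y s N % 2) := by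
    intro N
    induction N with
    | zero => simp
    | succ N ih =>
      rw [Finset.sum_range_succ, Finset.sum_range_succ, mul_add, ← add_assoc, ih, accum_succ]
      have h := Nat.div_add_mod (accumMid x y s N) 2
      set a := accumMid x y s N
      set b := accumMid x y s (N + 1)
      have : 2 ^ N * a = 2 ^ N * (2 * (a / 2) + a % 2) := by rw [h]
      rw [this]; ring
  have h0 : accumMid x y s (s + 1) = 0 := by
    rw [accumMid_eq, accum_eq_zero (by omega), if_neg (by omega)]
  rw [key, h0]; simp

end

/-- The multiplier is correct: what has left it and what it still contains make up the product of
the factors read so far. -/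
theorem output_add (a b : ℤ) (s : ℕ) : (output (digit a) (digit b) s : ℤ) +
    2 ^ s * ((∑ i ∈ Finset.range s, 2 ^ i * accum (digit a) (digit b) s i : ℕ) : ℤ) =
      (a % 2 ^ s) * (b % 2 ^ s) := by
  have hsum : ∀ (z : ℤ) s, z % 2 ^ s = ∑ i ∈ Finset.range s, (2 : ℤ) ^ i * ((digit z i).toNat : ℤ) := by
    intro z s
    induction s with
    | zero => simp
    | succ s ih => rw [emod_two_pow_succ, ih, Finset.sum_range_succ]
  induction s with
  | zero => simp [output]
  | succ s ih =>
    have h1 := sum_accum_succ (x := digit a) (y := digit b) s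
    set S1 := ∑ i ∈ Finset.range (s + 1), 2 ^ i * accum (digit a) (digit b) (s + 1) i with hS1
    -- reading the digits of weight `2 ^ s` adds the partial products that involve one of them; the
    -- product of both digits is contained in the first summand only
    have h2 : ((∑ i ∈ Finset.range (s + 1), 2 ^ i * accumMid (digit a) (digit b) s i : ℕ) : ℤ) =
        ((∑ i ∈ Finset.range s, 2 ^ i * accum (digit a) (digit b) s i : ℕ) : ℤ) +
        (a % 2 ^ (s + 1)) * ((digit b s).toNat : ℤ) + ((digit a s).toNat : ℤ) * (b % 2 ^ s) := by
      rw [Finset.sum_range_succ, accumMid_eq, if_pos le_rfl, accum_eq_zero le_rfl,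
        emod_two_pow_succ, hsum a s, hsum b s]
      have h3 : ∑ i ∈ Finset.range s, 2 ^ i * accumMid (digit a) (digit b) s i =
          ∑ i ∈ Finset.range s, (2 ^ i * accum (digit a) (digit b) s i +
          2 ^ i * (digit a i).toNat * (digit b s).toNat + (digit a s).toNat *
            (2 ^ i * (digit b i).toNat)) := by
        refine Finset.sum_congr rfl fun i hi => ?_
        rw [Finset.mem_range] at hi
        rw [accumMid_eq, if_pos hi.le, decide_eq_false hi.ne]
        cases digit a i <;> cases digit b i <;> cases digit a s <;> cases digit b s <;> simp <;> ring
      rw [h3, Finset.sum_add_distrib, Finset.sum_add_distrib, ← Finset.sum_mul, ← Finset.mul_sum]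
      cases digit a s <;> cases digit b s <;> simp <;> ring
    have h4 : ((output (digit a) (digit b) (s + 1) : ℕ) : ℤ) = output (digit a) (digit b) s +
        2 ^ s * ((accumMid (digit a) (digit b) s 0 % 2 : ℕ) : ℤ) := by
      rw [output, Finset.sum_range_succ]; push_cast [output]; rfl
    have h5 := congrArg (Nat.cast : ℕ → ℤ) h1
    rw [Nat.cast_add, Nat.cast_mul] at h5
    rw [h4, emod_two_pow_succ b]
    have h6 := emod_two_pow_succ a s
    rw [h2] at h5
    rw [pow_succ] at h5 h6 ⊢
    set p := (2 : ℤ) ^ s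
    set S0 := ((∑ i ∈ Finset.range s, 2 ^ i * accum (digit a) (digit b) s i : ℕ) : ℤ)
    push_cast at h5 ⊢
    linear_combination ih + p * h5 - (b % p) * h6

/-- The carry of the serial addition of `c` to the output of the multiplier. -/
def carry (c : ℤ) (x y : ℕ → Bool) (s : ℕ) : ℤ := (c + output x y s) / 2 ^ s

theorem carry_zero (c : ℤ) (x y : ℕ → Bool) : carry c x y 0 = c := by simp [carry, output]

theorem add_output_succ (c : ℤ) (x y : ℕ → Bool) (s : ℕ) :
    (c + output x y (s + 1)) / 2 ^ s = carry c x y s + (accumMid x y s 0 % 2 : ℕ) := by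
  have h4 : ((output x y (s + 1) : ℕ) : ℤ) = output x y s +
      2 ^ s * ((accumMid x y s 0 % 2 : ℕ) : ℤ) := by
    rw [output, Finset.sum_range_succ]; push_cast [output]; rfl
  rw [h4, ← add_assoc, Int.add_mul_ediv_left _ _ (by positivity)]; rfl

theorem carry_succ (c : ℤ) (x y : ℕ → Bool) (s : ℕ) :
    carry c x y (s + 1) = (carry c x y s + (accumMid x y s 0 % 2 : ℕ)) / 2 := by
  rw [← add_output_succ, Int.ediv_ediv_of_nonneg (by positivity), ← pow_succ]; rfl

theorem abs_carry_le {c : ℤ} {B : ℕ} (hc : |c| ≤ B) (x y : ℕ → Bool) (s : ℕ) :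
    |carry c x y s| ≤ B := by
  induction s with
  | zero => rwa [carry_zero]
  | succ s ih =>
    rw [carry_succ]
    rw [abs_le] at ih ⊢
    omega

/-- The digits of the sum. -/
theorem digit_add_mul (c a b : ℤ) (s : ℕ) : digit (c + a * b) s =
    decide ((carry c (digit a) (digit b) s + (accumMid (digit a) (digit b) s 0 % 2 : ℕ)) % 2 = 1) := by
  rw [← add_output_succ]
  change _ = digit (c + output (digit a) (digit b) (s + 1)) s
  apply digit_congr
  refine Int.ModEq.add_left _ ?_
  have h1 := output_add a b (s + 1)
  have h2 : (a % 2 ^ (s + 1)) * (b % 2 ^ (s + 1)) ≡ a * b [ZMOD 2 ^ (s + 1)] :=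
    (Int.mod_modEq _ _).mul (Int.mod_modEq _ _)
  refine h2.symm.trans ?_
  rw [← h1]
  rw [Int.ModEq, Int.add_mul_emod_self_left]

/-- One step of a serial test of `D * l = q`, with the carry `w`. -/
theorem two_pow_dvd_succ {D l q w : ℤ} {s : ℕ} (hw : 2 ^ s * w = D * (l % 2 ^ s) - q % 2 ^ s) :
    (2 ^ (s + 1) ∣ D * l - q ↔
      (w + D * (digit l s).toNat - (digit q s).toNat) % 2 = 0) ∧
    ((w + D * (digit l s).toNat - (digit q s).toNat) % 2 = 0 →
      2 ^ (s + 1) * ((w + D * (digit l s).toNat - (digit q s).toNat) / 2) =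
        D * (l % 2 ^ (s + 1)) - q % 2 ^ (s + 1)) := by
  set v := w + D * (digit l s).toNat - (digit q s).toNat with hv
  have h1 : 2 ^ s * v = D * (l % 2 ^ (s + 1)) - q % 2 ^ (s + 1) := by
    rw [emod_two_pow_succ, emod_two_pow_succ, hv]
    linear_combination hw
  have h2 : D * (l % 2 ^ (s + 1)) - q % 2 ^ (s + 1) ≡ D * l - q [ZMOD 2 ^ (s + 1)] :=
    ((Int.mod_modEq _ _).mul_left _).sub (Int.mod_modEq _ _)
  refine ⟨?_, fun h => ?_⟩
  · rw [Int.dvd_iff_emod_eq_zero, ← h2, ← h1, pow_succ, Int.mul_emod_mul_of_pos _ _ (by positivity),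
      mul_eq_zero]
    have : (2 : ℤ) ^ s ≠ 0 := by positivity
    simp [this]
  · rw [← h1, pow_succ, mul_assoc, Int.mul_ediv_cancel' (Int.dvd_of_emod_eq_zero h)]

theorem emod_le_succ (a b : ℤ) (s : ℕ) : a % 2 ^ (s + 1) ≤ b % 2 ^ (s + 1) ↔
    if digit a s = digit b s then a % 2 ^ s ≤ b % 2 ^ s else digit b s = true := by
  rw [emod_two_pow_succ, emod_two_pow_succ]
  have h2 : (0 : ℤ) < 2 ^ s := by positivity
  have ha := Int.emod_lt_of_pos a h2
  have hb := Int.emod_lt_of_pos b h2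
  have ha' := Int.emod_nonneg a h2.ne'
  have hb' := Int.emod_nonneg b h2.ne'
  cases digit a s <;> cases digit b s <;> simp <;> omega

/-- The parity of the number of multiples of `2 ^ s` among `1, …, x` is a binary digit of `x`. -/
theorem crossParity_dvd (s x : ℕ) :
    crossParity (fun z => decide (2 ^ s ∣ z)) x = digit x s := by
  induction x with
  | zero => simp [crossParity, digit]
  | succ x ih =>
    rw [crossParity, ih]
    unfold digit
    have h : ((x + 1 : ℕ) : ℤ) / 2 ^ s = (((x + 1) / 2 ^ s : ℕ) : ℤ) := by push_cast; rfl
    have h' : ((x : ℕ) : ℤ) / 2 ^ s = ((x / 2 ^ s : ℕ) : ℤ) := by push_cast; rfl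
    rw [h, h', Nat.succ_div]
    by_cases hd : 2 ^ s ∣ x + 1
    · simp only [hd, if_true, decide_true, Bool.xor_true]
      rw [← decide_not, decide_eq_decide]; omega
    · simp [hd]

theorem two_pow_succ_dvd_iff (s x : ℕ) :
    decide (2 ^ (s + 1) ∣ x) = (decide (2 ^ s ∣ x) && !digit x s) := by
  unfold digit
  have h' : ((x : ℕ) : ℤ) / 2 ^ s = ((x / 2 ^ s : ℕ) : ℤ) := by push_cast; rfl
  rw [h', ← decide_not, ← Bool.decide_and, decide_eq_decide]
  constructor
  · rintro ⟨k, rfl⟩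
    refine ⟨⟨2 * k, by ring⟩, ?_⟩
    rw [pow_succ, mul_assoc, Nat.mul_div_cancel_left _ (by positivity)]; omega
  · rintro ⟨⟨k, rfl⟩, h⟩
    rw [Nat.mul_div_cancel_left _ (by positivity)] at h
    obtain ⟨j, rfl⟩ : ∃ j, k = 2 * j := ⟨k / 2, by omega⟩
    exact ⟨j, by ring⟩

/-! ### One pass of the main loop on a side -/

namespace Detector

open AmoebotAlgorithm

variable {P : Detector} {S : Finset Node} {frame : Node → Frame}
  {ω : ℕ × Node → Fin (2 * (P.m + 1))} {t : ℕ}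

/-- The sides are directed towards their acute corners. -/
structure Directed (P : Detector) (S : Finset Node) (frame : Node → Frame)
    (ω : ℕ × Node → Fin (2 * (P.m + 1))) (t : ℕ) : Prop where
  side : ∀ u ∈ S, ∀ g, (P.gport S frame ω t u g).pred = true → GSide S u g
  pred : ∀ v g L, IsLine S v g L → ∀ x < L,
    (P.gport S frame ω t (lineNode v g x) g).pred = false ∧
    (P.gport S frame ω t (lineNode v g (x + 1)) (g + 3)).pred = true

theorem Oriented.directed (h : Oriented P S frame ω t) (hc : ∀ u ∈ S, isConvex (gmask S u)) :
    Directed P S frame ω t := ⟨h.side, h.pred hc⟩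

theorem stepPort_pred {c : PC P.d P.r₀} (hc : c ≠ .orient) (coin sd : Bool) (x : Signals)
    (r : Port P.d P.B) : (P.stepPort c coin sd x r).pred = r.pred := by
  cases c <;> first | exact absurd rfl hc | rfl | skip
  all_goals
    simp only [stepPort]
    split_ifs <;> rfl

theorem Directed.succ {c : PC P.d P.r₀} (h : Directed P S frame ω t) (hat : P.At S frame ω t c)
    (hd : ∀ b, c ≠ .done b) (hc : c ≠ .orient) : Directed P S frame ω (t + 1) := by
  have hp : ∀ u ∈ S, ∀ g, (P.gport S frame ω (t + 1) u g).pred = (P.gport S frame ω t u g).pred := by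
    intro u hu g
    rw [hat.port_succ hd hu, stepPort_pred hc]
  refine ⟨fun u hu g => ?_, fun v g L hl x hx => ?_⟩
  · rw [hp u hu]; exact h.side u hu g
  · rw [hp _ (hl.side x hx).mem, hp _ (hl.toIsRun.side_back hx).mem]; exact h.pred v g L hl x hx

section line

variable {v : Node} {g : Dir} {L : ℕ}

/-- What the port towards the acute corner receives. -/
theorem At.exists_signals {c : PC P.d P.r₀} (hat : P.At S frame ω t c) (hq : Quiet P c)
    (hrun : IsRun S v g L) {x : ℕ} (hx : x < L) :
    ∃ coin sd, ∃ sg : Signals, P.gport S frame ω (t + 1) (lineNode v g (x + 1)) (g + 3) =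
        P.stepPort c coin sd sg (P.gport S frame ω t (lineNode v g (x + 1)) (g + 3)) ∧
      (sg.outer = true ↔ P.Sig S frame ω t (lineNode v g x) g false) ∧
      (sg.inner = true ↔ P.Sig S frame ω t (lineNode v g x) g true) ∧
      (sg.back = true ↔ P.Sig S frame ω t (lineNode v g (x + 1)) g false) ∧
      (sg.other = true ↔ ∃ g', g' ≠ g + 3 ∧
        (P.gport S frame ω t (lineNode v g (x + 1)) g').pred = true ∧
        (P.gport S frame ω t (lineNode v g (x + 1)) g').bit = true) := by
  have hm := (hrun.side_back hx).mem
  have hd : ∀ b, c ≠ .done b := by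
    rcases hq with rfl | rfl | rfl | rfl | rfl | rfl | ⟨j, rfl⟩ | ⟨j, rfl⟩ | rfl <;> simp
  obtain ⟨h1, h2, h3, h4⟩ := hat.signals_eq hq hm (g + 3)
  refine ⟨_, _, _, hat.port_succ hd hm _, ?_, ?_, ?_, h4⟩
  · rw [h1, lineNode_succ, sig_opposite (hrun.side x hx)]
  · rw [h2, lineNode_succ, sig_opposite (hrun.side x hx)]
  · rw [h3, add_three_add_three]

/-- The multiples of `2 ^ s` exchange the tracks, and so the arriving track tells the digit of weight
`2 ^ s` of the distance to the acute corner. -/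
theorem At.port_parity (hat : P.At S frame ω t .parity) (hdir : Directed P S frame ω t)
    (hc : ∀ u ∈ S, isConvex (gmask S u)) (hl : IsLine S v g L) {s : ℕ}
    (hact : ∀ x < L, (P.gport S frame ω t (lineNode v g (x + 1)) (g + 3)).act =
      decide (2 ^ s ∣ x + 1)) {x : ℕ} (hx : x < L) :
    P.gport S frame ω (t + 1) (lineNode v g (x + 1)) (g + 3) =
      { P.gport S frame ω t (lineNode v g (x + 1)) (g + 3) with
        bit := digit ((x + 1 : ℕ) : ℤ) s
        act := decide (2 ^ (s + 1) ∣ x + 1) } := by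
  obtain ⟨coin, sd, sg, h, -, hi, -, -⟩ := hat.exists_signals (by simp [Quiet]) hl.toIsRun hx
  rw [h]
  simp only [stepPort, (hdir.pred v g L hl x hx).2, if_true]
  have hcr : ∀ z < L, crossParity (fun z => P.cross (P.st S frame ω t (lineNode v g z))
      ((frame (lineNode v g z)).lab g)) z = digit (z : ℤ) s := by
    intro z hz
    rw [← crossParity_dvd]
    refine crossParity_congr fun y h1 h2 => ?_
    obtain ⟨y, rfl⟩ := Nat.exists_eq_succ_of_ne_zero (by omega : y ≠ 0)
    have hm := (hl.toIsRun.side_back (by omega : y < L)).mem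
    have h3 := (hdir.pred v g L hl (y + 1) (by omega)).1
    have h4 := (hdir.pred v g L hl y (by omega)).2
    have h5 := hact y (by omega)
    unfold cross
    rw [hat.pc hm]
    rw [gport] at h3 h4 h5
    rw [Frame.lab_add_three] at h4 h5
    simp only [Nat.succ_eq_add_one, h3, h4, h5]
    simp
  have hin : sg.inner = digit (x : ℤ) s := by
    apply bool_eq_iff
    rw [hi, hat.sig_iff_of_lined (by simp [Lined]) hl.toIsRun hx]
    constructor
    · rintro ⟨y, hy, b', h1, h2⟩
      rw [hcr x hx, hcr y hy] at h2
      have hy0 : y = 0 ∧ b' = false := by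
        rcases h1 with h1 | h1
        · have hm := hl.toIsRun.mem hy.le
          simp only [sends, hat.pc hm, hat.isArc_iff hm (r := 2) (by simp)] at h1
          exact ⟨(hl.arc_two_iff hc hy.le).1 h1.1, h1.2⟩
        · have hm := hl.toIsRun.mem (show y + 1 ≤ L by omega)
          simp only [sends, hat.pc hm, hat.isArc_iff hm (r := 2) (by simp)] at h1
          exact absurd ((hl.arc_two_iff hc (by omega)).1 h1.1) (by omega)
      obtain ⟨rfl, rfl⟩ := hy0
      have : digit ((0 : ℕ) : ℤ) s = false := digit_eq_false_of_lt (Nat.zero_le _)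
      rw [this] at h2
      revert h2
      cases digit (x : ℤ) s <;> simp
    · intro h1
      have hm := hl.toIsRun.mem (Nat.zero_le L)
      refine ⟨0, hl.pos, false, Or.inl ?_, ?_⟩
      · simp only [sends, hat.pc hm, hat.isArc_iff hm (r := 2) (by simp)]
        exact ⟨(hl.arc_two_iff hc (Nat.zero_le _)).2 rfl, trivial⟩
      · rw [hcr x hx, hcr 0 hl.pos, h1, digit_eq_false_of_lt (Nat.zero_le _)]; rfl
  -- the signal is received before the node itself exchanges the tracks
  have hbit : (sg.inner ^^ (P.gport S frame ω t (lineNode v g (x + 1)) (g + 3)).act) =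
      digit ((x + 1 : ℕ) : ℤ) s := by
    rw [hin, hact x hx, ← crossParity_dvd, ← crossParity_dvd]; rfl
  rw [hbit, two_pow_succ_dvd_iff, hact x hx]

/-- The node at the end of the side broadcasts its digit. -/
theorem At.port_length (hat : P.At S frame ω t .length) (hdir : Directed P S frame ω t)
    (hc : ∀ u ∈ S, isConvex (gmask S u)) (hl : IsLine S v g L) {b : Bool}
    (hbit : (P.gport S frame ω t (lineNode v g L) (g + 3)).bit = b) {x : ℕ} (hx : x < L) :
    P.gport S frame ω (t + 1) (lineNode v g (x + 1)) (g + 3) =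
      { P.gport S frame ω t (lineNode v g (x + 1)) (g + 3) with len := b } := by
  obtain ⟨coin, sd, sg, h, ho, -, -, -⟩ := hat.exists_signals (by simp [Quiet]) hl.toIsRun hx
  rw [h]
  simp only [stepPort, (hdir.pred v g L hl x hx).2, if_true]
  have hout : sg.outer = b := by
    apply bool_eq_iff
    rw [ho, hat.sig_iff_of_straight (by simp [Lined]) (by simp) hl.toIsRun hx, ← hbit]
    constructor
    · rintro ⟨y, hy, h1 | h1⟩
      · have hm := hl.toIsRun.mem hy.le
        simp only [sends, hat.pc hm, hat.isArc_iff hm (r := 3) (by simp)] at h1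
        exact absurd ((hl.arc_three_iff hc hy.le).1 h1.1) (by omega)
      · have hm := hl.toIsRun.mem (show y + 1 ≤ L by omega)
        simp only [sends, hat.pc hm, hat.isArc_iff hm (r := 3) (by simp)] at h1
        have := (hl.arc_three_iff hc (show y + 1 ≤ L by omega)).1 h1.1
        rw [← this]; exact h1.2.2.1
    · intro h1
      obtain ⟨y, rfl⟩ := Nat.exists_eq_succ_of_ne_zero (Nat.one_le_iff_ne_zero.1 hl.pos)
      have hm := hl.toIsRun.mem le_rfl
      refine ⟨y, Nat.lt_succ_self y, Or.inr ?_⟩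
      simp only [sends, hat.pc hm, hat.isArc_iff hm (r := 3) (by simp)]
      exact ⟨hl.obtuse, (hdir.pred v g _ hl y (Nat.lt_succ_self y)).2, h1, trivial⟩
  rw [hout]

/-- In each pass one more cell is captured, and it stores the current digit of the length. -/
theorem At.port_token (hat : P.At S frame ω t .token) (hdir : Directed P S frame ω t)
    (hc : ∀ u ∈ S, isConvex (gmask S u)) (hl : IsLine S v g L) {s : ℕ}
    (hcap : ∀ x < L, (P.gport S frame ω t (lineNode v g (x + 1)) (g + 3)).cap =
      decide (x < s)) {x : ℕ} (hx : x < L) :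
    P.gport S frame ω (t + 1) (lineNode v g (x + 1)) (g + 3) =
      { P.gport S frame ω t (lineNode v g (x + 1)) (g + 3) with
        cap := decide (x ≤ s)
        fresh := decide (x = s)
        first := decide (x = 0)
        xd := if x = s then (P.gport S frame ω t (lineNode v g (x + 1)) (g + 3)).len else
          (P.gport S frame ω t (lineNode v g (x + 1)) (g + 3)).xd } := by
  obtain ⟨coin, sd, sg, h, ho, hi, -, -⟩ := hat.exists_signals (by simp [Quiet]) hl.toIsRun hx
  rw [h]
  simp only [stepPort, (hdir.pred v g L hl x hx).2, if_true]
  have hsig : ∀ b, P.Sig S frame ω t (lineNode v g x) g b ↔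
      x = 0 ∨ (x ≤ s ∧ b = false) := by
    intro b
    rw [hat.sig_iff_of_local (by simp) (hl.side x hx)]
    have hm := hl.toIsRun.mem hx.le
    have hm' := hl.toIsRun.mem (show x + 1 ≤ L by omega)
    rw [← lineNode_succ]
    have h1 : ¬ P.sends (P.st S frame ω t (lineNode v g (x + 1)))
        ((frame (lineNode v g (x + 1))).lab (g + 3)) b := by
      simp only [sends, hat.pc hm', hat.isArc_iff hm' (r := 2) (by simp)]
      rintro (h1 | h1)
      · exact absurd ((hl.arc_two_iff hc (by omega)).1 h1) (by omega)
      · have := (hdir.pred v g L hl x hx).2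
        rw [gport, h1.1] at this
        exact absurd this (by simp)
    simp only [h1, or_false]
    simp only [sends, hat.pc hm, hat.isArc_iff hm (r := 2) (by simp), hl.arc_two_iff hc hx.le]
    by_cases hx0 : x = 0
    · simp [hx0]
    obtain ⟨y, rfl⟩ := Nat.exists_eq_succ_of_ne_zero hx0
    have h2 := (hdir.pred v g L hl (y + 1) hx).1
    have h3 := hcap y (by omega)
    rw [gport] at h2 h3
    rw [Frame.lab_add_three] at h3
    simp only [Nat.succ_eq_add_one, h2, h3]
    simp
  have hout : sg.outer = decide (x ≤ s) := by
    apply bool_eq_iff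
    rw [ho, hsig, decide_eq_true_eq]; simp; omega
  have hin : sg.inner = decide (x = 0) := by
    apply bool_eq_iff
    rw [hi, hsig, decide_eq_true_eq]; simp
  have h1 : (decide (x < s) || decide (x ≤ s)) = decide (x ≤ s) := by
    rw [← Bool.decide_or, decide_eq_decide]; omega
  have h2 : (!decide (x < s) && decide (x ≤ s)) = decide (x = s) := by
    rw [← decide_not, ← Bool.decide_and, decide_eq_decide]; omega
  simp only [hout, hin, hcap x hx, h1, h2, decide_eq_true_eq]

/-- The signal that the node next to the acute corner sends along the side. -/
theorem At.sig_first {c : PC P.d P.r₀} (hat : P.At S frame ω t c)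
    (hcc : (∃ j, c = .mul j) ∨ c = .compare) (hdir : Directed P S frame ω t)
    (hl : IsLine S v g L)
    (hfirst : ∀ x < L, (P.gport S frame ω t (lineNode v g (x + 1)) (g + 3)).first =
      decide (x = 0)) {x : ℕ} (hx : x < L) :
    P.Sig S frame ω t (lineNode v g x) g false ↔
      (P.gport S frame ω t (lineNode v g 1) (g + 3)).y = true := by
  have hlin : Lined P c := by rcases hcc with ⟨j, rfl⟩ | rfl <;> simp [Lined]
  have hsend : ∀ u ∈ S, ∀ d, P.sends (P.st S frame ω t u) ((frame u).lab d) false ↔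
      (P.gport S frame ω t u d).pred = true ∧ (P.gport S frame ω t u d).first = true ∧
        (P.gport S frame ω t u d).y = true := by
    intro u hu d
    unfold sends
    rcases hcc with ⟨j, rfl⟩ | rfl <;> simp [hat.pc hu, gport]
  rw [hat.sig_iff_of_straight hlin (by rcases hcc with ⟨j, rfl⟩ | rfl <;> simp) hl.toIsRun hx]
  constructor
  · rintro ⟨y, hy, h1 | h1⟩
    · rw [hsend _ (hl.toIsRun.mem hy.le), (hdir.pred v g L hl y hy).1] at h1
      exact absurd h1.1 (by simp)
    · rw [hsend _ (hl.toIsRun.mem (by omega)), hfirst y hy, decide_eq_true_eq] at h1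
      obtain ⟨-, rfl, h2⟩ := h1
      exact h2
  · intro h1
    refine ⟨0, hl.pos, Or.inr ?_⟩
    rw [hsend _ (hl.toIsRun.mem (show 0 + 1 ≤ L from hl.pos)), hfirst 0 hl.pos]
    exact ⟨(hdir.pred v g L hl 0 hl.pos).2, by simp, h1⟩

/-- The digit `b` of the factor `y` is sent to all cells of a multiplier. -/
theorem At.port_mul {j : Fin (P.d + 1)} (hat : P.At S frame ω t (.mul j))
    (hdir : Directed P S frame ω t) (hl : IsLine S v g L)
    (hfirst : ∀ x < L, (P.gport S frame ω t (lineNode v g (x + 1)) (g + 3)).first =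
      decide (x = 0)) {x : ℕ} (hx : x < L) {r : Port P.d P.B}
    (hr : P.gport S frame ω t (lineNode v g (x + 1)) (g + 3) = r) {b : Bool}
    (hb : (P.gport S frame ω t (lineNode v g 1) (g + 3)).y = b) :
    P.gport S frame ω (t + 1) (lineNode v g (x + 1)) (g + 3) = { r with
      yd := Function.update r.yd j (if r.fresh then b else r.yd j)
      acc := Function.update r.acc j (Fin.ofNat 8 ((r.acc j).val +
        if r.cap then (r.xd && b).toNat + (!r.fresh && r.len && r.yd j).toNat else 0)) } := by
  obtain ⟨coin, sd, sg, h, ho, -, -, -⟩ := hat.exists_signals (by simp [Quiet]) hl.toIsRun hx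
  have hp := (hdir.pred v g L hl x hx).2
  rw [h]
  rw [hr] at hp ⊢
  simp only [stepPort, hp, if_true]
  have hout : sg.outer = b := by
    apply bool_eq_iff
    rw [ho, hat.sig_first (by simp) hdir hl hfirst hx, hb]
  rw [hout]

/-- The contents of the cells are halved; cell `x` receives the least significant bit of cell
`x + 1`. -/
theorem At.port_shift {j : Fin (P.d + 1)} (hat : P.At S frame ω t (.shift j))
    (hdir : Directed P S frame ω t) (hl : IsLine S v g L) {x : ℕ} (hx : x < L) {r : Port P.d P.B}
    (hr : P.gport S frame ω t (lineNode v g (x + 1)) (g + 3) = r) {b : ℕ}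
    (hb : b = if x + 1 < L ∧ (P.gport S frame ω t (lineNode v g (x + 2)) (g + 3)).cap = true then
      ((P.gport S frame ω t (lineNode v g (x + 2)) (g + 3)).acc j).val % 2 else 0) :
    P.gport S frame ω (t + 1) (lineNode v g (x + 1)) (g + 3) = { r with
      acc := Function.update r.acc j (Fin.ofNat 8 ((r.acc j).val / 2 + b))
      y := decide (((r.u j : ℤ) + ((r.acc j).val % 2 : ℕ)) % 2 = 1)
      u := Function.update r.u j (clamp P.B (((r.u j : ℤ) + ((r.acc j).val % 2 : ℕ)) / 2)) } := by
  obtain ⟨coin, sd, sg, h, -, -, ho, -⟩ := hat.exists_signals (by simp [Quiet]) hl.toIsRun hx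
  have hp := (hdir.pred v g L hl x hx).2
  rw [h]
  rw [hr] at hp ⊢
  simp only [stepPort, hp, if_true]
  have hback : sg.back.toNat = b := by
    have hiff : sg.back = true ↔ b = 1 := by
      rw [ho, hb]
      by_cases hx1 : x + 1 < L
      · rw [hat.sig_iff_of_local (by simp) (hl.side _ hx1), ← lineNode_succ]
        have hm := hl.toIsRun.mem hx1.le
        have hm' := hl.toIsRun.mem (show x + 1 + 1 ≤ L by omega)
        have h2 := (hdir.pred v g L hl (x + 1) hx1).1
        have h3 := (hdir.pred v g L hl (x + 1) hx1).2
        rw [gport] at h2 h3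
        simp only [sends, hat.pc hm, hat.pc hm', h2, h3, hx1, true_and]
        simp only [gport]
        by_cases hcap : ((P.st S frame ω t (lineNode v g (x + 2))).port
            ((frame (lineNode v g (x + 2))).lab (g + 3))).cap = true <;> simp [hcap]
      · simp only [hx1, false_and, if_false]
        have : x + 1 = L := by omega
        simp [Sig, this, hl.not_after]
    have h2 : b ≤ 1 := by rw [hb]; split_ifs <;> omega
    cases hs : sg.back <;> simp [hs] at hiff ⊢ <;> omega
  rw [hback]

/-- The digit `b` of the value of the polynomial arrives at the obtuse corner, where the digit `o` of
the other side is known. -/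
theorem At.port_compare (hat : P.At S frame ω t .compare) (hdir : Directed P S frame ω t)
    (hl : IsLine S v g L)
    (hfirst : ∀ x < L, (P.gport S frame ω t (lineNode v g (x + 1)) (g + 3)).first =
      decide (x = 0)) {x : ℕ} (hx : x < L) {r : Port P.d P.B}
    (hr : P.gport S frame ω t (lineNode v g (x + 1)) (g + 3) = r) {b o : Bool}
    (hb : (P.gport S frame ω t (lineNode v g 1) (g + 3)).y = b)
    (ho : o = true ↔ ∃ g', g' ≠ g + 3 ∧
      (P.gport S frame ω t (lineNode v g (x + 1)) g').pred = true ∧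
      (P.gport S frame ω t (lineNode v g (x + 1)) g').bit = true) :
    P.gport S frame ω (t + 1) (lineNode v g (x + 1)) (g + 3) = { r with
      y := false
      mism := r.mism || decide (((r.w : ℤ) + P.D * o.toNat - b.toNat) % 2 = 1)
      w := clamp P.B (((r.w : ℤ) + P.D * o.toNat - b.toNat) / 2)
      le := if r.bit = o then r.le else o } := by
  obtain ⟨coin, sd, sg, h, hou, -, -, hot⟩ := hat.exists_signals (by simp [Quiet]) hl.toIsRun hx
  have hp := (hdir.pred v g L hl x hx).2
  rw [h]
  rw [hr] at hp ⊢
  simp only [stepPort, hp, if_true]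
  have hout : sg.outer = b := by
    apply bool_eq_iff
    rw [hou, hat.sig_first (by simp) hdir hl hfirst hx, hb]
  have hoth : sg.other = o := by
    apply bool_eq_iff
    rw [hot, ho]
  rw [hout, hoth]

end line

end Detector

/-! ### The contents of the cells of a side -/

namespace Detector

open AmoebotAlgorithm

/-- The partial results of the evaluation at `L` of the polynomial of the detector by Horner's
method. -/
def horner (P : Detector) (L : ℤ) : ℕ → ℤ
  | 0 => 0
  | j + 1 => (if h : j < P.d + 1 then P.coef ⟨j, h⟩ else 0) + L * horner P L j

/-- The value at `L` of the polynomial of the detector. -/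
def value (P : Detector) (L : ℤ) : ℤ := P.horner L (P.d + 1)

theorem horner_succ (P : Detector) (L : ℤ) (j : Fin (P.d + 1)) :
    P.horner L (j + 1) = P.coef j + L * P.horner L j := by
  rw [horner, dif_pos j.2]

/-- The state of the test whether a side of length `L` has the right length `l` of the other side,
after `s` passes. -/
structure Judged (P : Detector) (l L : ℕ) (s : ℕ) (r : Port P.d P.B) : Prop where
  mism : r.mism = false ↔ 2 ^ s ∣ P.D * (l : ℤ) - P.value L
  w : r.mism = false → 2 ^ s * (r.w : ℤ) = P.D * ((l : ℤ) % 2 ^ s) - P.value L % 2 ^ s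
  le : r.le = true ↔ (L : ℤ) % 2 ^ s ≤ (l : ℤ) % 2 ^ s

/-- The multipliers and adders, when in the current pass the first `j` of them have been served. -/
structure Served (P : Detector) (L : ℕ) (s j x : ℕ) (r : Port P.d P.B) : Prop where
  yd : ∀ i : Fin (P.d + 1), x < (if i.val < j then s + 1 else s) →
    r.yd i = digit (P.horner L i) x
  acc : ∀ i : Fin (P.d + 1), (r.acc i).val =
    accum (digit L) (digit (P.horner L i)) (if i.val < j then s + 1 else s) x
  u : x = 0 → ∀ i : Fin (P.d + 1), (r.u i : ℤ) =
    carry (P.coef i) (digit L) (digit (P.horner L i)) (if i.val < j then s + 1 else s)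

/-- The memory of the `x`-th cell of a side of length `L`, at the beginning of pass `s`. The other
side has length `l`. -/
structure Start (P : Detector) (l L : ℕ) (s x : ℕ) (r : Port P.d P.B) : Prop where
  served : Served P L s 0 x r
  judged : x + 1 = L → Judged P l L s r
  act : r.act = decide (2 ^ s ∣ x + 1)
  cap : r.cap = decide (x < s)
  xd : x < s → r.xd = digit L x
  y : x = 0 → r.y = false

/-- The memory of the `x`-th cell of a side of length `L` in pass `s`, before multiplier `j` is
served. -/
structure Middle (P : Detector) (l L : ℕ) (s j x : ℕ) (r : Port P.d P.B) : Prop where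
  served : Served P L s j x r
  judged : x + 1 = L → Judged P l L s r
  act : r.act = decide (2 ^ (s + 1) ∣ x + 1)
  bit : r.bit = digit ((x + 1 : ℕ) : ℤ) s
  cap : r.cap = decide (x ≤ s)
  fresh : r.fresh = decide (x = s)
  first : r.first = decide (x = 0)
  len : r.len = digit L s
  xd : x ≤ s → r.xd = digit L x
  y : x = 0 → r.y = digit (P.horner L j) s

theorem start_initPort (P : Detector) (l L x : ℕ) (o : Option Bool) (p : Bool) :
    Start P l L 0 x { P.initPort with own := o, pred := p } := by
  refine ⟨⟨fun i h => ?_, fun i => ?_, fun h i => ?_⟩, fun _ => ⟨?_, fun _ => ?_, ?_⟩, ?_, ?_, ?_, ?_⟩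
  · simp at h
  · simp [accum, initPort]
  · simp only [not_lt_zero, if_false, carry_zero]
    exact clamp_coe (P.coef_le i)
  · simp [initPort]
  · simp only [initPort]
    rw [clamp_coe (by simp)]; simp
  · simp [initPort]
  · simp [initPort]
  · simp [initPort]
  · simp
  · simp [initPort]

variable {P : Detector} {S : Finset Node} {frame : Node → Frame}
  {ω : ℕ × Node → Fin (2 * (P.m + 1))} {t : ℕ}

section pc

theorem At.length (h : P.At S frame ω t .parity) : P.At S frame ω (t + 1) .length :=
  h.next_of_forall (by simp) fun _ => rfl

theorem At.token (h : P.At S frame ω t .parity) : P.At S frame ω (t + 2) .token :=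
  h.length.next_of_forall (by simp) fun _ => rfl

theorem At.mul (h : P.At S frame ω t .parity) (j : Fin (P.d + 1)) :
    P.At S frame ω (t + 3 + 2 * j) (.mul j) := by
  obtain ⟨j, hj⟩ := j
  induction j with
  | zero => exact h.token.next_of_forall (by simp) fun _ => rfl
  | succ j ih =>
    have h1 := (ih (by omega)).next_of_forall (c' := .shift ⟨j, by omega⟩) (by simp) fun _ => rfl
    refine h1.next_of_forall (by simp) fun _ => ?_
    simp only [PC.next]
    rw [dif_pos (by omega)]

theorem At.shift (h : P.At S frame ω t .parity) (j : Fin (P.d + 1)) :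
    P.At S frame ω (t + 3 + 2 * j + 1) (.shift j) :=
  (h.mul j).next_of_forall (by simp) fun _ => rfl

theorem At.compare (h : P.At S frame ω t .parity) :
    P.At S frame ω (t + 3 + 2 * (P.d + 1)) .compare := by
  refine (h.shift (Fin.last _)).next_of_forall (by simp) fun _ => ?_
  simp [PC.next]

theorem At.clock (h : P.At S frame ω t .parity) :
    P.At S frame ω (t + 3 + 2 * (P.d + 1) + 1) .clock :=
  h.compare.next_of_forall (by simp) fun _ => rfl

theorem Directed.mul (h : Directed P S frame ω t) (hat : P.At S frame ω t .parity) {j : ℕ}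
    (hj : j ≤ P.d + 1) : Directed P S frame ω (t + 3 + 2 * j) := by
  induction j with
  | zero =>
    have h1 := h.succ hat (by simp) (by simp)
    have h2 := h1.succ hat.length (by simp) (by simp)
    exact h2.succ hat.token (by simp) (by simp)
  | succ j ih =>
    have h1 := (ih (by omega)).succ (hat.mul ⟨j, by omega⟩) (by simp) (by simp)
    exact h1.succ (hat.shift ⟨j, by omega⟩) (by simp) (by simp)

end pc

section line

variable {v : Node} {g : Dir} {l L s : ℕ}

theorem Start.middle (hat : P.At S frame ω t .parity) (hdir : Directed P S frame ω t)
    (hc : ∀ u ∈ S, isConvex (gmask S u)) (hl : IsLine S v g L)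
    (h : ∀ x < L, Start P l L s x (P.gport S frame ω t (lineNode v g (x + 1)) (g + 3))) :
    ∀ x < L, Middle P l L s 0 x (P.gport S frame ω (t + 3) (lineNode v g (x + 1)) (g + 3)) := by
  intro x hx
  have hd1 := hdir.succ hat (by simp) (by simp)
  have hd2 := hd1.succ hat.length (by simp) (by simp)
  have e1 := fun x (hx : x < L) => hat.port_parity hdir hc hl (fun x hx => (h x hx).act) hx
  have e2 : ∀ x < L, _ := fun x (hx : x < L) => hat.length.port_length hd1 hc hl
    (b := digit (L : ℤ) s) (by
      obtain ⟨L, rfl⟩ := Nat.exists_eq_succ_of_ne_zero (Nat.one_le_iff_ne_zero.1 hl.pos)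
      rw [Nat.succ_eq_add_one, e1 L (Nat.lt_succ_self L)]) hx
  have e3 := hat.token.port_token hd2 hc hl (s := s) (fun x hx => by
    rw [e2 x hx, e1 x hx]; exact (h x hx).cap) hx
  rw [show t + 3 = t + 2 + 1 from rfl, e3, show t + 2 = t + 1 + 1 from rfl, e2 x hx, e1 x hx]
  have h0 := h x hx
  refine ⟨⟨h0.served.yd, h0.served.acc, h0.served.u⟩, fun hL => ?_, rfl, rfl, rfl, rfl, rfl, rfl, ?_, ?_⟩
  · exact ⟨(h0.judged hL).mism, (h0.judged hL).w, (h0.judged hL).le⟩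
  · intro hxs
    simp only
    split_ifs with h1
    · rw [h1]
    · exact h0.xd (by omega)
  · intro h1
    simp only [h0.y h1, horner]
    rw [digit]; simp

/-- The multiplier `j` and its adder produce the next digit of the Horner value `j + 1`. -/
theorem Middle.succ (hat : P.At S frame ω t .parity) (hdir : Directed P S frame ω t)
    (hl : IsLine S v g L) {j : Fin (P.d + 1)}
    (h : ∀ x < L, Middle P l L s j x
      (P.gport S frame ω (t + 3 + 2 * j) (lineNode v g (x + 1)) (g + 3))) :
    ∀ x < L, Middle P l L s (j + 1) x
      (P.gport S frame ω (t + 3 + 2 * (j + 1)) (lineNode v g (x + 1)) (g + 3)) := by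
  have hd1 := hdir.mul hat (j := j) (by omega)
  have hd2 := hd1.succ (hat.mul j) (by simp) (by simp)
  set F := fun x => P.gport S frame ω (t + 3 + 2 * j) (lineNode v g (x + 1)) (g + 3) with hF
  have e1 := fun x (hx : x < L) => (hat.mul j).port_mul hd1 hl (fun x hx => (h x hx).first) hx
    (r := F x) rfl ((h 0 hl.pos).y rfl)
  have hacc : ∀ x < L, ((Fin.ofNat 8 (((F x).acc j).val + if (F x).cap then
      ((F x).xd && digit (P.horner L j) s).toNat + (!(F x).fresh && (F x).len && (F x).yd j).toNat
        else 0) : Fin 8)).val = accumMid (digit L) (digit (P.horner L j)) s x := by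
    intro x hx
    have h0 := h x hx
    have hlt := accumMid_lt (x := digit L) (y := digit (P.horner L j)) s x
    rw [accumMid_eq] at hlt ⊢
    have h1 := h0.served.acc j
    rw [if_neg (lt_irrefl _)] at h1
    have h2 : (if (F x).cap = true then ((F x).xd && digit (P.horner L j) s).toNat +
        (!(F x).fresh && (F x).len && (F x).yd j).toNat else 0) =
        if x ≤ s then (digit L x && digit (P.horner L j) s).toNat +
          (!decide (x = s) && digit L s && digit (P.horner L j) x).toNat else 0 := by
      simp only [hF, h0.cap, h0.fresh, h0.len, decide_eq_true_eq]
      split_ifs with hxs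
      · rw [h0.xd hxs]
        by_cases hxe : x = s
        · simp [hxe]
        · rw [h0.served.yd j (by rw [if_neg (lt_irrefl _)]; omega)]
      · rfl
    rw [h2, show (((F x).acc j).val) = _ from h1]
    exact Nat.mod_eq_of_lt hlt
  intro x hx
  -- beyond the end of the side and beyond the captured cells, the multiplier is empty
  have hb : (if x + 1 < L ∧ x + 1 ≤ s then accumMid (digit L) (digit (P.horner L j)) s (x + 1) % 2
      else 0) = accumMid (digit L) (digit (P.horner L j)) s (x + 1) % 2 := by
    split_ifs with h1
    · rfl
    · rcases not_and_or.1 h1 with h1 | h1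
      · rw [accumMid_eq_zero (fun i hi => digit_eq_false_of_lt hi) s (by omega : L ≤ x + 1)]
      · rw [accumMid_eq, if_neg h1, accum_eq_zero (by omega)]
  have e2 := (hat.shift j).port_shift hd2 hl hx (e1 x hx) (b := _) rfl
  have hback : (if x + 1 < L ∧ (P.gport S frame ω (t + 3 + 2 * j + 1) (lineNode v g (x + 2))
      (g + 3)).cap = true then ((P.gport S frame ω (t + 3 + 2 * j + 1) (lineNode v g (x + 2))
      (g + 3)).acc j).val % 2 else 0) = accumMid (digit L) (digit (P.horner L j)) s (x + 1) % 2 := by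
    rw [← hb]
    by_cases hx1 : x + 1 < L
    · rw [e1 (x + 1) hx1]
      simp only [hx1, true_and, Function.update_self]
      rw [hacc (x + 1) hx1]
      simp only [hF, (h (x + 1) hx1).cap, decide_eq_true_eq]
    · simp [hx1]
  rw [hback] at e2
  rw [show t + 3 + 2 * (j.val + 1) = t + 3 + 2 * j + 1 + 1 by ring, e2]
  have h0 := h x hx
  have hneg : ∀ {α : Type} (a b : α), (if j.val < j.val then a else b) = b :=
    fun a b => if_neg (lt_irrefl _)
  have hsucc : ∀ i : Fin (P.d + 1), i ≠ j → (i.val < j.val + 1 ↔ i.val < j.val) := by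
    intro i hi
    have := Fin.val_ne_of_ne hi
    omega
  have hsum : x = 0 → ((F x).u j : ℤ) + (((Function.update (F x).acc j (Fin.ofNat 8
      (((F x).acc j).val + if (F x).cap then ((F x).xd && digit (P.horner L j) s).toNat +
      (!(F x).fresh && (F x).len && (F x).yd j).toNat else 0))) j).val % 2 : ℕ) =
      carry (P.coef j) (digit L) (digit (P.horner L j)) s +
      (accumMid (digit L) (digit (P.horner L j)) s 0 % 2 : ℕ) := by
    intro hx0
    rw [Function.update_self, hacc x hx, hx0]
    have := (h 0 hl.pos).served.u rfl j
    rw [hneg] at this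
    rw [show ((F 0).u j : ℤ) = _ from this]
  refine ⟨⟨fun i hi => ?_, fun i => ?_, fun hx0 i => ?_⟩, fun hL => ?_, h0.act, h0.bit, h0.cap,
    h0.fresh, h0.first, h0.len, h0.xd, fun hx0 => ?_⟩
  · simp only
    rcases eq_or_ne i j with rfl | hij
    · rw [Function.update_self]
      simp only [hF, h0.fresh, decide_eq_true_eq]
      split_ifs with h1
      · rw [h1]
      · rw [if_pos (by omega)] at hi
        exact h0.served.yd i (by rw [hneg]; omega)
    · rw [Function.update_of_ne hij]
      rw [if_congr (hsucc i hij) rfl rfl] at hi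
      exact h0.served.yd i hi
  · simp only
    rcases eq_or_ne i j with rfl | hij
    · rw [Function.update_self, Function.update_self, hacc x hx, if_pos (by omega), accum_succ]
      have := accumMid_lt (x := digit L) (y := digit (P.horner L i)) s x
      exact Nat.mod_eq_of_lt (by omega)
    · rw [Function.update_of_ne hij, Function.update_of_ne hij, if_congr (hsucc i hij) rfl rfl]
      exact h0.served.acc i
  · simp only
    rcases eq_or_ne i j with rfl | hij
    · rw [Function.update_self, hsum hx0, if_pos (by omega), ← carry_succ]
      exact clamp_coe (abs_carry_le (P.coef_le i) _ _ _)
    · rw [Function.update_of_ne hij, if_congr (hsucc i hij) rfl rfl]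
      exact h0.served.u hx0 i
  · exact ⟨(h0.judged hL).mism, (h0.judged hL).w, (h0.judged hL).le⟩
  · simp only
    rw [hsum hx0, horner_succ, digit_add_mul]

theorem Start.middle_last (hat : P.At S frame ω t .parity) (hdir : Directed P S frame ω t)
    (hc : ∀ u ∈ S, isConvex (gmask S u)) (hl : IsLine S v g L)
    (h : ∀ x < L, Start P l L s x (P.gport S frame ω t (lineNode v g (x + 1)) (g + 3))) :
    ∀ x < L, Middle P l L s (P.d + 1) x
      (P.gport S frame ω (t + 3 + 2 * (P.d + 1)) (lineNode v g (x + 1)) (g + 3)) := by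
  have key : ∀ j ≤ P.d + 1, ∀ x < L, Middle P l L s j x
      (P.gport S frame ω (t + 3 + 2 * j) (lineNode v g (x + 1)) (g + 3)) := by
    intro j
    induction j with
    | zero => exact fun _ => Start.middle hat hdir hc hl h
    | succ j ih =>
      exact fun hj => Middle.succ hat hdir hl (j := ⟨j, by omega⟩) (ih (by omega))
  exact key _ le_rfl

end line

/-- The sides of lengths `L₁` and `L₂`, starting at acute corners, meet at their obtuse ends, and no
other side edge is incident there. -/
structure IsCorner (S : Finset Node) (v₁ : Node) (g₁ : Dir) (L₁ : ℕ) (v₂ : Node) (g₂ : Dir)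
    (L₂ : ℕ) : Prop where
  line₁ : IsLine S v₁ g₁ L₁
  line₂ : IsLine S v₂ g₂ L₂
  end_eq : lineNode v₁ g₁ L₁ = lineNode v₂ g₂ L₂
  ne : g₁ ≠ g₂
  side : ∀ d, GSide S (lineNode v₁ g₁ L₁) d → d = g₁ + 3 ∨ d = g₂ + 3

theorem IsCorner.swap {v₁ v₂ : Node} {g₁ g₂ : Dir} {L₁ L₂ : ℕ} (h : IsCorner S v₁ g₁ L₁ v₂ g₂ L₂) :
    IsCorner S v₂ g₂ L₂ v₁ g₁ L₁ :=
  ⟨h.line₂, h.line₁, h.end_eq.symm, h.ne.symm, fun d hd => (h.side d (h.end_eq ▸ hd)).symm⟩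

theorem abs_compare_le {B D : ℕ} (hB : 1 ≤ B) (hD : D ≤ B) {w : ℤ} (hw : |w| ≤ B) (o b : Bool) :
    |(w + D * o.toNat - b.toNat) / 2| ≤ B := by
  have h1 := Bool.toNat_le o
  have h2 := Bool.toNat_le b
  have h3 : (D : ℤ) * o.toNat ≤ B := by
    cases o <;> simp; omega
  have h4 : 0 ≤ (D : ℤ) * o.toNat := by positivity
  rw [abs_le] at hw ⊢
  omega

/-- One pass of the main loop on a side. -/
theorem Start.succ (hat : P.At S frame ω t .parity) (hdir : Directed P S frame ω t)
    (hc : ∀ u ∈ S, isConvex (gmask S u)) {v₁ v₂ : Node} {g₁ g₂ : Dir} {L₁ L₂ s : ℕ}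
    (hcor : IsCorner S v₁ g₁ L₁ v₂ g₂ L₂)
    (h₁ : ∀ x < L₁, Start P L₂ L₁ s x (P.gport S frame ω t (lineNode v₁ g₁ (x + 1)) (g₁ + 3)))
    (h₂ : ∀ x < L₂, Start P L₁ L₂ s x (P.gport S frame ω t (lineNode v₂ g₂ (x + 1)) (g₂ + 3))) :
    ∀ x < L₁, Start P L₂ L₁ (s + 1) x (P.gport S frame ω (t + 3 + 2 * (P.d + 1) + 2)
      (lineNode v₁ g₁ (x + 1)) (g₁ + 3)) := by
  have hl := hcor.line₁
  have m₁ := Start.middle_last hat hdir hc hl h₁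
  have m₂ := Start.middle_last hat hdir hc hcor.line₂ h₂
  have hd := hdir.mul hat le_rfl
  intro x hx
  have hm := (hl.toIsRun.side_back hx).mem
  have hcl : P.gport S frame ω (t + 3 + 2 * (P.d + 1) + 2) (lineNode v₁ g₁ (x + 1)) (g₁ + 3) =
      P.gport S frame ω (t + 3 + 2 * (P.d + 1) + 1) (lineNode v₁ g₁ (x + 1)) (g₁ + 3) :=
    hat.clock.port_succ (by simp) hm _
  classical
  set F := P.gport S frame ω (t + 3 + 2 * (P.d + 1)) (lineNode v₁ g₁ (x + 1)) (g₁ + 3) with hF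
  have e := hat.compare.port_compare hd hl (fun x hx => (m₁ x hx).first) hx (r := F) rfl
    ((m₁ 0 hl.pos).y rfl) (decide_eq_true_iff (p := ∃ g', g' ≠ g₁ + 3 ∧
      (P.gport S frame ω (t + 3 + 2 * (P.d + 1)) (lineNode v₁ g₁ (x + 1)) g').pred = true ∧
      (P.gport S frame ω (t + 3 + 2 * (P.d + 1)) (lineNode v₁ g₁ (x + 1)) g').bit = true))
  rw [hcl, e]
  have h0 : Middle P L₂ L₁ s (P.d + 1) x F := m₁ x hx
  refine ⟨⟨fun i hi => ?_, fun i => ?_, fun hx0 i => ?_⟩, fun hL => ?_, h0.act, ?_, fun hs => ?_,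
    fun _ => rfl⟩
  · exact h0.served.yd i (by rw [if_pos i.2]; simpa using hi)
  · have := h0.served.acc i
    rw [if_pos i.2] at this
    simpa using this
  · have := h0.served.u hx0 i
    rw [if_pos i.2] at this
    simpa using this
  · -- at the corner, the digit of the other side is known
    have ho : ∀ inst, @decide (∃ g', g' ≠ g₁ + 3 ∧
      (P.gport S frame ω (t + 3 + 2 * (P.d + 1)) (lineNode v₁ g₁ (x + 1)) g').pred = true ∧
      (P.gport S frame ω (t + 3 + 2 * (P.d + 1)) (lineNode v₁ g₁ (x + 1)) g').bit = true) inst =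
        digit (L₂ : ℤ) s := by
      intro inst
      apply bool_eq_iff
      rw [decide_eq_true_eq]
      obtain ⟨y, rfl⟩ := Nat.exists_eq_succ_of_ne_zero (Nat.one_le_iff_ne_zero.1 hcor.line₂.pos)
      have he : lineNode v₁ g₁ (x + 1) = lineNode v₂ g₂ (y + 1) := by rw [hL, hcor.end_eq]
      have hb := (m₂ y (Nat.lt_succ_self y)).bit
      have hp := (hd.pred v₂ g₂ _ hcor.line₂ y (Nat.lt_succ_self y)).2
      constructor
      · rintro ⟨g', h1, h2, h3⟩
        have h4 := hd.side _ hm g' h2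
        rw [hL] at h4
        rcases hcor.side g' h4 with rfl | rfl
        · exact absurd rfl h1
        · rw [he, hb] at h3; exact h3
      · intro h1
        refine ⟨g₂ + 3, fun h => hcor.ne (add_right_cancel h).symm, by rw [he]; exact hp, ?_⟩
        rw [he, hb]; exact h1
    rw [ho]
    have hj : Judged P L₂ L₁ s F := h0.judged hL
    have hstep : F.mism = false → _ := fun h => two_pow_dvd_succ (hj.w h)
    have hv : digit (P.horner (L₁ : ℤ) (P.d + 1)) s = digit (P.value L₁) s := rfl
    have hmis : (F.mism || decide (((F.w : ℤ) + P.D * (digit (L₂ : ℤ) s).toNat -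
        (digit (P.value L₁) s).toNat) % 2 = 1)) = false ↔
        2 ^ (s + 1) ∣ P.D * (L₂ : ℤ) - P.value L₁ := by
      rw [Bool.or_eq_false_iff, decide_eq_false_iff_not]
      constructor
      · rintro ⟨h1, h2⟩
        rw [(hstep h1).1]
        omega
      · intro h1
        have h2 := hj.mism.2 ((pow_dvd_pow _ (Nat.le_succ s)).trans h1)
        refine ⟨h2, ?_⟩
        rw [(hstep h2).1] at h1
        omega
    refine ⟨hmis, fun h => ?_, ?_⟩
    · simp only [hv] at h ⊢
      rw [Bool.or_eq_false_iff, decide_eq_false_iff_not] at h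
      rw [clamp_coe (abs_compare_le P.one_le_B P.D_le (abs_le.2 F.w.2) _ _)]
      exact (hstep h.1).2 (by omega)
    · rw [emod_le_succ]
      have hbit : F.bit = digit (L₁ : ℤ) s := by rw [h0.bit, hL]
      simp only [hbit]
      split_ifs with h1
      · exact hj.le
      · rfl
  · simp only [h0.cap, Nat.lt_succ_iff]
  · exact h0.xd (by omega)

end Detector

/-! ### The main loop and the verdict -/

theorem isSeg_not_isConvex : ∀ N : Mask, isSeg N → ¬ isConvex N := by
  decide

theorem IsRun.lt_card {S : Finset Node} {v : Node} {g : Dir} {L : ℕ} (h : IsRun S v g L) :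
    L < S.card := by
  have h1 : ((Finset.range (L + 1)).image (lineNode v g)) ⊆ S := by
    intro u hu
    obtain ⟨x, hx, rfl⟩ := Finset.mem_image.1 hu
    exact h.mem (Nat.lt_succ_iff.1 (Finset.mem_range.1 hx))
  have h2 := Finset.card_le_card h1
  rwa [Finset.card_image_of_injective _ (lineNode_injective v g), Finset.card_range] at h2

namespace Detector

open AmoebotAlgorithm

variable {P : Detector} {S : Finset Node} {frame : Node → Frame}
  {ω : ℕ × Node → Fin (2 * (P.m + 1))} {t : ℕ}

/-- The number of rounds of a pass of the main loop. -/
def passLength (P : Detector) : ℕ := 3 + 2 * (P.d + 1) + 2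

theorem Directed.pass (h : Directed P S frame ω t) (hat : P.At S frame ω t .parity) :
    Directed P S frame ω (t + P.passLength) := by
  have h1 := (h.mul hat le_rfl).succ hat.compare (by simp) (by simp)
  have h2 := h1.succ hat.clock (by simp) (by simp)
  rwa [show t + P.passLength = t + 3 + 2 * (P.d + 1) + 1 + 1 by unfold passLength; ring]

theorem At.fail_pass (hat : P.At S frame ω t .parity) {u : Node} (hu : u ∈ S) :
    (P.st S frame ω (t + P.passLength) u).fail = (P.st S frame ω t u).fail := by
  have key : ∀ {t : ℕ} {c : PC P.d P.r₀}, P.At S frame ω t c → (∀ b, c ≠ .done b) →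
      (c ≠ .orient ∧ c ≠ .check ∧ (∀ r, c ≠ .hop r) ∧ c ≠ .hopAll) →
      (P.st S frame ω (t + 1) u).fail = (P.st S frame ω t u).fail := by
    intro t c hc hd hne
    rw [hc.fail_succ hd hu]
    have : ¬ P.detects (P.st S frame ω t u) (P.heardAt S frame ω t u) := by
      unfold detects
      rw [hc.pc hu]
      cases c <;> simp_all
    simp [this]
  have h1 : ∀ j ≤ P.d + 1, (P.st S frame ω (t + 3 + 2 * j) u).fail = (P.st S frame ω t u).fail := by
    intro j
    induction j with
    | zero =>
      intro _
      exact (key hat.token (by simp) (by simp)).trans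
        ((key hat.length (by simp) (by simp)).trans (key hat (by simp) (by simp)))
    | succ j ih =>
      intro hj
      exact (key (hat.shift ⟨j, by omega⟩) (by simp) (by simp)).trans
        ((key (hat.mul ⟨j, by omega⟩) (by simp) (by simp)).trans (ih (by omega)))
  rw [show t + P.passLength = t + 3 + 2 * (P.d + 1) + 1 + 1 by unfold passLength; ring]
  exact (key hat.clock (by simp) (by simp)).trans
    ((key hat.compare (by simp) (by simp)).trans (h1 _ le_rfl))

theorem ne_done_of_le {u : Node} {s : ℕ} (hs : s ≤ t)
    (h : ∀ b, (P.st S frame ω t u).pc ≠ .done b) : ∀ b, (P.st S frame ω s u).pc ≠ .done b := by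
  induction t, hs using Nat.le_induction with
  | base => exact h
  | succ t _ ih =>
    refine ih fun b hb => h b ?_
    rw [st_succ_of_done _ _ _ _ hb, hb]

theorem alive_iff {u : Node} (h : ∀ b, (P.st S frame ω t u).pc ≠ .done b) :
    (P.st S frame ω t u).alive = true ↔ ∀ s < t, (ω (s, u)).val ≠ 0 := by
  induction t with
  | zero => simp [st, run, alg, initSt]
  | succ t ih =>
    have h1 := ne_done_of_le (Nat.le_succ t) h
    rw [st_succ_of_ne_done _ _ _ _ h1]
    simp only [Bool.and_eq_true, ih h1, decide_eq_true_eq]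
    exact ⟨fun h s hs => (Nat.lt_succ_iff_lt_or_eq.1 hs).elim (h.1 s) (fun e => e ▸ h.2),
      fun h => ⟨fun s hs => h s (by omega), h t (by omega)⟩⟩

/-- The clock stops the main loop as soon as all amoebots have drawn the symbol `0`. -/
theorem At.exists_passes (hS : IsAmoebotStructure S) (hat : P.At S frame ω t .parity) {N₁ N₂ : ℕ}
    (hlo : ∃ u ∈ S, ∀ s < N₁, (ω (s, u)).val ≠ 0) (hhi : ∀ u ∈ S, ∃ s < N₂, (ω (s, u)).val = 0) :
    ∃ T, (∀ k < T, P.At S frame ω (t + P.passLength * k) .parity) ∧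
      P.At S frame ω (t + P.passLength * T) .final ∧ N₁ < t + P.passLength * T ∧
      t + P.passLength * T ≤ max t N₂ + P.passLength := by
  classical
  have hM : P.passLength = 3 + 2 * (P.d + 1) + 1 + 1 := rfl
  -- the first pass at whose end nobody is alive
  have hex : ∃ k, ∀ u ∈ S, ∃ s < t + P.passLength * k + 3 + 2 * (P.d + 1) + 1, (ω (s, u)).val = 0 := by
    refine ⟨N₂, fun u hu => ?_⟩
    obtain ⟨s, hs, h⟩ := hhi u hu
    have : N₂ ≤ P.passLength * N₂ := Nat.le_mul_of_pos_left _ (by omega)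
    exact ⟨s, by omega, h⟩
  set T := Nat.find hex with hT
  have hpass : ∀ k, P.At S frame ω (t + P.passLength * k) .parity →
      P.At S frame ω (t + P.passLength * (k + 1)) (if k < T then .parity else .final) ∨ T < k := by
    intro k hk
    by_cases hTk : T < k
    · exact Or.inr hTk
    left
    have h1 := hk.clock.next_of_global hS (by simp)
    rw [show t + P.passLength * (k + 1) = t + P.passLength * k + 3 + 2 * (P.d + 1) + 1 + 1 by
      rw [hM]; ring]
    have h2 : (∃ v ∈ S, P.shouts (P.st S frame ω (t + P.passLength * k + 3 + 2 * (P.d + 1) + 1) v)) ↔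
        k < T := by
      rw [Nat.lt_find_iff]
      have h3 : ∀ v ∈ S, P.shouts (P.st S frame ω (t + P.passLength * k + 3 + 2 * (P.d + 1) + 1) v) ↔
          ∀ s < t + P.passLength * k + 3 + 2 * (P.d + 1) + 1, (ω (s, v)).val ≠ 0 := by
        intro v hv
        have hpc := hk.clock.pc hv
        rw [← alive_iff (P := P) (S := S) (frame := frame) (by rw [hpc]; simp)]
        simp [shouts, hpc]
      constructor
      · rintro ⟨v, hv, h4⟩ k' hk' h5
        obtain ⟨s, hs, h6⟩ := h5 v hv
        have : P.passLength * k' ≤ P.passLength * k := Nat.mul_le_mul_left _ hk'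
        exact (h3 v hv).1 h4 s (by omega) h6
      · intro h4
        have h5 := h4 k le_rfl
        push Not at h5
        obtain ⟨v, hv, h5⟩ := h5
        exact ⟨v, hv, (h3 v hv).2 h5⟩
    by_cases hkT : k < T
    · rw [if_pos hkT]
      rw [decide_eq_true (h2.2 hkT)] at h1
      exact h1
    · rw [if_neg hkT]
      rw [decide_eq_false (fun h => hkT (h2.1 h))] at h1
      exact h1
  have hpar : ∀ k ≤ T, P.At S frame ω (t + P.passLength * k) .parity := by
    intro k
    induction k with
    | zero => exact fun _ => hat
    | succ k ih =>
      intro hk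
      rcases hpass k (ih (by omega)) with h | h
      · rwa [if_pos (by omega)] at h
      · omega
  refine ⟨T + 1, fun k hk => hpar k (by omega), ?_, ?_, ?_⟩
  · rcases hpass T (hpar T le_rfl) with h | h
    · rwa [if_neg (by omega)] at h
    · omega
  · obtain ⟨u, hu, h⟩ := hlo
    obtain ⟨s, hs, h0⟩ := Nat.find_spec hex u hu
    have h1 : ¬ s < N₁ := fun hs' => h s hs' h0
    rw [← hT] at hs
    rw [mul_add, mul_one]
    omega
  · rcases Nat.eq_zero_or_pos T with h0 | h0
    · rw [h0]; simp
    · obtain ⟨k, hk⟩ := Nat.exists_eq_succ_of_ne_zero h0.ne'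
      have h1 := Nat.find_min hex (m := k) (by omega)
      push Not at h1
      obtain ⟨u, hu, h1⟩ := h1
      obtain ⟨s, hs, h2⟩ := hhi u hu
      have h3 : ¬ s < t + P.passLength * k + 3 + 2 * (P.d + 1) + 1 := fun h => h1 s h h2
      rw [hk, Nat.succ_eq_add_one, mul_add, mul_add]
      omega

/-- The verdict of the amoebots. -/
theorem At.decidesIn (hS : IsAmoebotStructure S) (hat : P.At S frame ω t .final) :
    P.alg.DecidesIn S frame (∀ u ∈ S, ¬ P.rejects (P.st S frame ω t u)) ω (t + 1) := by
  classical
  obtain ⟨⟨u₀, hu₀⟩⟩ := hS.nonempty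
  constructor
  · intro s hs hterm
    apply hterm u₀ hu₀
    have h1 := ne_done_of_le (P := P) (S := S) (frame := frame) (ω := ω) (Nat.lt_succ_iff.1 hs)
      (u := u₀) (by rw [hat.pc hu₀]; simp)
    change P.verdict (P.st S frame ω s u₀) = none
    unfold verdict
    split
    · rename_i b hb; exact absurd hb (h1 b)
    · rfl
  · have h1 := hat.next_of_global hS (by simp)
    refine ⟨!decide (∃ v ∈ S, P.shouts (P.st S frame ω t v)), ?_, fun u hu => ?_⟩
    rotate_left
    · change P.verdict (P.st S frame ω (t + 1) u) = _
      unfold verdict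
      rw [h1.pc hu]
      rfl
    · have h2 : ∀ v ∈ S, P.shouts (P.st S frame ω t v) ↔ P.rejects (P.st S frame ω t v) := by
        intro v hv
        simp [shouts, hat.pc hv]
      rw [Bool.not_eq_true', decide_eq_false_iff_not]
      push Not
      exact forall₂_congr fun v hv => not_congr (h2 v hv)

/-- The sides of a corner after a number of passes. -/
theorem IsCorner.start {T : ℕ} (hat : ∀ k, k < T → P.At S frame ω (t + P.passLength * k) .parity)
    (ho : Oriented P S frame ω t) (hc : ∀ u ∈ S, isConvex (gmask S u)) {v₁ v₂ : Node}
    {g₁ g₂ : Dir} {L₁ L₂ : ℕ} (hcor : IsCorner S v₁ g₁ L₁ v₂ g₂ L₂) : ∀ k ≤ T,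
    Directed P S frame ω (t + P.passLength * k) ∧
    (∀ x < L₁, Start P L₂ L₁ k x
      (P.gport S frame ω (t + P.passLength * k) (lineNode v₁ g₁ (x + 1)) (g₁ + 3))) ∧
    (∀ x < L₂, Start P L₁ L₂ k x
      (P.gport S frame ω (t + P.passLength * k) (lineNode v₂ g₂ (x + 1)) (g₂ + 3))) := by
  intro k
  induction k with
  | zero =>
    intro _
    refine ⟨ho.directed hc, fun x hx => ?_, fun x hx => ?_⟩
    · obtain ⟨o, p, h⟩ := ho.port _ (hcor.line₁.toIsRun.side_back hx).mem (g₁ + 3)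
      rw [mul_zero, add_zero, h]; exact start_initPort ..
    · obtain ⟨o, p, h⟩ := ho.port _ (hcor.line₂.toIsRun.side_back hx).mem (g₂ + 3)
      rw [mul_zero, add_zero, h]; exact start_initPort ..
  | succ k ih =>
    intro hk
    obtain ⟨h1, h2, h3⟩ := ih (by omega)
    have ha := hat k (by omega)
    have he : t + P.passLength * (k + 1) = t + P.passLength * k + P.passLength := by ring
    have he' : t + P.passLength * (k + 1) = t + P.passLength * k + 3 + 2 * (P.d + 1) + 2 := by
      unfold passLength; ring
    refine ⟨he ▸ h1.pass ha, ?_, ?_⟩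
    · rw [he']; exact Start.succ ha h1 hc hcor h2 h3
    · rw [he']; exact Start.succ ha h1 hc hcor.swap h3 h2

theorem IsPara.exists_isCorner {v : Node} {g : Dir} {m n : ℕ} (h : IsPara S v g m n) (hm : 1 ≤ m)
    (hn : 1 ≤ n) {u : Node} (hu : u ∈ S) (h3 : isArc (gmask S u) 3) :
    ∃ v₁ g₁ v₂ g₂, lineNode v₁ g₁ m = u ∧ IsCorner S v₁ g₁ m v₂ g₂ n := by
  obtain ⟨v₁, g₁, v₂, g₂, h1, h2, h3, h4, h5, h6⟩ := h.obtuse hm hn hu h3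
  exact ⟨v₁, g₁, v₂, g₂, h3, h1, h2, h3.trans h4.symm, h5, h3 ▸ h6⟩

theorem eq_zero_of_two_pow_dvd {z : ℤ} {T : ℕ} (h : 2 ^ T ∣ z) (hz : |z| < 2 ^ T) : z = 0 :=
  Int.eq_zero_of_abs_lt_dvd h hz

/-- At an obtuse corner, the test is passed if and only if one side has the prescribed length. -/
theorem IsCorner.exists_port_iff {T : ℕ}
    (hat : ∀ k, k < T → P.At S frame ω (t + P.passLength * k) .parity)
    (ho : Oriented P S frame ω t) (hc : ∀ u ∈ S, isConvex (gmask S u)) {v₁ v₂ : Node}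
    {g₁ g₂ : Dir} {L₁ L₂ : ℕ} (hcor : IsCorner S v₁ g₁ L₁ v₂ g₂ L₂)
    (hT : ∀ h l : ℕ, h < S.card → l < S.card → |P.D * (l : ℤ) - P.value h| < 2 ^ T)
    (hT' : S.card < 2 ^ T) :
    (∃ g, (P.gport S frame ω (t + P.passLength * T) (lineNode v₁ g₁ L₁) g).pred = true ∧
      (P.gport S frame ω (t + P.passLength * T) (lineNode v₁ g₁ L₁) g).mism = false ∧
      (P.gport S frame ω (t + P.passLength * T) (lineNode v₁ g₁ L₁) g).le = true) ↔
    (L₁ ≤ L₂ ∧ P.D * (L₂ : ℤ) = P.value L₁) ∨ (L₂ ≤ L₁ ∧ P.D * (L₁ : ℤ) = P.value L₂) := by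
  obtain ⟨hd, h1, h2⟩ := IsCorner.start hat ho hc hcor T le_rfl
  have c₁ := hcor.line₁.toIsRun.lt_card
  have c₂ := hcor.line₂.toIsRun.lt_card
  have key : ∀ {l L : ℕ} {r : Port P.d P.B}, L < S.card → l < S.card → Judged P l L T r →
      ((r.mism = false ∧ r.le = true) ↔ L ≤ l ∧ P.D * (l : ℤ) = P.value L) := by
    intro l L r hL hl hj
    rw [hj.mism, hj.le]
    have e : ∀ z : ℕ, z < S.card → (z : ℤ) % 2 ^ T = z := fun z hz =>
      Int.emod_eq_of_lt (by omega) (by exact_mod_cast hz.trans hT')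
    rw [e _ hL, e _ hl, and_comm]
    refine and_congr (by omega) ⟨fun h => ?_, fun h => ?_⟩
    · exact sub_eq_zero.1 (eq_zero_of_two_pow_dvd h (hT L l hL hl))
    · rw [h, sub_self]; exact dvd_zero _
  obtain ⟨y₁, hy₁⟩ := Nat.exists_eq_succ_of_ne_zero (Nat.one_le_iff_ne_zero.1 hcor.line₁.pos)
  obtain ⟨y₂, hy₂⟩ := Nat.exists_eq_succ_of_ne_zero (Nat.one_le_iff_ne_zero.1 hcor.line₂.pos)
  have j₁ := (h1 y₁ (by omega)).judged (by omega)
  have j₂ := (h2 y₂ (by omega)).judged (by omega)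
  have p₁ := (hd.pred v₁ g₁ L₁ hcor.line₁ y₁ (by omega)).2
  have p₂ := (hd.pred v₂ g₂ L₂ hcor.line₂ y₂ (by omega)).2
  rw [← Nat.succ_eq_add_one, ← hy₁] at j₁ p₁
  rw [← Nat.succ_eq_add_one, ← hy₂, ← hcor.end_eq] at j₂ p₂
  constructor
  · rintro ⟨g, h3, h4⟩
    rcases hcor.side g (hd.side _ (hcor.line₁.toIsRun.mem le_rfl) g h3) with rfl | rfl
    · exact Or.inl ((key c₁ c₂ j₁).1 h4)
    · exact Or.inr ((key c₂ c₁ j₂).1 h4)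
  · rintro (h | h)
    · exact ⟨_, p₁, (key c₁ c₂ j₁).2 h⟩
    · exact ⟨_, p₂, (key c₂ c₁ j₂).2 h⟩

end Detector

/-! ### Correctness for favourable coin tosses -/

namespace Detector

open AmoebotAlgorithm

variable {P : Detector} {S : Finset Node} {frame : Node → Frame}
  {ω : ℕ × Node → Fin (2 * (P.m + 1))} {t : ℕ}

/-- What the detector has to know about the polynomial and about the admitted segment. -/
structure Represents (P : Detector) (degenerate : Prop) (p : Polynomial ℝ) : Prop where
  value : ∀ h l : ℕ, (l : ℝ) = p.eval (h : ℝ) ↔ P.D * (l : ℤ) = P.value h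
  seg : ∀ l : ℕ, 1 ≤ l → (P.seg = some l ↔ degenerate ∧ (l : ℝ) = p.eval 0)

theorem rejects_iff {c : PC P.d P.r₀} (hat : P.At S frame ω t c) {u : Node} (hu : u ∈ S) :
    P.rejects (P.st S frame ω t u) ↔ (P.st S frame ω t u).fail = true ∨
      ¬ (isConvex (gmask S u) ∨ (isSeg (gmask S u) ∧ P.seg.isSome = true)) ∨
      (isArc (gmask S u) 3 ∧ ¬ ∃ g, (P.gport S frame ω t u g).pred = true ∧
        (P.gport S frame ω t u g).mism = false ∧ (P.gport S frame ω t u g).le = true) := by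
  unfold rejects
  rw [hat.isConvex_iff hu, hat.isSeg_iff hu, hat.isArc_iff hu (r := 3) (by simp)]
  refine or_congr_right (or_congr_right (and_congr_right fun _ => not_congr ⟨?_, ?_⟩))
  · rintro ⟨i, h⟩
    exact ⟨(frame u).dir i, by simpa [gport] using h⟩
  · rintro ⟨g, h⟩
    exact ⟨_, h⟩

theorem IsSegment.one_le {v : Node} {g : Dir} {l : ℕ} (h : IsSegment S v g l) (hS : 2 ≤ S.card) :
    1 ≤ l := by
  by_contra h0
  have hl : l = 0 := by omega
  subst hl
  have : S ⊆ {v} := by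
    intro w hw
    obtain ⟨x, hx, rfl⟩ := (h w).1 hw
    rw [Nat.le_zero.1 hx, lineNode_zero]; simp
  have := Finset.card_le_card this
  simp at this
  omega

/-- The amoebots do not reject if and only if they form a parallelogram of the prescribed shape. -/
theorem forall_not_rejects_iff (hS : IsAmoebotStructure S) (hcard : 2 ≤ S.card) {degenerate : Prop}
    {p : Polynomial ℝ} (hP : Represents P degenerate p) {R T : ℕ}
    (hor : P.At S frame ω t .orient) (htoss : Tossing P S frame ω t R)
    (hown : ∀ u g, GSide S u g → (P.gport S frame ω t u g).own ≠ none)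
    (hpar : ∀ k, k < T → P.At S frame ω (t + 4 + P.r₀ + P.passLength * k) .parity)
    (hfin : P.At S frame ω (t + 4 + P.r₀ + P.passLength * T) .final)
    (hT : ∀ h l : ℕ, h < S.card → l < S.card → |P.D * (l : ℤ) - P.value h| < 2 ^ T)
    (hT' : S.card < 2 ^ T) :
    (∀ u ∈ S, ¬ P.rejects (P.st S frame ω (t + 4 + P.r₀ + P.passLength * T) u)) ↔
      FormsPolynomialParallelogram degenerate p S := by
  have hch : P.At S frame ω (t + 1) .check := hor.next_of_forall (by simp) fun _ => rfl
  have hdead : ∀ u ∈ S, (P.st S frame ω (t + 1 + 1) u).dead = false := by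
    intro u hu
    rw [hch.dead_succ (by simp) hu, hor.dead_succ (by simp) hu, htoss.dead u hu]
    simp [reached, hor.pc hu, hch.pc hu]
  have e : t + 1 + 3 + P.r₀ = t + 4 + P.r₀ := by ring
  have hori : Oriented P S frame ω (t + 4 + P.r₀) := e ▸ (htoss.oriented hor hown).loop hch
  have hfail : ∀ u ∈ S, (P.st S frame ω (t + 4 + P.r₀ + P.passLength * T) u).fail =
      (P.st S frame ω (t + 4 + P.r₀) u).fail := by
    intro u hu
    have key : ∀ k ≤ T, (P.st S frame ω (t + 4 + P.r₀ + P.passLength * k) u).fail =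
        (P.st S frame ω (t + 4 + P.r₀) u).fail := by
      intro k
      induction k with
      | zero => exact fun _ => rfl
      | succ k ih =>
        intro hk
        rw [mul_add, mul_one, ← add_assoc, (hpar k (by omega)).fail_pass hu, ih (by omega)]
    exact key T le_rfl
  have hfailS : ∀ {v : Node} {g : Dir} {l : ℕ}, IsSegment S v g l →
      ((∀ u ∈ S, (P.st S frame ω (t + 4 + P.r₀) u).fail = false) ↔ l = P.seg.getD 0) := by
    intro v g l h
    rw [← e]
    have hl := IsSegment.one_le h hcard
    exact IsSegment.fail_iff hS hl h hch hdead (IsSegment.fail_check htoss hor hl h)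
  have hnoseg : (∀ u ∈ S, isConvex (gmask S u)) → ∀ u ∈ S,
      (P.st S frame ω (t + 4 + P.r₀) u).fail = (P.st S frame ω (t + 2) u).fail := by
    intro hc u hu
    rw [← e]
    exact fail_hop_of_isConvex hch (fun u hu h => isSeg_not_isConvex _ h (hc u hu)) hu
  constructor
  · intro h
    have h' : ∀ u ∈ S, (P.st S frame ω (t + 4 + P.r₀ + P.passLength * T) u).fail = false ∧
        (isConvex (gmask S u) ∨ (isSeg (gmask S u) ∧ P.seg.isSome = true)) ∧
        (isArc (gmask S u) 3 → ∃ g,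
          (P.gport S frame ω (t + 4 + P.r₀ + P.passLength * T) u g).pred = true ∧
          (P.gport S frame ω (t + 4 + P.r₀ + P.passLength * T) u g).mism = false ∧
          (P.gport S frame ω (t + 4 + P.r₀ + P.passLength * T) u g).le = true) := by
      intro u hu
      have h0 := (rejects_iff hfin hu).not.1 (h u hu)
      exact ⟨by simpa using fun h1 => h0 (Or.inl h1), not_not.1 fun h1 => h0 (Or.inr (Or.inl h1)),
        fun h3 => not_not.1 fun h1 => h0 (Or.inr (Or.inr ⟨h3, h1⟩))⟩
    have hf : ∀ u ∈ S, (P.st S frame ω (t + 4 + P.r₀) u).fail = false := fun u hu => by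
      rw [← hfail u hu]; exact (h' u hu).1
    by_cases hseg : ∃ u ∈ S, isSeg (gmask S u)
    · obtain ⟨u, hu, hu'⟩ := hseg
      obtain ⟨v, g, l, hl, hp⟩ := exists_isSegment hS (fun u hu => (h' u hu).2.1.imp_right And.left)
        hu hu'
      have hsome := ((h' u hu).2.1.resolve_left (isSeg_not_isConvex _ hu')).2
      have hlen := (hfailS hp).1 hf
      obtain ⟨l', hl'⟩ := Option.isSome_iff_exists.1 hsome
      rw [hl', Option.getD_some] at hlen
      subst hlen
      obtain ⟨h1, h2⟩ := (hP.seg l hl).1 hl'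
      exact ⟨0, l, IsSegment.formsParallelogram hp, Or.inr h1, Nat.zero_le _, by simpa using h2⟩
    · push Not at hseg
      have hc : ∀ u ∈ S, isConvex (gmask S u) := fun u hu =>
        (h' u hu).2.1.resolve_right fun h => hseg u hu h.1
      have halt : Alternating S := hor.alternating hc fun u hu => by
        rw [← hnoseg hc u hu]; exact hf u hu
      obtain ⟨v, g, m, n, hm, hn, hp⟩ := exists_isPara hS hc halt
      have hl := (hp.isLine hm hn).1
      have hu := hl.toIsRun.mem le_rfl
      obtain ⟨v₁, g₁, v₂, g₂, h1, hcor⟩ := IsPara.exists_isCorner hp hm hn hu hl.obtuse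
      have h2 := (h' _ hu).2.2 hl.obtuse
      rw [← h1, hcor.exists_port_iff hpar hori hc hT hT'] at h2
      rcases h2 with ⟨h2, h3⟩ | ⟨h2, h3⟩
      · exact ⟨m, n, hp.formsParallelogram.1, Or.inl hm, h2, (hP.value _ _).2 h3⟩
      · exact ⟨n, m, hp.formsParallelogram.2, Or.inl hn, h2, (hP.value _ _).2 h3⟩
  · rintro ⟨h, l, hF, hdeg, hhl, hpl⟩
    suffices H : (∀ u ∈ S, (P.st S frame ω (t + 4 + P.r₀) u).fail = false) ∧
        (∀ u ∈ S, isConvex (gmask S u) ∨ (isSeg (gmask S u) ∧ P.seg.isSome = true)) ∧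
        (∀ u ∈ S, isArc (gmask S u) 3 → ∃ g,
          (P.gport S frame ω (t + 4 + P.r₀ + P.passLength * T) u g).pred = true ∧
          (P.gport S frame ω (t + 4 + P.r₀ + P.passLength * T) u g).mism = false ∧
          (P.gport S frame ω (t + 4 + P.r₀ + P.passLength * T) u g).le = true) by
      intro u hu
      rw [rejects_iff hfin hu, hfail u hu, H.1 u hu]
      rintro (h1 | h1 | h1)
      · exact absurd h1 (by simp)
      · exact h1 (H.2.1 u hu)
      · exact h1.2 (H.2.2 u hu h1.1)
    rcases Nat.eq_zero_or_pos h with rfl | hh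
    · obtain ⟨v, g, hp⟩ := hF.exists_isSegment
      have hl := IsSegment.one_le hp hcard
      have hseg : P.seg = some l :=
        (hP.seg l hl).2 ⟨hdeg.resolve_left (by omega), by simpa using hpl⟩
      refine ⟨(hfailS hp).2 (by rw [hseg]; rfl), fun u hu => ?_, fun u hu h3 => ?_⟩
      · obtain ⟨x, hx, rfl⟩ := (hp u).1 hu
        exact Or.inr ⟨(hp.isSeg hl hx).1, by rw [hseg]; rfl⟩
      · obtain ⟨x, hx, rfl⟩ := (hp u).1 hu
        exact absurd h3 (hp.isSeg hl hx).2.2.2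
    · have hval := (hP.value h l).1 hpl
      obtain ⟨v, g, m, n, hm, hn, hp, hmn⟩ : ∃ v g m n, 1 ≤ m ∧ 1 ≤ n ∧ IsPara S v g m n ∧
          ((m ≤ n ∧ P.D * (n : ℤ) = P.value m) ∨ (n ≤ m ∧ P.D * (m : ℤ) = P.value n)) := by
        obtain ⟨v, g, hp | hp⟩ := hF.exists_isPara
        · exact ⟨v, g, h, l, hh, hh.trans_le hhl, hp, Or.inl ⟨hhl, hval⟩⟩
        · exact ⟨v, g, l, h, hh.trans_le hhl, hh, hp, Or.inr ⟨hhl, hval⟩⟩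
      have hc := hp.isConvex hm hn
      refine ⟨fun u hu => ?_, fun u hu => Or.inl (hc u hu), fun u hu h3 => ?_⟩
      · rw [hnoseg hc u hu]
        exact htoss.fail_para hor hown hm hn hp u hu
      · obtain ⟨v₁, g₁, v₂, g₂, rfl, hcor⟩ := IsPara.exists_isCorner hp hm hn hu h3
        exact (hcor.exists_port_iff hpar hori hc hT hT').2 hmn

/-- For favourable coin tosses, the algorithm answers correctly, and within the prescribed bounds
for the number of rounds: the ends of every side edge draw different coins early, all amoebots draw
the symbol `0` before round `N₂`, but some amoebot does so only after many rounds. -/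
theorem exists_decidesIn (hS : IsAmoebotStructure S) (hcard : 2 ≤ S.card) {degenerate : Prop}
    {p : Polynomial ℝ} (hP : Represents P degenerate p) {R₁ N₁ N₂ : ℕ} (hR₁ : 1 ≤ R₁)
    (hdiff : ∀ u g, GSide S u g → ∃ s < R₁,
      ¬ ((ω (2 * s, u)).val % 2 = 1 ↔ (ω (2 * s, u + dirVec g)).val % 2 = 1))
    (hlo : ∃ u ∈ S, ∀ s < N₁, (ω (s, u)).val ≠ 0) (hhi : ∀ u ∈ S, ∃ s < N₂, (ω (s, u)).val = 0)
    (hN₁ : ∀ T, N₁ < 2 * R₁ + 5 + P.r₀ + P.passLength * T → S.card < 2 ^ T ∧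
      ∀ h l : ℕ, h < S.card → l < S.card → |P.D * (l : ℤ) - P.value h| < 2 ^ T) :
    ∃ t, N₁ ≤ t ∧ t ≤ 2 * R₁ + 6 + P.r₀ + P.passLength + N₂ ∧
      P.alg.DecidesIn S frame (FormsPolynomialParallelogram degenerate p S) ω t := by
  obtain ⟨R, hR, -, hor, htoss, hown⟩ := exists_orient (P := P) (frame := frame) hS hR₁ hdiff
  have hch : P.At S frame ω (1 + 2 * R + 1) .check := hor.next_of_forall (by simp) fun _ => rfl
  have hloop := hch.loop
  rw [show 1 + 2 * R + 1 + 3 + P.r₀ = 1 + 2 * R + 4 + P.r₀ by ring] at hloop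
  obtain ⟨T, hpar, hfin, h1, h2⟩ := hloop.exists_passes hS hlo hhi
  obtain ⟨hT', hT⟩ := hN₁ T (by omega)
  refine ⟨1 + 2 * R + 4 + P.r₀ + P.passLength * T + 1, ?_, ?_, ?_⟩
  rotate_left 2
  · rw [← forall_not_rejects_iff hS hcard hP hor htoss hown hpar hfin hT hT']
    exact hfin.decidesIn hS
  · omega
  · have := max_le_add_of_nonneg (Nat.zero_le (1 + 2 * R + 4 + P.r₀)) (Nat.zero_le N₂)
    omega

end Detector

/-! ### Replacing the real polynomial by an integral equation -/

open Polynomial in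
/-- Integer interpolation, up to a common denominator. -/
theorem exists_int_interpolation (s : Finset ℕ) (f : ℕ → ℕ) : ∃ (r : ℚ[X]) (D : ℕ) (q : ℤ[X]),
    0 < D ∧ r.degree < s.card ∧ (∀ a ∈ s, r.eval (a : ℚ) = f a) ∧
      q.map (Int.castRingHom ℚ) = (D : ℚ[X]) * r := by
  classical
  set r := Lagrange.interpolate s (fun a : ℕ => (a : ℚ)) (fun a => (f a : ℚ)) with hr
  have hinj : Set.InjOn (fun a : ℕ => (a : ℚ)) s := Nat.cast_injective.injOn
  obtain ⟨b, hbM, hb⟩ := IsLocalization.integerNormalization_spec (nonZeroDivisors ℤ) r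
  have hb0 : b ≠ 0 := nonZeroDivisors.ne_zero hbM
  obtain ⟨n, hn⟩ := Int.eq_ofNat_of_zero_le (sq_nonneg b)
  refine ⟨r, n, C b * IsLocalization.integerNormalization (nonZeroDivisors ℤ) r,
    ?_, Lagrange.degree_interpolate_lt _ hinj, fun a ha => ?_, ?_⟩
  · have := pow_ne_zero 2 hb0
    omega
  · exact Lagrange.eval_interpolate_at_node _ hinj ha
  · have h1 : (n : ℚ[X]) = C (b : ℚ) ^ 2 := by
      have h2 : (n : ℚ) = (b : ℚ) ^ 2 := by exact_mod_cast congrArg (Int.cast (R := ℚ)) hn.symm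
      rw [← C_pow, ← h2]; simp
    have h3 : (IsLocalization.integerNormalization (nonZeroDivisors ℤ) r).map (Int.castRingHom ℚ) =
        C (b : ℚ) * r := by
      have : algebraMap ℤ ℚ = Int.castRingHom ℚ := rfl
      rw [← this, hb, ← smul_eq_C_mul]
      ext n
      simp
    rw [Polynomial.map_mul, h3, h1, map_C]
    simp; ring

open Polynomial in
/-- On the natural numbers, an equation `l = p h` with real coefficients is equivalent to one with
integral coefficients: either `p` has infinitely many integral points and hence rational
coefficients, or there are finitely many solutions, which are interpolated by a polynomial that is
negative at the other natural numbers. -/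
theorem exists_int_equation (p : ℝ[X]) : ∃ (D : ℕ) (q : ℤ[X]), 0 < D ∧
    ∀ h l : ℕ, (l : ℝ) = p.eval (h : ℝ) ↔ D * (l : ℤ) = q.eval (h : ℤ) := by
  classical
  set A := {h : ℕ | ∃ l : ℕ, (l : ℝ) = p.eval (h : ℝ)} with hA
  choose! f hf using fun (h : ℕ) (hh : h ∈ A) => hh
  have hevalQ : ∀ (q : ℤ[X]) (r : ℚ[X]) (D : ℕ), q.map (Int.castRingHom ℚ) = (D : ℚ[X]) * r →
      ∀ h : ℕ, ((q.eval (h : ℤ) : ℤ) : ℚ) = D * r.eval (h : ℚ) := by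
    intro q r D hq h
    have := congrArg (Polynomial.eval (h : ℚ)) hq
    rw [eval_mul, eval_natCast] at this
    rw [← this]
    simp
  by_cases hfin : A.Finite
  · obtain ⟨r, D, q, hD, -, hr, hq⟩ := exists_int_interpolation hfin.toFinset f
    have hmem : ∀ h : ℕ, h ∈ A → q.eval (h : ℤ) = D * (f h : ℤ) := by
      intro h hh
      have h1 := hevalQ q r D hq h
      rw [hr h (hfin.mem_toFinset.2 hh)] at h1
      exact_mod_cast h1
    set W : ℤ[X] := ∏ a ∈ hfin.toFinset, (X - C (a : ℤ)) with hW
    -- off the zeros of `W`, the value of this polynomial is at most `q - q ^ 2 - 1 < 0`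
    refine ⟨D, q - W ^ 2 * (q ^ 2 + 1), hD, fun h l => ?_⟩
    have hWe : W.eval (h : ℤ) = ∏ a ∈ hfin.toFinset, ((h : ℤ) - a) := by
      rw [hW, eval_prod]; simp
    simp only [eval_sub, eval_mul, eval_pow, eval_add, eval_one]
    by_cases hh : h ∈ A
    · have h0 : W.eval (h : ℤ) = 0 := by
        rw [hWe]; exact Finset.prod_eq_zero (hfin.mem_toFinset.2 hh) (sub_self _)
      rw [h0, hmem h hh, ← hf h hh]
      simp [hD.ne']
    · constructor
      · intro h1; exact absurd ⟨l, h1⟩ hh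
      · intro h1
        exfalso
        have h0 : W.eval (h : ℤ) ≠ 0 := by
          rw [hWe, Finset.prod_ne_zero_iff]
          intro a ha h2
          have : h = a := by omega
          exact hh (this ▸ hfin.mem_toFinset.1 ha)
        have h3 : 1 ≤ (W.eval (h : ℤ)) ^ 2 := by
          have := sq_nonneg (W.eval (h : ℤ))
          have := pow_ne_zero 2 h0
          omega
        have h4 : 0 ≤ (D : ℤ) * l := by positivity
        nlinarith [sq_nonneg (q.eval (h : ℤ)), sq_nonneg (q.eval (h : ℤ) - 1),
          mul_le_mul_of_nonneg_right h3 (by positivity : 0 ≤ (q.eval (h : ℤ)) ^ 2 + 1)]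
  · obtain ⟨s, hsA, hs⟩ := (Set.not_finite.1 hfin : A.Infinite).exists_subset_card_eq (p.natDegree + 1)
    obtain ⟨r, D, q, hD, hdeg, hr, hq⟩ := exists_int_interpolation s f
    -- both polynomials have degree less than `p.natDegree + 1` and agree at that many points
    have hpr : p = r.map (algebraMap ℚ ℝ) := by
      have hinj : Set.InjOn (fun a : ℕ => (a : ℝ)) s :=
        Nat.cast_injective.injOn
      refine eq_of_degrees_lt_of_eval_index_eq s hinj ?_ ?_ ?_
      · rw [hs]
        exact (degree_le_natDegree).trans_lt (by exact_mod_cast Nat.lt_succ_self _)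
      · rw [degree_map]; exact hdeg
      · intro a ha
        rw [← hf a (hsA ha)]
        have := Polynomial.eval_map_apply (algebraMap ℚ ℝ) (p := r) (a : ℚ)
        rw [hr a ha] at this
        simpa using this.symm
    refine ⟨D, q, hD, fun h l => ?_⟩
    have h1 := hevalQ q r D hq h
    have h2 : p.eval (h : ℝ) = ((r.eval (h : ℚ) : ℚ) : ℝ) := by
      rw [hpr]
      have := Polynomial.eval_map_apply (algebraMap ℚ ℝ) (p := r) (h : ℚ)
      simpa using this
    rw [h2]
    have h3 : (D : ℚ) ≠ 0 := by positivity
    constructor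
    · intro h4
      have h5 : (l : ℚ) = r.eval (h : ℚ) := by exact_mod_cast h4
      rw [← h5] at h1
      exact_mod_cast h1.symm
    · intro h4
      have h5 : (D : ℚ) * l = D * r.eval (h : ℚ) := by rw [← h1]; exact_mod_cast h4
      exact_mod_cast mul_left_cancel₀ h3 h5

namespace Detector

open Polynomial in
theorem value_eq_eval {P : Detector} {q : ℤ[X]} (hd : P.d = q.natDegree)
    (hcoef : ∀ j : Fin (P.d + 1), P.coef j = q.coeff (P.d - j)) (L : ℤ) : P.value L = q.eval L := by
  have hco : ∀ k n, (divX^[k] q).coeff n = q.coeff (n + k) := by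
    intro k
    induction k with
    | zero => intro n; rfl
    | succ k ih => intro n; rw [Function.iterate_succ_apply', coeff_divX, ih]; congr 1; ring
  have key : ∀ j ≤ P.d + 1, P.horner L j = (divX^[P.d + 1 - j] q).eval L := by
    intro j
    induction j with
    | zero =>
      intro _
      have : divX^[P.d + 1 - 0] q = 0 := by
        ext n
        rw [hco, coeff_zero]
        exact coeff_eq_zero_of_natDegree_lt (by omega)
      rw [this, eval_zero, horner]
    | succ j ih =>
      intro hj
      rw [horner, dif_pos (by omega), ih (by omega), hcoef]
      have h1 : P.d + 1 - j = P.d - j + 1 := by omega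
      have h2 : P.d + 1 - (j + 1) = P.d - j := by omega
      rw [h1, h2, Function.iterate_succ_apply']
      conv_rhs => rw [← divX_mul_X_add (divX^[P.d - j] q)]
      rw [eval_add, eval_mul, eval_X, eval_C, hco, zero_add]
      ring
  unfold value
  rw [key _ le_rfl, Nat.sub_self]; rfl

/-- There is a detector for every polynomial and each of the two conventions. -/
theorem exists_represents (degenerate : Prop) (p : Polynomial ℝ) (K : ℕ) :
    ∃ (P : Detector) (q : Polynomial ℤ), P.K = K ∧
      (∀ m L, { P with m := m }.value L = q.eval L) ∧
      ∀ m, Represents { P with m := m } degenerate p := by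
  classical
  obtain ⟨D, q, hD, hq⟩ := exists_int_equation p
  have hB : ∀ j : ℕ, |q.coeff j| ≤ ((∑ i ∈ Finset.range (q.natDegree + 1), (q.coeff i).natAbs : ℕ) : ℤ) := by
    intro j
    rw [Int.abs_eq_natAbs, Nat.cast_le]
    by_cases hj : j ≤ q.natDegree
    · exact Finset.single_le_sum (f := fun i => (q.coeff i).natAbs) (fun _ _ => Nat.zero_le _)
        (Finset.mem_range.2 (Nat.lt_succ_of_le hj))
    · rw [Polynomial.coeff_eq_zero_of_natDegree_lt (by omega)]; simp
  let P : Detector :=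
    { K := K
      d := q.natDegree
      coef := fun j => q.coeff (q.natDegree - j)
      D := D
      B := D + ∑ i ∈ Finset.range (q.natDegree + 1), (q.coeff i).natAbs
      seg := if h : degenerate ∧ ∃ l : ℕ, (l : ℝ) = p.eval 0 then some h.2.choose else none
      m := 0
      one_le_B := by omega
      D_le := by omega
      coef_le := fun j => (hB _).trans (by push_cast; omega) }
  have hval : ∀ m, ∀ L, value { P with m := m } L = q.eval L := fun m L =>
    value_eq_eval (P := { P with m := m }) rfl (fun _ => rfl) L
  refine ⟨P, q, rfl, hval, fun m => ⟨fun h l => ?_, fun l _ => ?_⟩⟩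
  · rw [hval m, hq]
  · change (if h : degenerate ∧ ∃ l : ℕ, (l : ℝ) = p.eval 0 then some h.2.choose else none) = some l ↔ _
    split_ifs with h
    · have h1 := h.2.choose_spec
      rw [Option.some_inj]
      constructor
      · intro h2; rw [← h2]; exact ⟨h.1, h1⟩
      · rintro ⟨-, h2⟩
        rw [← h1] at h2
        exact_mod_cast h2.symm
    · simp only [false_iff]
      exact fun h2 => h ⟨h2.1, l, h2.2⟩

end Detector

/-! ### The probability of favourable coin tosses -/

open MeasureTheory ProbabilityTheory

/-- The law of the coin tosses. -/
noncomputable def tosses (m : ℕ) : Measure (ℕ × Node → Fin (2 * (m + 1))) :=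
  Measure.infinitePi fun _ => (PMF.uniformOfFintype (Fin (2 * (m + 1)))).toMeasure

instance (m : ℕ) : IsProbabilityMeasure (tosses m) := by unfold tosses; infer_instance

theorem tosses_box {m : ℕ} (s : Finset (ℕ × Node)) (A : ℕ × Node → Set (Fin (2 * (m + 1)))) :
    (tosses m).real {ω | ∀ i ∈ s, ω i ∈ A i} =
      ∏ i ∈ s, (PMF.uniformOfFintype (Fin (2 * (m + 1)))).toMeasure.real (A i) := by
  have h : {ω : ℕ × Node → Fin (2 * (m + 1)) | ∀ i ∈ s, ω i ∈ A i} = Set.pi s A := rfl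
  rw [h, Measure.real, tosses, Measure.infinitePi_pi _ (fun i _ => (Set.toFinite _).measurableSet),
    ENNReal.toReal_prod]
  rfl

theorem uniform_real {m : ℕ} (A : Set (Fin (2 * (m + 1)))) :
    (PMF.uniformOfFintype (Fin (2 * (m + 1)))).toMeasure.real A = A.ncard / (2 * (m + 1) : ℕ) := by
  classical
  rw [Measure.real, PMF.toMeasure_uniformOfFintype_apply A (Set.toFinite _).measurableSet,
    ENNReal.toReal_div, ENNReal.toReal_natCast, ENNReal.toReal_natCast, Fintype.card_fin,
    ← Nat.card_eq_fintype_card, Nat.card_coe_set_eq]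

/-- Each parity is equally likely. -/
theorem uniform_parity (m : ℕ) (b : Bool) :
    (PMF.uniformOfFintype (Fin (2 * (m + 1)))).toMeasure.real {x | decide (x.val % 2 = 1) = b} =
      1 / 2 := by
  let e : Fin (m + 1) ≃ {x : Fin (2 * (m + 1)) | decide (x.val % 2 = 1) = b} :=
    { toFun := fun i => ⟨⟨2 * i + b.toNat, by have := i.2; cases b <;> simp <;> omega⟩, by
        cases b <;> simp⟩
      invFun := fun x => ⟨x.1 / 2, by have := x.1.2; omega⟩
      left_inv := fun i => by cases b <;> ext <;> simp; omega
      right_inv := by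
        rintro ⟨⟨x, hx⟩, h⟩
        ext
        cases b <;> simp at h ⊢ <;> omega }
  rw [uniform_real, ← Nat.card_coe_set_eq, ← Nat.card_congr e, Nat.card_fin]
  push_cast
  field_simp

/-- The probability that an amoebot stays alive for one more round. -/
noncomputable def survival (m : ℕ) : ℝ := 1 - 1 / (2 * (m + 1))

theorem uniform_ne_zero (m : ℕ) :
    (PMF.uniformOfFintype (Fin (2 * (m + 1)))).toMeasure.real {x | x.val ≠ 0} = survival m := by
  have h1 : {x : Fin (2 * (m + 1)) | x.val ≠ 0} = {(⟨0, by omega⟩ : Fin (2 * (m + 1)))}ᶜ := by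
    ext x
    rw [Set.mem_compl_singleton_iff, ne_eq, Fin.ext_iff]
    rfl
  rw [h1, probReal_compl_eq_one_sub (Set.toFinite _).measurableSet, uniform_real,
    Set.ncard_singleton, survival]
  push_cast
  rfl

/-- The probability that two amoebots do not draw different coins in `R` rounds. -/
theorem tosses_tie {m : ℕ} {u v : Node} (huv : u ≠ v) (R : ℕ) :
    (tosses m).real {ω | ∀ s < R, ((ω (2 * s, u)).val % 2 = 1 ↔ (ω (2 * s, v)).val % 2 = 1)} ≤
      (1 / 2) ^ R := by
  classical
  set I : Finset (ℕ × Node) := (Finset.range R ×ˢ {u, v}).image fun p => (2 * p.1, p.2) with hI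
  have hcard : I.card = 2 * R := by
    rw [hI, Finset.card_image_of_injective, Finset.card_product, Finset.card_range,
      Finset.card_pair huv, mul_comm]
    rintro ⟨a, b⟩ ⟨a', b'⟩ h
    simp only [Prod.mk.injEq] at h
    exact Prod.ext (by simp only; omega) h.2
  have hmem : ∀ s < R, (2 * s, u) ∈ I ∧ (2 * s, v) ∈ I := fun s hs =>
    ⟨Finset.mem_image.2 ⟨(s, u), by simp [hs], rfl⟩, Finset.mem_image.2 ⟨(s, v), by simp [hs], rfl⟩⟩
  have hmem' : ∀ i ∈ I, ∃ s < R, i = (2 * s, u) ∨ i = (2 * s, v) := by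
    intro i hi
    obtain ⟨⟨s, w⟩, hp, rfl⟩ := Finset.mem_image.1 hi
    simp only [Finset.mem_product, Finset.mem_range, Finset.mem_insert, Finset.mem_singleton] at hp
    obtain ⟨hs, rfl | rfl⟩ := hp
    · exact ⟨s, hs, Or.inl rfl⟩
    · exact ⟨s, hs, Or.inr rfl⟩
  -- the common sequence of coins
  let box : (Fin R → Bool) → Set (ℕ × Node → Fin (2 * (m + 1))) := fun σ =>
    {ω | ∀ i ∈ I, ω i ∈ {x : Fin (2 * (m + 1)) |
      decide (x.val % 2 = 1) = if h : i.1 / 2 < R then σ ⟨i.1 / 2, h⟩ else false}}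
  have hbox : ∀ σ, (tosses m).real (box σ) = (1 / 4) ^ R := by
    intro σ
    rw [tosses_box, Finset.prod_congr rfl fun i _ => uniform_parity m _, Finset.prod_const, hcard,
      pow_mul]
    norm_num
  calc (tosses m).real {ω | ∀ s < R, ((ω (2 * s, u)).val % 2 = 1 ↔ (ω (2 * s, v)).val % 2 = 1)}
      ≤ (tosses m).real (⋃ σ ∈ (Finset.univ : Finset (Fin R → Bool)), box σ) := by
        refine measureReal_mono (fun ω hω => ?_) (measure_ne_top _ _)
        simp only [Finset.mem_univ, Set.iUnion_true, Set.mem_iUnion]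
        refine ⟨fun s => decide ((ω (2 * s, u)).val % 2 = 1), fun i hi => ?_⟩
        obtain ⟨s, hs, rfl | rfl⟩ := hmem' i hi
        · simp [hs]
        · simp [hs, hω s hs]
    _ ≤ ∑ σ ∈ (Finset.univ : Finset (Fin R → Bool)), (tosses m).real (box σ) :=
        measureReal_biUnion_finset_le _ _
    _ = (1 / 2) ^ R := by
        rw [Finset.sum_congr rfl fun σ _ => hbox σ, Finset.sum_const, Finset.card_univ]
        simp only [Fintype.card_pi, Fintype.card_bool, Finset.prod_const, Finset.card_univ,
          Fintype.card_fin, nsmul_eq_mul]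
        push_cast
        rw [← mul_pow]
        norm_num

/-- The probability that all amoebots of a set survive `N` rounds. -/
theorem tosses_alive {m : ℕ} (U : Finset Node) (N : ℕ) :
    (tosses m).real {ω | ∀ u ∈ U, ∀ s < N, (ω (s, u)).val ≠ 0} = (survival m ^ N) ^ U.card := by
  have h : {ω : ℕ × Node → Fin (2 * (m + 1)) | ∀ u ∈ U, ∀ s < N, (ω (s, u)).val ≠ 0} =
      {ω | ∀ i ∈ Finset.range N ×ˢ U, ω i ∈ {x : Fin (2 * (m + 1)) | x.val ≠ 0}} := by
    ext ω
    constructor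
    · rintro h ⟨s, u⟩ hs
      rw [Finset.mem_product, Finset.mem_range] at hs
      exact h u hs.2 s hs.1
    · intro h u hu s hs
      exact h (s, u) (Finset.mem_product.2 ⟨Finset.mem_range.2 hs, hu⟩)
  rw [h, tosses_box, Finset.prod_congr rfl fun i _ => uniform_ne_zero m, Finset.prod_const,
    Finset.card_product, Finset.card_range, pow_mul]

/-- The probability that no amoebot of a set survives `N` rounds. -/
theorem tosses_dead {m : ℕ} (U : Finset Node) (N : ℕ) :
    (tosses m).real {ω | ∀ u ∈ U, ∃ s < N, (ω (s, u)).val = 0} = (1 - survival m ^ N) ^ U.card := by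
  set B : Node → Set (ℕ × Node → Fin (2 * (m + 1))) :=
    fun u => {ω | ∀ s < N, (ω (s, u)).val ≠ 0} with hB
  have hmeas : ∀ u, MeasurableSet (B u) := by
    intro u
    have : B u = ⋂ s ∈ Finset.range N, (fun ω => ω (s, u)) ⁻¹' {x | x.val ≠ 0} := by
      ext ω; simp [hB]
    rw [this]
    exact Finset.measurableSet_biInter _ fun s _ =>
      (measurable_pi_apply _) (Set.toFinite _).measurableSet
  have hreal : ∀ V : Finset Node, (tosses m).real (⋂ u ∈ V, B u) = (survival m ^ N) ^ V.card := by
    intro V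
    rw [← tosses_alive]
    congr 1
    ext ω; simp [hB]
  have hone : ∀ u, (tosses m).real (B u) = survival m ^ N := by
    intro u
    have := hreal {u}
    simpa using this
  have hind : iIndepSet B (tosses m) := by
    rw [iIndepSet_iff_meas_biInter hmeas]
    intro V
    rw [← ENNReal.toReal_eq_toReal_iff' (by finiteness)
      (ENNReal.prod_ne_top fun _ _ => by finiteness), ENNReal.toReal_prod]
    change (tosses m).real _ = ∏ u ∈ V, (tosses m).real (B u)
    rw [hreal, Finset.prod_congr rfl fun u _ => hone u, Finset.prod_const]
  have h1 := ((iIndepSet_iff_iIndep _ _).1 hind).meas_biInter (S := U) (s := fun u => (B u)ᶜ)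
    (fun u _ => (MeasurableSpace.measurableSet_generateFrom (Set.mem_singleton _)).compl)
  have h2 : {ω : ℕ × Node → Fin (2 * (m + 1)) | ∀ u ∈ U, ∃ s < N, (ω (s, u)).val = 0} =
      ⋂ u ∈ U, (B u)ᶜ := by
    ext ω; simp [hB]
  rw [h2, Measure.real, h1, ENNReal.toReal_prod]
  change ∏ u ∈ U, (tosses m).real (B u)ᶜ = _
  rw [Finset.prod_congr rfl fun u _ => by
    rw [probReal_compl_eq_one_sub (hmeas u), hone u], Finset.prod_const]

/-- A lower bound for the probability of favourable coin tosses. -/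
theorem le_tosses_favourable (m : ℕ) {S : Finset Node} (R N₁ N₂ : ℕ) :
    1 - (6 * S.card * (1 / 2) ^ R + (1 - survival m ^ N₁) ^ S.card + S.card * survival m ^ N₂) ≤
    (tosses m).real {ω | (∀ u g, GSide S u g → ∃ s < R,
        ¬ ((ω (2 * s, u)).val % 2 = 1 ↔ (ω (2 * s, u + dirVec g)).val % 2 = 1)) ∧
      (∃ u ∈ S, ∀ s < N₁, (ω (s, u)).val ≠ 0) ∧ ∀ u ∈ S, ∃ s < N₂, (ω (s, u)).val = 0} := by
  classical
  set G := {ω : ℕ × Node → Fin (2 * (m + 1)) | (∀ u g, GSide S u g → ∃ s < R,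
        ¬ ((ω (2 * s, u)).val % 2 = 1 ↔ (ω (2 * s, u + dirVec g)).val % 2 = 1)) ∧
      (∃ u ∈ S, ∀ s < N₁, (ω (s, u)).val ≠ 0) ∧ ∀ u ∈ S, ∃ s < N₂, (ω (s, u)).val = 0} with hG
  set E₁ := ⋃ p ∈ S ×ˢ (Finset.univ : Finset Dir), {ω : ℕ × Node → Fin (2 * (m + 1)) | ∀ s < R,
    ((ω (2 * s, p.1)).val % 2 = 1 ↔ (ω (2 * s, p.1 + dirVec p.2)).val % 2 = 1)} with hE₁
  set E₂ := {ω : ℕ × Node → Fin (2 * (m + 1)) | ∀ u ∈ S, ∃ s < N₁, (ω (s, u)).val = 0} with hE₂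
  set E₃ := ⋃ u ∈ S, {ω : ℕ × Node → Fin (2 * (m + 1)) | ∀ w ∈ ({u} : Finset Node), ∀ s < N₂,
    (ω (s, w)).val ≠ 0} with hE₃
  have h1 : (tosses m).real E₁ ≤ 6 * S.card * (1 / 2) ^ R := by
    refine (measureReal_biUnion_finset_le _ _).trans ?_
    refine (Finset.sum_le_sum fun p _ => tosses_tie (R := R) ?_).trans ?_
    · intro h
      exact dirVec_ne_zero p.2 (by simpa using h.symm)
    · rw [Finset.sum_const, Finset.card_product, Finset.card_univ, nsmul_eq_mul]
      have : Fintype.card Dir = 6 := rfl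
      rw [this]; push_cast
      exact le_of_eq (by ring)
  have h2 : (tosses m).real E₂ = (1 - survival m ^ N₁) ^ S.card := tosses_dead S N₁
  have h3 : (tosses m).real E₃ ≤ S.card * survival m ^ N₂ := by
    refine (measureReal_biUnion_finset_le _ _).trans (le_of_eq ?_)
    rw [Finset.sum_congr rfl fun u _ => tosses_alive {u} N₂]
    simp
  have hcov : (Set.univ : Set (ℕ × Node → Fin (2 * (m + 1)))) ⊆ G ∪ (E₁ ∪ E₂ ∪ E₃) := by
    intro ω _
    by_contra hω
    simp only [Set.mem_union, not_or] at hω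
    obtain ⟨hg, ⟨h1, h2⟩, h3⟩ := hω
    apply hg
    refine ⟨fun u g hs => ?_, ?_, fun u hu => ?_⟩
    · by_contra hne
      push Not at hne
      apply h1
      simp only [hE₁, Set.mem_iUnion]
      exact ⟨(u, g), Finset.mem_product.2 ⟨hs.mem, Finset.mem_univ _⟩, hne⟩
    · by_contra hne
      push Not at hne
      exact h2 hne
    · by_contra hne
      push Not at hne
      apply h3
      simp only [hE₃, Set.mem_iUnion]
      exact ⟨u, hu, by simpa using hne⟩
  have h4 := measureReal_mono (μ := tosses m) hcov (measure_ne_top _ _)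
  rw [probReal_univ] at h4
  have h5 := measureReal_union_le (μ := tosses m) G (E₁ ∪ E₂ ∪ E₃)
  have h6 := measureReal_union_le (μ := tosses m) (E₁ ∪ E₂) E₃
  have h7 := measureReal_union_le (μ := tosses m) E₁ E₂
  linarith

/-! ### Choice of the constants -/

/-- The number of binary digits of `n`. -/
def bits (n : ℕ) : ℕ := Nat.log 2 n + 1

theorem lt_two_pow_bits (n : ℕ) : n < 2 ^ bits n := Nat.lt_pow_succ_log_self one_lt_two n

theorem two_le_bits {n : ℕ} (hn : 2 ≤ n) : 2 ≤ bits n := by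
  have := Nat.log_pos one_lt_two hn
  unfold bits; omega

theorem two_pow_le_of_bits {n : ℕ} (hn : 2 ≤ n) : 2 ^ bits n ≤ 2 * n := by
  have := Nat.pow_log_le_self 2 (by omega : n ≠ 0)
  rw [bits, pow_succ]; omega

theorem bits_le {n : ℕ} (hn : 2 ≤ n) : bits n ≤ n := by
  have h1 := two_pow_le_of_bits hn
  have h2 : ∀ k, 1 ≤ k → 2 * k ≤ 2 ^ k := by
    intro k hk
    induction k, hk using Nat.le_induction with
    | base => norm_num
    | succ k hk ih => rw [pow_succ]; omega
  have := h2 (bits n) (by have := two_le_bits hn; omega)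
  omega

theorem log_le_bits {n : ℕ} (hn : 2 ≤ n) : Real.log n ≤ bits n := by
  have h1 : (n : ℝ) ≤ 2 ^ bits n := by exact_mod_cast (lt_two_pow_bits n).le
  have h2 := Real.log_le_log (by positivity) h1
  rw [Real.log_pow] at h2
  have h3 : Real.log 2 ≤ 1 := by
    have := Real.log_two_lt_d9
    linarith
  nlinarith [(Nat.cast_nonneg (bits n) : (0 : ℝ) ≤ bits n)]

theorem bits_le_log {n : ℕ} (hn : 2 ≤ n) : (bits n : ℝ) ≤ 4 * Real.log n := by
  have h1 : (2 : ℝ) ^ Nat.log 2 n ≤ n := by exact_mod_cast Nat.pow_log_le_self 2 (by omega : n ≠ 0)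
  have h2 := Real.log_le_log (by positivity) h1
  rw [Real.log_pow] at h2
  have h3 := Real.log_two_gt_d9
  have h4 : (1 : ℝ) ≤ Nat.log 2 n := by exact_mod_cast Nat.log_pos one_lt_two hn
  unfold bits
  push_cast
  nlinarith

theorem survival_nonneg (m : ℕ) : 0 ≤ survival m := by
  unfold survival
  rw [sub_nonneg, div_le_one (by positivity)]
  linarith [(Nat.cast_nonneg m : (0 : ℝ) ≤ m)]

theorem survival_lt_one (m : ℕ) : survival m < 1 := by
  unfold survival
  have : (0 : ℝ) < 1 / (2 * (m + 1)) := by positivity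
  linarith

/-- If the symbol `0` is rare enough, some amoebot stays alive for a long time: for small structures
because every amoebot does so with high probability, for large ones because there are many. -/
theorem exists_survival (b c : ℕ) : ∃ m : ℕ, ∀ n : ℕ, 2 ≤ n →
    (1 - survival m ^ (b * bits n)) ^ n ≤ (1 / 2 : ℝ) ^ (c * bits n + 2) := by
  obtain ⟨l₀, hl₀⟩ : ∃ l₀ : ℕ, ∀ l ≥ l₀, (2 * c + 4) * (l : ℝ) ≤ (3 / 2) ^ l := by
    have h := tendsto_pow_const_div_const_pow_of_one_lt 1 (by norm_num : (1 : ℝ) < 3 / 2)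
    have h2 := h.eventually (gt_mem_nhds (by positivity : (0 : ℝ) < 1 / (2 * c + 4)))
    obtain ⟨l₀, h3⟩ := Filter.eventually_atTop.1 h2
    refine ⟨l₀, fun l hl => ?_⟩
    have h4 := h3 l hl
    rw [pow_one, div_lt_div_iff₀ (by positivity) (by positivity)] at h4
    linarith
  -- small structures require `l₀ * ε ≤ (1 / 2) ^ (c + 2)`, large ones `1 - ε ≥ 3 / 4`
  set ε : ℝ := min (1 / 4) ((1 / 2) ^ (c + 2) / (l₀ + 1)) with hε
  have hε0 : 0 < ε := by rw [hε]; positivity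
  obtain ⟨m, hm⟩ := exists_nat_gt ((b : ℝ) / ε)
  refine ⟨m, fun n hn => ?_⟩
  set l := bits n with hl
  set x := survival m ^ b with hx
  have hx1 : x ≤ 1 := pow_le_one₀ (survival_nonneg m) (survival_lt_one m).le
  have hx0 : 0 ≤ x := pow_nonneg (survival_nonneg m) b
  have hxε : 1 - ε ≤ x := by
    have h1 := one_add_mul_le_pow (a := -(1 / (2 * ((m : ℝ) + 1)))) (by
      have : 1 / (2 * ((m : ℝ) + 1)) ≤ 1 := by
        rw [div_le_one (by positivity)]; linarith [(Nat.cast_nonneg m : (0 : ℝ) ≤ m)]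
      linarith) b
    have h2 : x = (1 + -(1 / (2 * ((m : ℝ) + 1)))) ^ b := by rw [hx, survival]; ring
    rw [div_lt_iff₀ hε0] at hm
    have h3 : (b : ℝ) * (1 / (2 * ((m : ℝ) + 1))) ≤ ε := by
      rw [mul_one_div, div_le_iff₀ (by positivity)]
      nlinarith [(Nat.cast_nonneg m : (0 : ℝ) ≤ m)]
    rw [h2]
    linarith
  rw [pow_mul]
  have hxl1 : x ^ l ≤ 1 := pow_le_one₀ hx0 hx1
  by_cases hll : l ≤ l₀
  · have h1 : 1 - x ^ l ≤ (1 / 2) ^ (c + 2) := by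
      have h2 := one_add_mul_le_pow (a := x - 1) (by linarith) l
      have h3 : (l : ℝ) * ε ≤ (1 / 2) ^ (c + 2) := by
        have h4 : ε ≤ (1 / 2) ^ (c + 2) / (l₀ + 1) := min_le_right _ _
        rw [le_div_iff₀ (by positivity)] at h4
        have h5 : (l : ℝ) ≤ l₀ := by exact_mod_cast hll
        nlinarith
      have h4 : (l : ℝ) * (1 - x) ≤ l * ε := by
        apply mul_le_mul_of_nonneg_left (by linarith) (Nat.cast_nonneg l)
      have h5 : (1 + (x - 1)) ^ l = x ^ l := by ring
      rw [h5] at h2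
      linarith
    calc (1 - x ^ l) ^ n ≤ ((1 / 2) ^ (c + 2)) ^ n := pow_le_pow_left₀ (by linarith) h1 n
      _ = (1 / 2) ^ ((c + 2) * n) := by rw [pow_mul]
      _ ≤ (1 / 2) ^ (c * l + 2) := by
        apply pow_le_pow_of_le_one (by norm_num) (by norm_num)
        have := bits_le hn
        nlinarith
  · have h1 : (3 / 4 : ℝ) ^ l ≤ x ^ l := by
      apply pow_le_pow_left₀ (by norm_num)
      have : ε ≤ 1 / 4 := min_le_left _ _
      linarith
    have h2 : (2 : ℝ) ^ l ≤ 2 * n := by exact_mod_cast two_pow_le_of_bits hn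
    have h3 : (c * l + 2 : ℕ) ≤ x ^ l * n := by
      have h4 := hl₀ l (by omega)
      have h5 : (3 / 2 : ℝ) ^ l = (3 / 4) ^ l * 2 ^ l := by rw [← mul_pow]; norm_num
      have h6 : (3 / 4 : ℝ) ^ l * 2 ^ l ≤ x ^ l * (2 * n) := by
        apply mul_le_mul h1 h2 (by positivity) (by positivity)
      have h7 : (1 : ℝ) ≤ l := by exact_mod_cast (by have := two_le_bits hn; omega : 1 ≤ l)
      push_cast
      nlinarith
    calc (1 - x ^ l) ^ n ≤ (Real.exp (-x ^ l)) ^ n :=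
          pow_le_pow_left₀ (by linarith) (Real.one_sub_le_exp_neg _) n
      _ = Real.exp (-(x ^ l * n)) := by rw [← Real.exp_nat_mul]; congr 1; ring
      _ ≤ Real.exp (-((c * l + 2 : ℕ) : ℝ)) := by
          apply Real.exp_le_exp.2; linarith
      _ = (Real.exp (-1)) ^ (c * l + 2) := by rw [← Real.exp_nat_mul]; congr 1; ring
      _ ≤ (1 / 2) ^ (c * l + 2) := by
          apply pow_le_pow_left₀ (Real.exp_pos _).le
          rw [Real.exp_neg, one_div]
          apply inv_anti₀ (by norm_num)
          have := Real.add_one_le_exp 1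
          linarith

/-- No amoebot stays alive for a large multiple of `log n` rounds. -/
theorem exists_extinction (m c : ℕ) : ∃ e : ℕ, ∀ n : ℕ, 2 ≤ n →
    (n : ℝ) * survival m ^ (e * bits n) ≤ (1 / 2) ^ (c * bits n + 2) := by
  obtain ⟨e, he⟩ := exists_pow_lt_of_lt_one (by positivity : (0 : ℝ) < (1 / 2) ^ (c + 3))
    (survival_lt_one m)
  refine ⟨e, fun n hn => ?_⟩
  have h1 : (n : ℝ) ≤ 2 ^ bits n := by exact_mod_cast (lt_two_pow_bits n).le
  have h0 := survival_nonneg m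
  calc (n : ℝ) * survival m ^ (e * bits n) ≤ 2 ^ bits n * ((1 / 2) ^ (c + 3)) ^ bits n := by
        rw [pow_mul]
        apply mul_le_mul h1 (pow_le_pow_left₀ (by positivity) he.le _) (by positivity) (by positivity)
    _ = (1 / 2) ^ ((c + 2) * bits n) := by
        rw [pow_mul, ← mul_pow, pow_succ]
        congr 1
        ring
    _ ≤ (1 / 2) ^ (c * bits n + 2) := by
        apply pow_le_pow_of_le_one (by norm_num) (by norm_num)
        have := two_le_bits hn
        nlinarith

/-- The error probability of the coin tosses on the side edges. -/
theorem tie_bound (c : ℕ) {n : ℕ} (hn : 2 ≤ n) :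
    6 * (n : ℝ) * (1 / 2) ^ ((c + 4) * bits n) ≤ (1 / 2) ^ (c * bits n + 2) := by
  have h1 : (n : ℝ) ≤ 2 ^ bits n := by exact_mod_cast (lt_two_pow_bits n).le
  have h2 : (2 : ℝ) ^ bits n * (1 / 2) ^ bits n = 1 := by rw [← mul_pow]; norm_num
  have h3 : (1 / 2 : ℝ) ^ (3 * bits n) ≤ (1 / 2) ^ 6 :=
    pow_le_pow_of_le_one (by norm_num) (by norm_num) (by have := two_le_bits hn; omega)
  have h4 : (1 / 2 : ℝ) ^ ((c + 4) * bits n) =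
      (1 / 2) ^ (c * bits n) * (1 / 2) ^ (3 * bits n) * (1 / 2) ^ bits n := by
    rw [← pow_add, ← pow_add]; congr 1; ring
  rw [h4, pow_add]
  have h5 : (0 : ℝ) < (1 / 2) ^ (c * bits n) := by positivity
  have h6 : (0 : ℝ) < (1 / 2) ^ bits n := by positivity
  have h7 : (n : ℝ) * (1 / 2) ^ bits n ≤ 1 :=
    (mul_le_mul_of_nonneg_right h1 h6.le).trans_eq h2
  calc 6 * (n : ℝ) * ((1 / 2) ^ (c * bits n) * (1 / 2) ^ (3 * bits n) * (1 / 2) ^ bits n)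
      = 6 * (1 / 2) ^ (c * bits n) * ((1 / 2) ^ (3 * bits n)) * (n * (1 / 2) ^ bits n) := by ring
    _ ≤ 6 * (1 / 2) ^ (c * bits n) * ((1 / 2) ^ 6) * 1 := by
        apply mul_le_mul _ h7 (by positivity) (by positivity)
        exact mul_le_mul_of_nonneg_left h3 (by positivity)
    _ ≤ (1 / 2) ^ (c * bits n) * (1 / 2) ^ 2 := by
        nlinarith

open Polynomial in
theorem exists_eval_le (q : ℤ[X]) : ∃ γ : ℕ, ∀ n : ℕ, 2 ≤ n → ∀ h : ℕ, h < n →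
    |q.eval (h : ℤ)| ≤ 2 ^ (γ * bits n) := by
  induction q using Polynomial.induction_on' with
  | add p q hp hq =>
    obtain ⟨γ₁, h₁⟩ := hp
    obtain ⟨γ₂, h₂⟩ := hq
    refine ⟨γ₁ + γ₂ + 1, fun n hn h hh => ?_⟩
    rw [eval_add]
    have hb := two_le_bits hn
    have e1 : (2 : ℤ) ^ (γ₁ * bits n) ≤ 2 ^ ((γ₁ + γ₂) * bits n) :=
      pow_le_pow_right₀ (by norm_num) (by nlinarith)
    have e2 : (2 : ℤ) ^ (γ₂ * bits n) ≤ 2 ^ ((γ₁ + γ₂) * bits n) :=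
      pow_le_pow_right₀ (by norm_num) (by nlinarith)
    have e3 : (2 : ℤ) ^ ((γ₁ + γ₂) * bits n + 1) ≤ 2 ^ ((γ₁ + γ₂ + 1) * bits n) :=
      pow_le_pow_right₀ (by norm_num) (by nlinarith)
    rw [pow_succ] at e3
    have e4 := abs_add_le (p.eval (h : ℤ)) (q.eval (h : ℤ))
    have e5 := h₁ n hn h hh
    have e6 := h₂ n hn h hh
    linarith
  | monomial k a =>
    refine ⟨a.natAbs + k, fun n hn h hh => ?_⟩
    have hb := two_le_bits hn
    rw [eval_monomial, abs_mul, abs_pow, add_mul, pow_add, mul_comm k, pow_mul 2 (bits n)]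
    have e1 : |a| ≤ 2 ^ (a.natAbs * bits n) := by
      rw [Int.abs_eq_natAbs]
      have : a.natAbs ≤ 2 ^ (a.natAbs * bits n) :=
        Nat.lt_two_pow_self.le.trans
          (Nat.pow_le_pow_right (by norm_num) (Nat.le_mul_of_pos_right _ (by omega)))
      exact_mod_cast this
    have e2 : |(h : ℤ)| ≤ 2 ^ bits n := by
      rw [Nat.abs_cast]
      exact_mod_cast (hh.trans (lt_two_pow_bits n)).le
    exact mul_le_mul e1 (pow_le_pow_left₀ (abs_nonneg _) e2 k) (by positivity) (by positivity)

/-- A number of passes that suffices for an exact comparison. -/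
theorem exists_enough_passes (q : Polynomial ℤ) (D : ℕ) : ∃ γ : ℕ, ∀ n : ℕ, 2 ≤ n →
    n < 2 ^ (γ * bits n) ∧ ∀ h l : ℕ, h < n → l < n →
      |D * (l : ℤ) - q.eval (h : ℤ)| < 2 ^ (γ * bits n) := by
  obtain ⟨γ, hγ⟩ := exists_eval_le
    (Polynomial.X * Polynomial.C (D : ℤ))
  obtain ⟨γ', hγ'⟩ := exists_eval_le q
  refine ⟨γ + γ' + 2, fun n hn => ⟨?_, fun h l hh hl => ?_⟩⟩
  · exact (lt_two_pow_bits n).trans_le (Nat.pow_le_pow_right (by norm_num) (by nlinarith))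
  · have hb := two_le_bits hn
    have e1 := hγ n hn l hl
    have e2 := hγ' n hn h hh
    simp only [Polynomial.eval_mul, Polynomial.eval_X, Polynomial.eval_C] at e1
    have e3 : (2 : ℤ) ^ (γ * bits n) ≤ 2 ^ ((γ + γ') * bits n) :=
      pow_le_pow_right₀ (by norm_num) (by nlinarith)
    have e4 : (2 : ℤ) ^ (γ' * bits n) ≤ 2 ^ ((γ + γ') * bits n) :=
      pow_le_pow_right₀ (by norm_num) (by nlinarith)
    have e5 : (2 : ℤ) ^ ((γ + γ') * bits n + 2) ≤ 2 ^ ((γ + γ' + 2) * bits n) :=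
      pow_le_pow_right₀ (by norm_num) (by nlinarith)
    have e6 : (2 : ℤ) ^ ((γ + γ') * bits n + 2) = 4 * 2 ^ ((γ + γ') * bits n) := by
      rw [pow_add]; ring
    have e7 := abs_sub (D * (l : ℤ)) (q.eval (h : ℤ))
    rw [mul_comm (l : ℤ)] at e1
    have e8 : (0 : ℤ) < 2 ^ ((γ + γ') * bits n) := by positivity
    linarith

theorem mainTheorem7 (p : Polynomial ℝ) (degenerate : Prop) (k : ℕ) (hk : 2 ≤ k) (c : ℕ) :
    ∃ (A : AmoebotAlgorithm k) (C₁ C₂ : ℝ), 0 < C₁ ∧ 0 < C₂ ∧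
      ∀ S : Finset Node, IsAmoebotStructure S → ∀ frame : Node → Frame,
        1 - 1 / (S.card : ℝ) ^ c ≤
          A.coins.real {ω | ∃ t : ℕ,
            C₁ * Real.log S.card ≤ t ∧ (t : ℝ) ≤ C₂ * Real.log S.card ∧
              A.DecidesIn S frame (FormsPolynomialParallelogram degenerate p S) ω t} := by
  obtain ⟨K, rfl⟩ : ∃ K, k = K + 2 := ⟨k - 2, by omega⟩
  obtain ⟨P₀, q, rfl, hval, hrep⟩ := Detector.exists_represents degenerate p K
  obtain ⟨γ, hγ⟩ := exists_enough_passes q P₀.D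
  -- `b * bits n` rounds leave time for the coin tosses, the constantly many rounds before the main
  -- loop, and `γ * bits n` passes
  set b := 2 * (c + 4) + 5 + P₀.r₀ + P₀.passLength * γ with hb
  obtain ⟨m, hm⟩ := exists_survival b c
  obtain ⟨e, he⟩ := exists_extinction m c
  let P : Detector := { P₀ with m := m }
  set C : ℕ := 2 * (c + 4) + 6 + P₀.r₀ + P₀.passLength + e with hC
  refine ⟨P.alg, 1, 4 * C, one_pos, by rw [hC]; positivity, fun S hS frame => ?_⟩
  change _ ≤ (tosses m).real _
  have hpos : 1 ≤ S.card := by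
    obtain ⟨⟨u, hu⟩⟩ := hS.nonempty
    exact Finset.card_pos.2 ⟨u, hu⟩
  rcases hpos.eq_or_lt with h1 | hcard
  · -- a single amoebot: the bound for the probability is `0`
    rw [← h1]
    simp only [Nat.cast_one, one_pow, div_one, sub_self]
    exact MeasureTheory.measureReal_nonneg
  replace hcard : 2 ≤ S.card := hcard
  set l := bits S.card with hl
  have hl2 : 2 ≤ l := two_le_bits hcard
  refine le_trans ?_ ((le_tosses_favourable m (S := S) ((c + 4) * l) (b * l) (e * l)).trans
    (MeasureTheory.measureReal_mono ?_ (MeasureTheory.measure_ne_top _ _)))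
  · have h1 := tie_bound c hcard
    have h2 := hm S.card hcard
    have h3 := he S.card hcard
    have h4 : (1 / 2 : ℝ) ^ (c * l + 2) = (1 / 2) ^ (c * l) / 4 := by rw [pow_add]; ring
    have h5 : (1 / 2 : ℝ) ^ (c * l) ≤ 1 / (S.card : ℝ) ^ c := by
      rw [one_div_pow]
      apply one_div_le_one_div_of_le (by positivity)
      rw [mul_comm c, pow_mul]
      apply pow_le_pow_left₀ (by positivity)
      exact_mod_cast (lt_two_pow_bits S.card).le
    have h6 : (0 : ℝ) < (1 / 2 : ℝ) ^ (c * l) := by positivity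
    rw [← hl, h4] at h1 h2 h3
    linarith
  · rintro ω ⟨hdiff, hlo, hhi⟩
    obtain ⟨t, ht1, ht2, ht⟩ := Detector.exists_decidesIn (P := P) (frame := frame) hS hcard (hrep m)
      (R₁ := (c + 4) * l) (by nlinarith) hdiff hlo hhi (by
        intro T hT
        have hT' : γ * l ≤ T := by
          by_contra hlt
          have e1 : P₀.passLength * T ≤ P₀.passLength * (γ * l) := Nat.mul_le_mul_left _ (by omega)
          have e2 : b * l = 2 * ((c + 4) * l) + (5 + P₀.r₀) * l + P₀.passLength * (γ * l) := by
            rw [hb]; ring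
          have e3 : 5 + P₀.r₀ ≤ (5 + P₀.r₀) * l := Nat.le_mul_of_pos_right _ (by omega)
          have e4 : b * l < 2 * ((c + 4) * l) + 5 + P₀.r₀ + P₀.passLength * T := hT
          omega
        obtain ⟨g1, g2⟩ := hγ S.card hcard
        refine ⟨g1.trans_le (Nat.pow_le_pow_right (by norm_num) hT'), fun h l' hh hl' => ?_⟩
        have hv : P.value h = q.eval (h : ℤ) := hval m h
        rw [hv]
        exact (g2 h l' hh hl').trans_le (pow_le_pow_right₀ (by norm_num) hT'))
    refine ⟨t, ?_, ?_, ht⟩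
    · have h1 := log_le_bits hcard
      have h2 : l ≤ t := le_trans (Nat.le_mul_of_pos_left _ (by omega)) ht1
      have h3 : (l : ℝ) ≤ t := by exact_mod_cast h2
      linarith
    · have h1 := bits_le_log hcard
      have h2 : t ≤ C * l := by
        refine ht2.trans ?_
        have e1 : C * l = 2 * ((c + 4) * l) + (6 + P₀.r₀ + P₀.passLength) * l + e * l := by
          rw [hC]; ring
        have e2 : 6 + P₀.r₀ + P₀.passLength ≤ (6 + P₀.r₀ + P₀.passLength) * l :=
          Nat.le_mul_of_pos_right _ (by omega)
        have e3 : P.r₀ = P₀.r₀ := rfl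
        have e4 : P.passLength = P₀.passLength := rfl
        rw [e3, e4]
        omega
      have h3 : (t : ℝ) ≤ C * l := by exact_mod_cast h2
      have h4 : (C : ℝ) * l ≤ C * (4 * Real.log S.card) :=
        mul_le_mul_of_nonneg_left h1 (Nat.cast_nonneg _)
      linarith
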